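/- **Setting.** Let $D\ge1$, let $\Lambda_d$ ($d=1,\dots,D$) be diagonal $L\times L$ matrices, $P\in\mathbb R^{q\times L}$, and $M:\mathbb R^q\to\mathbb R^L$ Lipschitz continuous. Let $\mathcal U\subset\mathbb R^q$ be an open set of states on which $M$ is $C^2$ and $PM(w)=w$, $P\Lambda_dM(w)=A_d(w)$. The kinetic model $\partial_tf+\sum_d\Lambda_d\partial_{x_d}f=\frac1\varepsilon(M(Pf)-f)$ relaxes to $\partial_tu+\sum_d\partial_{x_d}A_d(u)=0$. **Mesh and residuals.** Consider locally finite conforming simplicial meshes whose elements $K$ lie in an open set $\Omega\subset\mathbb R^D$, have diameter at most $h$ and contain a ball of radius $h/\kappa$ ($\kappa>0$ fixed). Let $\varphi_\sigma$ be the Bernstein basis of degree $p\ge1$, with degrees of freedom $\sigma$ identified with their domain points, $g_h=\sum_\sigma g_\sigma\varphi_\sigma$, and $|\mathcal C_\sigma|=\int\varphi_\sigma\,dx$. Write $\sigma\in K$ if $\sigma$ is a domain point of $K$. Nodal advection residuals $\phi^K_{ad,\sigma}$ are *consistent* if they are continuous functions of the coefficients at the degrees of freedom and, for each $R>0$, there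 are $C$ and a number $r$ of layers such that on all such meshes the following holds. If, for all $\tau$ in $r$ layers of elements around $\sigma$, $|f_\tau-(a+B(\tau-\sigma))|\le\delta$ with $|a|,\|B\|\le R$ and $0\le\delta\le Rh$, then $$\Big|\tfrac1{|\mathcal C_\sigma|}\sum_{K\ni\sigma}\phi^K_{ad,\sigma}(f)-\sum_d\Lambda_dBe_d\Big|\le C\Big(\frac{\delta}{h}+h\Big).$$ **Scheme.** Let $0=c_0<\dots<c_S=1$, $S\ge1$, $\Delta t^m=c_m\Delta t$, $t^m=t^n+\Delta t^m$, and let $\mathcal I$ be polynomial interpolation in time at the nodes $t^0,\dots,t^S$. In each timestep $n$, the value at $m=0$ is that of time $t^n$ for all iterations. For $m=1,\dots,S$ the prediction $k=1$ solves $\mathcal L^{1,m}_{\sigma,u}=0$, $\mathcal L^{1,m}_\sigma=0$, and the corrections $k+1=2,\dots,\mathcal K$ solve $\mathcal L^{1,(k+1)}-\mathcal L^{1,(k)}+\mathcal L^{2,(k)}=0$, both for $u$ and $f$, where $$\mathcal L^{1,m}_{\sigma,u}=|\mathcal C_\sigma|(u^m_\sigma-Pf^0_\sigma)+\Delta t^m\sum_{K\ni\sigma}P\phi^K_{ad,\sigma}(f^0),$$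 $$\mathcal L^{1,m}_{\sigma}=|\mathcal C_\sigma|\Big(1+\frac{\Delta t^m}\varepsilon\Big)f^m_\sigma-|\mathcal C_\sigma|f^0_\sigma+\Delta t^m\sum_{K\ni\sigma}\phi^K_{ad,\sigma}(f^0)-|\mathcal C_\sigma|\frac{\Delta t^m}\varepsilon M(u^m_\sigma),$$ $$\mathcal L^{2,m}_{\sigma}=\sum_{K\ni\sigma}\Big[\int_K\varphi_\sigma(f^m_h-f^0_h)\,dx+\int_{t^0}^{t^m}\mathcal I\big(\phi^K_\sigma(f^0),\dots,\phi^K_\sigma(f^S),s\big)ds\Big],$$ $$\phi^K_\sigma(f)=\phi^K_{ad,\sigma}(f)-\int_K\varphi_\sigma\frac{M(Pf_h)-f_h}\varepsilon\,dx,$$ and $\mathcal L^{2,m}_{\sigma,u}$ is the same expression as $\mathcal L^{2,m}_\sigma$ with $u_h$ and $P\phi^K_{ad,\sigma}(f)$ in place of $f_h$ and $\phi^K_\sigma(f)$. The new time level is the result for $k=\mathcal K\ge1$, $m=S$. The initial data are well prepared: $f^0_\sigma=M(u^0_\sigma)$. **Theorem.** 1. For any real $\theta_1,\dots,\theta_p$,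 the Galerkin residuals $\int_K\varphi_\sigma\sum_d\Lambda_d\partial_{x_d}f_h\,dx$ with jump stabilization $\sum_{k=1}^p\sum_{e\subset\partial K}\theta_kh_e^{2k}\int_e[\partial_n^kf_h][\partial_n^k\varphi_\sigma]\,d\Gamma$ are consistent. The sum is over interior faces $e$; $h_e$ is the diameter of $e$, or of $K$ if $D=1$. 2. For any consistent residuals the scheme has a solution for every $\varepsilon>0$, every such mesh and every $\Delta t>0$. For fixed mesh, $\Delta t$ and initial coefficients $u^0_\sigma$, all predictions and corrections converge as $\varepsilon\to0^+$. 3. For any consistent residuals, any compact $\mathcal Q\subset\mathcal U$, any $R$, any CFL constant $\gamma$ and any number $N$ of timesteps, there are $C$ and $h_0>0$, independent of $\varepsilon$, mesh, $\Delta t$ and data, with the following property. Let $h\le h_0$, $0<\Delta t\le\gamma h$, and let the initial coefficients satisfy $|u^0_\sigma-u_0(\sigma)|\le Rh^2$, where $u_0\in C^2(\Omega;\mathbb R^q)$ has values in $\mathcal Q$ and first and second derivatives bounded by $R$. Then for all $\varepsilon>0$, $n\le N$, $1\le k\le\mathcal K$, $1\le m\le S$, all $\sigma$, all $K\ni\sigma$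 and all $x\in K$ (for instance $x=\sigma$): $$\frac{u^{n,m,(k)}_\sigma-u^n_\sigma}{\Delta t^m}+\sum_d\partial_{x_d}A_d\big(u_h^{n,m,(k)}\big)(x)=O(\varepsilon+h),\qquad f^{n,m,(k)}_\sigma=M\big(u^{n,m,(k)}_\sigma\big)+O(\varepsilon+h),$$ $$\frac{f^{n,m,(k)}_\sigma-f^n_\sigma}{\Delta t^m}+\sum_d\Lambda_d\partial_{x_d}f_h^{n,m,(k)}(x)-\frac{M(u^{n,m,(k)}_\sigma)-f^{n,m,(k)}_\sigma}\varepsilon=O\Big(\frac h\varepsilon+h\Big),$$ with $u^{n,m,(k)}_\sigma=Pf^{n,m,(k)}_\sigma$ and $u_h^{n,m,(k)}(x)\in\mathcal U$, where all derivatives are those of the polynomials on $K$ and all constants in $O(\cdot)$ are $C$. In particular ($k=\mathcal K$, $m=S$) these relations hold for $u^{n+1},f^{n+1}$. The limits as $\varepsilon\to0^+$ at fixed mesh and timestep satisfy the relations of the first line, with $u=Pf$ and $u_h\in\mathcal U$, with $O(h)$ in place of $O(\varepsilon+h)$: the limit scheme is a consistent discretization of $\partial_tu+\sum_d\partial_{x_d}A_d(u)=0$.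 -/

import Mathlib

open MeasureTheory Filter Topology Set
open scoped BigOperators Matrix

noncomputable section

namespace IMEXRD

/-! ### Triangulations and Bernstein finite elements -/

/-- Physical space `ℝ^D`. -/
abbrev Pt (D : ℕ) : Type := EuclideanSpace ℝ (Fin D)

/-- A conforming simplicial triangulation: a simplicial complex in `ℝ^D` (Mathlib's notion), finite
or locally finite.  Its underlying domain may be bounded, or all of `ℝ^D` (which includes
the periodic setting). -/
structure Mesh (D : ℕ) where
  complex : Geometry.SimplicialComplex ℝ (Pt D)
  locallyFinite : ∀ x : Pt D,
    {K : Finset (Pt D) | K ∈ complex.faces ∧ x ∈ convexHull ℝ (K : Set (Pt D))}.Finite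

/-- The (closed) simplex spanned by a finite set of vertices. -/
def hull {D : ℕ} (K : Finset (Pt D)) : Set (Pt D) := convexHull ℝ (K : Set (Pt D))

/-- The elements of the mesh: the simplices of full dimension, given by their `D + 1` vertices. -/
def Mesh.elems {D : ℕ} (T : Mesh D) : Set (Finset (Pt D)) :=
  {K | K ∈ T.complex.faces ∧ K.card = D + 1}

/-- `T` is a mesh of `Ω` (elements contained in `Ω`) of characteristic size `h`, with regularity
constant `κ`: all elements have diameter at most `h` and contain a ball of radius `h / κ`. -/
def Mesh.IsRegular {D : ℕ} (T : Mesh D) (Ω : Set (Pt D)) (κ h : ℝ) : Prop :=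
  0 < h ∧ ∀ K ∈ T.elems, hull K ⊆ Ω ∧ Metric.diam (hull K) ≤ h ∧
    ∃ y : Pt D, Metric.ball y (h / κ) ⊆ hull K

open Classical in
/-- The barycentric coordinate of `x` attached to the vertex `v` of the simplex `K`, as an affine
function of `x ∈ ℝ^D` (and `0` if `K` is not a nondegenerate simplex with vertex `v`). -/
def bary {D : ℕ} (K : Finset (Pt D)) (v x : Pt D) : ℝ :=
  if h : v ∈ K ∧ AffineIndependent ℝ (Subtype.val : {w // w ∈ K} → Pt D) ∧
      affineSpan ℝ (Set.range (Subtype.val : {w // w ∈ K} → Pt D)) = ⊤ then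
    (AffineBasis.mk (Subtype.val : {w // w ∈ K} → Pt D) h.2.1 h.2.2).coord ⟨v, h.1⟩ x
  else 0

open Classical in
/-- Multi-indices `α : K → ℕ` of length `p` (extended by `0` outside `K`). -/
def multiIdx {D : ℕ} (p : ℕ) (K : Finset (Pt D)) : Finset (Pt D → ℕ) := K.piAntidiag p

/-- The domain point `∑_v (α_v / p) v` of a multi-index. -/
def domainPt {D : ℕ} (p : ℕ) (K : Finset (Pt D)) (α : Pt D → ℕ) : Pt D :=
  ∑ v ∈ K, ((α v : ℝ) / p) • v

open Classical in
/-- The degrees of freedom of an element, for Bernstein polynomials of degree `p`, identified with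
their domain points.  In a conforming mesh, degrees of freedom of different elements are the same
iff the domain points are. -/
def nodes {D : ℕ} (p : ℕ) (K : Finset (Pt D)) : Finset (Pt D) :=
  (multiIdx p K).image (domainPt p K)

/-- The Bernstein polynomial `p! / α! * λ^α` of the element `K`. -/
def bernsteinPoly {D : ℕ} (K : Finset (Pt D)) (α : Pt D → ℕ) (x : Pt D) : ℝ :=
  (Nat.multinomial K α : ℝ) * ∏ v ∈ K, bary K v x ^ α v

open Classical in
/-- The polynomial which the global basis function `φ_σ` equals on the element `K`: the Bernstein
polynomial with domain point `σ` if `σ ∈ K`, and `0` otherwise. -/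
def shape {D : ℕ} (p : ℕ) (K : Finset (Pt D)) (σ x : Pt D) : ℝ :=
  ∑ α ∈ multiIdx p K with domainPt p K α = σ, bernsteinPoly K α x

/-- The polynomial `∑_{σ ∈ K} f_σ φ_σ|_K` which the finite element function with
coefficients `f` equals on the element `K`. -/
def interp {D : ℕ} {ι : Type} (p : ℕ) (K : Finset (Pt D)) (f : Pt D → ι → ℝ) (x : Pt D) : ι → ℝ :=
  ∑ σ ∈ nodes p K, shape p K σ x • f σ

/-- All degrees of freedom `D_h` of the mesh. -/
def dofs {D : ℕ} (p : ℕ) (T : Mesh D) : Set (Pt D) := {σ | ∃ K ∈ T.elems, σ ∈ nodes p K}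

/-- The elements `K` with `σ ∈ K`. -/
def elemsAt {D : ℕ} (p : ℕ) (T : Mesh D) (σ : Pt D) : Set (Finset (Pt D)) :=
  {K | K ∈ T.elems ∧ σ ∈ nodes p K}

/-- `|C_σ| = ∫_Ω φ_σ dx`. -/
def cellVol {D : ℕ} (p : ℕ) (T : Mesh D) (σ : Pt D) : ℝ :=
  ∑ᶠ K ∈ elemsAt p T σ, ∫ x in hull K, shape p K σ x

/-- The degrees of freedom that can be reached from `σ` through at most `r` elements. -/
def layers {D : ℕ} (p : ℕ) (T : Mesh D) : ℕ → Pt D → Set (Pt D)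
  | 0, σ => {σ}
  | r + 1, σ => {τ | ∃ ρ ∈ layers p T r σ, ∃ K ∈ T.elems, ρ ∈ nodes p K ∧ τ ∈ nodes p K}

/-! ### Nodal residuals of the advection part `∑_d Λ_d ∂_{x_d} f` -/

/-- The diagonal matrix `Λ_d` (with diagonal `Λ d`) applied to a vector. -/
def lam {D L : ℕ} (Λ : Fin D → Fin L → ℝ) (d : Fin D) (v : Fin L → ℝ) : Fin L → ℝ :=
  Matrix.diagonal (Λ d) *ᵥ v

/-- The unit vector of the `d`-th coordinate direction. -/
def unitDir {D : ℕ} (d : Fin D) : Pt D := EuclideanSpace.single d 1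

/-- `∂_{x_d} g (x)`. -/
def pderiv {D : ℕ} {ι : Type} [Fintype ι] (d : Fin D) (g : Pt D → ι → ℝ) (x : Pt D) : ι → ℝ :=
  fderiv ℝ g x (unitDir d)

/-- A family of nodal residuals: to a mesh, an element `K`, a degree of freedom `σ ∈ K` and the
coefficients of a finite element function `f` it assigns `φ^K_{ad,σ}(f) ∈ ℝ^L`. -/
abbrev Residual (D L : ℕ) : Type :=
  Mesh D → Finset (Pt D) → Pt D → (Pt D → Fin L → ℝ) → Fin L → ℝ

/-- The nodal residuals are continuous functions of the coefficients at the degrees of freedom (and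
of nothing else), and their
normalized sum `|C_σ|⁻¹ ∑_{K ∋ σ} φ^K_σ(f)` is a (first order) consistent discretization of
`∑_d Λ_d ∂_{x_d} f`: if, on a fixed number `r` of layers of elements around `σ`, the nodal values
are those of an affine function up to `δ`, then it is the value of `∑_d Λ_d ∂_{x_d}` on the affine
function up to `C (δ / h + h)`. -/
def IsConsistentResidual {D L : ℕ} (p : ℕ) (Λ : Fin D → Fin L → ℝ) (Ω : Set (Pt D)) (κ : ℝ)
    (φ : Residual D L) : Prop :=
  (∀ T : Mesh D, ∀ K ∈ T.elems, ∀ σ ∈ nodes p K, Continuous (φ T K σ) ∧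
    ∀ f g : Pt D → Fin L → ℝ, (∀ τ ∈ dofs p T, f τ = g τ) → φ T K σ f = φ T K σ g) ∧
  ∀ R : ℝ, 0 < R → ∃ C : ℝ, ∃ r : ℕ, ∀ (T : Mesh D) (h : ℝ), T.IsRegular Ω κ h →
    ∀ σ ∈ dofs p T, ∀ (f : Pt D → Fin L → ℝ) (a : Fin L → ℝ) (B : Pt D →L[ℝ] (Fin L → ℝ)) (δ : ℝ),
      ‖a‖ ≤ R → ‖B‖ ≤ R → 0 ≤ δ → δ ≤ R * h →
      (∀ τ ∈ layers p T r σ, ‖f τ - (a + B (τ - σ))‖ ≤ δ) →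
      ‖(cellVol p T σ)⁻¹ • (∑ᶠ K ∈ elemsAt p T σ, φ T K σ f) - ∑ d, lam Λ d (B (unitDir d))‖
        ≤ C * (δ / h + h)

/-- The size `h_e` of a face `e` of `K`: its diameter, or the length of the cell `K` if `D = 1`. -/
def faceSize {D : ℕ} (K e : Finset (Pt D)) : ℝ :=
  if D = 1 then Metric.diam (hull K) else Metric.diam (hull e)

open Classical in
/-- A unit normal vector to the face `e` (unique up to its sign, which does not matter below). -/
def faceNormal {D : ℕ} (e : Finset (Pt D)) : Pt D :=
  if hn : ∃ n : Pt D, ‖n‖ = 1 ∧ ∀ x ∈ e, ∀ y ∈ e, inner ℝ n (x - y) = 0 then hn.choose else 0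

/-- The `k`-th derivative of `g` at `x` in the direction `n`. -/
def dirDeriv {D : ℕ} {V : Type} [NormedAddCommGroup V] [NormedSpace ℝ V]
    (k : ℕ) (g : Pt D → V) (n x : Pt D) : V :=
  iteratedFDeriv ℝ k g x (fun _ => n)

open Classical in
/-- `∫_e [∇^k f_h] [∇^k φ_σ] dΓ`, with derivatives in the normal direction and jumps between `K` and
the other element `K⁺` that contains the face `e` (it is `0` if `e` is on the boundary). -/
def jumpTerm {D L : ℕ} (p : ℕ) (T : Mesh D) (k : ℕ) (K e : Finset (Pt D)) (σ : Pt D)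
    (f : Pt D → Fin L → ℝ) : Fin L → ℝ :=
  if hK : ∃ K' ∈ T.elems, K' ≠ K ∧ e ⊆ K' then
    ∫ x in hull e,
      (dirDeriv k (shape p K σ) (faceNormal e) x
          - dirDeriv k (shape p hK.choose σ) (faceNormal e) x) •
        (dirDeriv k (interp p K f) (faceNormal e) x
          - dirDeriv k (interp p hK.choose f) (faceNormal e) x) ∂(μHE[D - 1])
  else 0

/-- The Galerkin residual `∫_K φ_σ ∑_d Λ_d ∂_{x_d} f_h dx` with stabilization by jumps of the
normal derivatives of orders `1, …, p` across the faces, with coefficients `θ_k`. -/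
def galerkinJump {D L : ℕ} (p : ℕ) (Λ : Fin D → Fin L → ℝ) (θ : ℕ → ℝ) : Residual D L :=
  fun T K σ f =>
    (∫ x in hull K, shape p K σ x • ∑ d, lam Λ d (pderiv d (interp p K f) x)) +
    ∑ k ∈ Finset.Icc 1 p, ∑ e ∈ K.powersetCard D,
      (θ k * faceSize K e ^ (2 * k)) • jumpTerm p T k K e σ f

/-! ### The IMEX deferred correction operators -/

/-- The interpolation polynomial `I_M(g_0, …, g_M, s)` with nodes `t_0, …, t_M`. -/
def timeInterp {S : ℕ} {ι : Type} (t : Fin (S + 1) → ℝ) (g : Fin (S + 1) → ι → ℝ) (s : ℝ) : ι → ℝ :=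
  ∑ j, (Lagrange.basis Finset.univ t j).eval s • g j

/-- All fixed data of the model and of the discretization. -/
structure Scheme (D q L S : ℕ) where
  /-- polynomial degree -/
  p : ℕ
  /-- number of iterations (one prediction and `iters - 1` corrections) -/
  iters : ℕ
  /-- sub-timesteps `t^{n,m} = t^n + c_m Δt`, `m = 0, …, S` -/
  c : Fin (S + 1) → ℝ
  /-- projection `P : ℝ^L → ℝ^q` -/
  P : Matrix (Fin q) (Fin L) ℝ
  /-- Maxwellian `M : ℝ^q → ℝ^L` -/
  maxw : (Fin q → ℝ) → (Fin L → ℝ)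
  /-- nodal residuals of the advection part -/
  φ : Residual D L

/-- Coefficients `v n k m σ` of a discrete solution: timestep `n`, iteration `k`, sub-timestep `m`,
degree of freedom `σ`. -/
abbrev History (D r S : ℕ) : Type := ℕ → ℕ → Fin (S + 1) → Pt D → Fin r → ℝ

variable {D q L S : ℕ}

/-- `Δt^m = t^{n,m} - t^{n,0}`. -/
def Scheme.dt (X : Scheme D q L S) (Δt : ℝ) (m : Fin (S + 1)) : ℝ := X.c m * Δt

/-- The full nodal residual `φ^K_σ`, of advection minus relaxation source
`(M(P f) - f) / ε`. -/
def Scheme.fullResidual (X : Scheme D q L S) (ε : ℝ) (T : Mesh D) (K : Finset (Pt D)) (σ : Pt D)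
    (f : Pt D → Fin L → ℝ) : Fin L → ℝ :=
  X.φ T K σ f -
    ∫ x in hull K, shape X.p K σ x •
      ((1 / ε) • (X.maxw (X.P *ᵥ interp X.p K f x) - interp X.p K f x))

/-- `L^{1,m}_{σ,u}(f^0, u^m)`. -/
def Scheme.L1u (X : Scheme D q L S) (T : Mesh D) (Δt : ℝ) (m : Fin (S + 1)) (σ : Pt D)
    (f0 : Pt D → Fin L → ℝ) (um : Pt D → Fin q → ℝ) : Fin q → ℝ :=
  cellVol X.p T σ • (um σ - X.P *ᵥ f0 σ) +
    X.dt Δt m • ∑ᶠ K ∈ elemsAt X.p T σ, X.P *ᵥ X.φ T K σ f0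

/-- `L^{1,m}_σ(f^0, f^m)`, which uses the value `u^m` of the auxiliary equation. -/
def Scheme.L1f (X : Scheme D q L S) (ε : ℝ) (T : Mesh D) (Δt : ℝ) (m : Fin (S + 1)) (σ : Pt D)
    (f0 : Pt D → Fin L → ℝ) (um : Pt D → Fin q → ℝ) (fm : Pt D → Fin L → ℝ) : Fin L → ℝ :=
  (cellVol X.p T σ * (1 + X.dt Δt m / ε)) • fm σ - cellVol X.p T σ • f0 σ +
    X.dt Δt m • (∑ᶠ K ∈ elemsAt X.p T σ, X.φ T K σ f0) -
    (cellVol X.p T σ * (X.dt Δt m / ε)) • X.maxw (um σ)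

/-- `L^{2,m}_{σ,u}`; the time variable is counted from `t^n`. -/
def Scheme.L2u (X : Scheme D q L S) (T : Mesh D) (Δt : ℝ) (m : Fin (S + 1)) (σ : Pt D)
    (u : Fin (S + 1) → Pt D → Fin q → ℝ) (f : Fin (S + 1) → Pt D → Fin L → ℝ) : Fin q → ℝ :=
  ∑ᶠ K ∈ elemsAt X.p T σ,
    ((∫ x in hull K, shape X.p K σ x • (interp X.p K (u m) x - interp X.p K (u 0) x)) +
      ∫ s in (0 : ℝ)..X.dt Δt m,
        timeInterp (X.dt Δt) (fun j => X.P *ᵥ X.φ T K σ (f j)) s)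

/-- `L^{2,m}_σ`. -/
def Scheme.L2f (X : Scheme D q L S) (ε : ℝ) (T : Mesh D) (Δt : ℝ) (m : Fin (S + 1)) (σ : Pt D)
    (f : Fin (S + 1) → Pt D → Fin L → ℝ) : Fin L → ℝ :=
  ∑ᶠ K ∈ elemsAt X.p T σ,
    ((∫ x in hull K, shape X.p K σ x • (interp X.p K (f m) x - interp X.p K (f 0) x)) +
      ∫ s in (0 : ℝ)..X.dt Δt m,
        timeInterp (X.dt Δt) (fun j => X.fullResidual ε T K σ (f j)) s)

/-- The sequence `u n k m σ = u^{n,m,(k)}_σ`, `f n k m σ = f^{n,m,(k)}_σ` is computed by the IMEX DeC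
RD scheme from the well-prepared discrete data `u^0 = U0`, `f^0 = M(U0)`.  Here `n` is
the timestep, `k = 1` is the prediction, `k = 2, …, iters` are the corrections, and `m` is the
sub-timestep. -/
structure Scheme.IsRun (X : Scheme D q L S) (ε : ℝ) (T : Mesh D) (Δt : ℝ) (U0 : Pt D → Fin q → ℝ)
    (u : History D q S) (f : History D L S) :
    Prop where
  init_u : ∀ k, ∀ σ ∈ dofs X.p T, u 0 k 0 σ = U0 σ
  init_f : ∀ k, ∀ σ ∈ dofs X.p T, f 0 k 0 σ = X.maxw (U0 σ)
  next_u : ∀ n k, ∀ σ ∈ dofs X.p T, u (n + 1) k 0 σ = u n X.iters (Fin.last S) σ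
  next_f : ∀ n k, ∀ σ ∈ dofs X.p T, f (n + 1) k 0 σ = f n X.iters (Fin.last S) σ
  predict_u : ∀ n, ∀ m ≠ 0, ∀ σ ∈ dofs X.p T, X.L1u T Δt m σ (f n 1 0) (u n 1 m) = 0
  predict_f : ∀ n, ∀ m ≠ 0, ∀ σ ∈ dofs X.p T,
    X.L1f ε T Δt m σ (f n 1 0) (u n 1 m) (f n 1 m) = 0
  correct_u : ∀ n k, 1 ≤ k → k < X.iters → ∀ m ≠ 0, ∀ σ ∈ dofs X.p T,
    X.L1u T Δt m σ (f n (k + 1) 0) (u n (k + 1) m) - X.L1u T Δt m σ (f n k 0) (u n k m)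
      + X.L2u T Δt m σ (u n k) (f n k) = 0
  correct_f : ∀ n k, 1 ≤ k → k < X.iters → ∀ m ≠ 0, ∀ σ ∈ dofs X.p T,
    X.L1f ε T Δt m σ (f n (k + 1) 0) (u n (k + 1) m) (f n (k + 1) m)
      - X.L1f ε T Δt m σ (f n k 0) (u n k m) (f n k m) + X.L2f ε T Δt m σ (f n k) = 0

/-! ### The discrete relations -/

/-- The macroscopic relations, up to an error `err`, for every timestep `n ≤ N`, prediction or
correction `k`, sub-timestep `m ≥ 1` and degree of freedom `σ`: `u = P f`,
`f = M(u) + O(err)`, and, for `x` in any element that contains `σ` (in particular for `x = σ`),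
`(u^{n,m,(k)}_σ - u^n_σ) / Δt^m + ∑_d ∂_{x_d} A_d(u_h^{n,m,(k)})(x) = O(err)`, where `u_h(x)` stays
in the set `𝒰` of admissible states.  The case `k = iters`, `m = S` is the whole timestep. -/
def Scheme.LimitRelations (X : Scheme D q L S) (A : Fin D → (Fin q → ℝ) → (Fin q → ℝ))
    (𝒰 : Set (Fin q → ℝ)) (T : Mesh D) (Δt : ℝ) (N : ℕ) (err : ℝ)
    (u : History D q S) (f : History D L S) :
    Prop :=
  ∀ n ≤ N, ∀ k, 1 ≤ k → k ≤ X.iters → ∀ m ≠ 0, ∀ σ ∈ dofs X.p T,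
    X.P *ᵥ f n k m σ = u n k m σ ∧
    ‖f n k m σ - X.maxw (u n k m σ)‖ ≤ err ∧
    ∀ K ∈ elemsAt X.p T σ, ∀ x ∈ hull K,
      interp X.p K (u n k m) x ∈ 𝒰 ∧
      ‖(1 / X.dt Δt m) • (u n k m σ - u n k 0 σ) +
        ∑ d, pderiv d (fun y => A d (interp X.p K (u n k m) y)) x‖ ≤ err

/-- The kinetic relations, up to an error `err`: for `x` in any element that contains `σ`,
`(f^{n,m,(k)}_σ - f^n_σ) / Δt^m + ∑_d Λ_d ∂_{x_d} f_h^{n,m,(k)}(x)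
  - (M(u^{n,m,(k)}_σ) - f^{n,m,(k)}_σ) / ε = O(err)`. -/
def Scheme.KineticRelations (X : Scheme D q L S) (Λ : Fin D → Fin L → ℝ) (ε : ℝ)
    (T : Mesh D) (Δt : ℝ) (N : ℕ) (err : ℝ)
    (u : History D q S) (f : History D L S) :
    Prop :=
  ∀ n ≤ N, ∀ k, 1 ≤ k → k ≤ X.iters → ∀ m ≠ 0, ∀ σ ∈ dofs X.p T,
    ∀ K ∈ elemsAt X.p T σ, ∀ x ∈ hull K,
      ‖(1 / X.dt Δt m) • (f n k m σ - f n k 0 σ) +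
        (∑ d, lam Λ d (pderiv d (interp X.p K (f n k m)) x)) -
        (1 / ε) • (X.maxw (u n k m σ) - f n k m σ)‖ ≤ err

/-- `U0` are well-resolved initial coefficients: they are `O(h^2)` close to the values at the
degrees of freedom of a function `u0` that is `C^2` in `Ω` with first and second derivatives
bounded by `R` and values in the set `𝒦`. -/
def GoodData (p : ℕ) (Ω : Set (Pt D)) (𝒦 : Set (Fin q → ℝ)) (R h : ℝ) (T : Mesh D)
    (U0 : Pt D → Fin q → ℝ) : Prop :=
  ∃ u0 : Pt D → Fin q → ℝ, ContDiffOn ℝ 2 u0 Ω ∧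
    (∀ x ∈ Ω, u0 x ∈ 𝒦 ∧ ‖fderiv ℝ u0 x‖ ≤ R ∧ ‖iteratedFDeriv ℝ 2 u0 x‖ ≤ R) ∧
    ∀ σ ∈ dofs p T, ‖U0 σ - u0 σ‖ ≤ R * h ^ 2

end IMEXRD

end

open IMEXRD

/-! Only a fixed number `N` of timesteps with `Δt ≤ γ h` is taken, so the computation lasts a time
`O(h)` and no evolution has to be followed: every intermediate value is compared with the initial
state `u0`, its Maxwellian `M(u0)` and the derivative `B` of `M ∘ u0`. The invariant
(`Scheme.IsNear`) is that `P f = u` and that `f - M(u0)` is `O(h)` at the nodes and oscillates by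
`O(h^2)` on each element, which is `SlowNodal` with constant `c h`. Such coefficients are affine up
to `O(h^2)` on any fixed number of layers (`norm_layers_le`), so consistency makes the advection
residual equal to `∑_d Λ_d B e_d + O(h)` (`exists_norm_adv_sub_le`).

The invariant survives an iteration for three reasons. A quantity known up to `O(h)` at each node is
slowly varying of order one (`SlowNodal.of_small`), and the factor `Δt = O(h)` in front of the
residuals lowers this to order `h`. For the Maxwellian, Lipschitz continuity is not enough; second
differences of the `C^2` map `M` supply the missing power of `h` (`norm_second_diff_le`). Finally,
replacing a cell average by the nodal value, in the mass matrix or in the relaxation term, costs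
only the oscillation on one element.

Uniformity in `ε`: relaxation is implicit, but `M` is evaluated at the macroscopic value `u` that is
already known, so each iteration can be solved explicitly (`L1f_eq_zero_iff`, `correct_f_iff`). Then
`ε` enters only through `ε / (ε + Δt^m)` in `[0, 1]` and through `Δt / (ε + Δt^m) ≤ 1 / c_m`.
Moreover `P` annihilates the averaged relaxation term as long as `u_h` stays in `𝒰` (`proj_source`),
so `u = P f` persists and the macroscopic increments do not see `ε`. They satisfy `u - u^n = -Δt^m P
∑_d Λ_d B e_d + O(Δt h)`, and division by `Δt^m` gives the macroscopic relation. For `f` the same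
comparison leaves relaxation terms of size `O(h)` divided by `ε`, hence the error `h / ε + h`. The
chain is `exists_predict`, `exists_correct`, `exists_stepBound`, `exists_runBound`,
`exists_relations`.

At fixed mesh and timestep the explicit formulas have limits for `ε → 0+` (`tendsto_step`), and the
macroscopic bounds are closed conditions, so they pass to the limit. Consistency of the Galerkin
residuals is a count of powers of `h`: inverse estimates lose `h^(-2k)` in a jump term of order `k`,
which the weight `h_e^(2k)` restores, and affine functions have no jumps. -/

noncomputable section

namespace IMEXRD

section

/-! ### Barycentric coordinates and Bernstein polynomials on a simplex -/

section Simplex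

variable {D : ℕ}

/-- `K` is the vertex set of a nondegenerate `D`-dimensional simplex. -/
def IsSimplex (K : Finset (Pt D)) : Prop :=
  AffineIndependent ℝ (Subtype.val : {w // w ∈ K} → Pt D) ∧
    affineSpan ℝ (Set.range (Subtype.val : {w // w ∈ K} → Pt D)) = ⊤

namespace IsSimplex

variable {K : Finset (Pt D)}

/-- The vertices as an affine basis. -/
def basis (hK : IsSimplex K) : AffineBasis {w // w ∈ K} ℝ (Pt D) :=
  AffineBasis.mk (Subtype.val : {w // w ∈ K} → Pt D) hK.1 hK.2

lemma bary_eq (hK : IsSimplex K) {v : Pt D} (hv : v ∈ K) (x : Pt D) :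
    bary K v x = hK.basis.coord ⟨v, hv⟩ x :=
  dif_pos ⟨hv, hK.1, hK.2⟩

lemma sum_bary (hK : IsSimplex K) (x : Pt D) : ∑ v ∈ K, bary K v x = 1 := by
  rw [← Finset.sum_coe_sort, ← hK.basis.sum_coord_apply_eq_one x]
  exact Finset.sum_congr rfl fun v _ => hK.bary_eq v.2 x

lemma sum_bary_smul (hK : IsSimplex K) (x : Pt D) : ∑ v ∈ K, bary K v x • v = x := by
  conv_rhs => rw [← hK.basis.linear_combination_coord_eq_self x]
  rw [← Finset.sum_coe_sort]
  exact Finset.sum_congr rfl fun v _ => by rw [hK.bary_eq v.2 x]; rfl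

lemma bary_self (hK : IsSimplex K) {v : Pt D} (hv : v ∈ K) : bary K v v = 1 := by
  rw [hK.bary_eq hv]
  exact hK.basis.coord_apply_eq ⟨v, hv⟩

lemma bary_of_ne (hK : IsSimplex K) {v w : Pt D} (hv : v ∈ K) (hw : w ∈ K) (h : v ≠ w) :
    bary K v w = 0 := by
  rw [hK.bary_eq hv]
  exact hK.basis.coord_apply_ne (i := ⟨v, hv⟩) (j := ⟨w, hw⟩) (by simpa using h)

lemma bary_nonneg (hK : IsSimplex K) {v x : Pt D} (hv : v ∈ K) (hx : x ∈ hull K) :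
    0 ≤ bary K v x := by
  rw [hK.bary_eq hv]
  have h := hK.basis.convexHull_eq_nonneg_coord
  have hr : Set.range hK.basis = (K : Set (Pt D)) := by
    change Set.range (Subtype.val : {w // w ∈ K} → Pt D) = _
    simp
  rw [hr] at h
  have hx' : x ∈ convexHull ℝ (K : Set (Pt D)) := hx
  rw [h] at hx'
  exact hx' _

lemma bary_le_one (hK : IsSimplex K) {v x : Pt D} (hv : v ∈ K) (hx : x ∈ hull K) :
    bary K v x ≤ 1 := by
  rw [← hK.sum_bary x]
  exact Finset.single_le_sum (f := fun w => bary K w x) (fun w hw => hK.bary_nonneg hw hx) hv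

lemma exists_bary_affine (hK : IsSimplex K) {v : Pt D} (hv : v ∈ K) :
    ∃ l : Pt D →L[ℝ] ℝ, ∀ x y, bary K v x = bary K v y + l (x - y) := by
  refine ⟨LinearMap.toContinuousLinearMap (hK.basis.coord ⟨v, hv⟩).linear, fun x y => ?_⟩
  rw [hK.bary_eq hv, hK.bary_eq hv]
  have := (hK.basis.coord ⟨v, hv⟩).linearMap_vsub x y
  simp only [vsub_eq_sub] at this
  rw [LinearMap.coe_toContinuousLinearMap', this]
  ring

lemma contDiff_bary (hK : IsSimplex K) {v : Pt D} (hv : v ∈ K) : ContDiff ℝ ⊤ (bary K v) := by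
  obtain ⟨l, hl⟩ := hK.exists_bary_affine hv
  have : bary K v = fun x => bary K v 0 + l (x - 0) := funext fun x => hl x 0
  rw [this]
  fun_prop

end IsSimplex

lemma isSimplex_of_mem_elems {T : Mesh D} {K : Finset (Pt D)} (hK : K ∈ T.elems) :
    IsSimplex K := by
  have h1 : AffineIndependent ℝ (Subtype.val : {w // w ∈ K} → Pt D) := T.complex.indep hK.1
  exact ⟨h1, (AffineIndependent.affineSpan_eq_top_iff_card_eq_finrank_add_one
    (k := ℝ) h1).2 (by simp [hK.2])⟩

lemma convex_hull (K : Finset (Pt D)) : Convex ℝ (hull K) := convex_convexHull ℝ _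

lemma isCompact_hull (K : Finset (Pt D)) : IsCompact (hull K) :=
  K.finite_toSet.isCompact_convexHull ℝ

lemma subset_hull (K : Finset (Pt D)) : (K : Set (Pt D)) ⊆ hull K := subset_convexHull ℝ _

lemma measurableSet_hull (K : Finset (Pt D)) : MeasurableSet (hull K) :=
  (isCompact_hull K).measurableSet

lemma mem_multiIdx {p : ℕ} {K : Finset (Pt D)} {α : Pt D → ℕ} :
    α ∈ multiIdx p K ↔ K.sum α = p ∧ ∀ i, α i ≠ 0 → i ∈ K := by
  unfold multiIdx
  exact Finset.mem_piAntidiag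

lemma sum_div_eq_one {p : ℕ} (hp : 1 ≤ p) {K : Finset (Pt D)} {α : Pt D → ℕ}
    (hα : α ∈ multiIdx p K) : ∑ v ∈ K, ((α v : ℝ) / p) = 1 := by
  have h := (mem_multiIdx.1 hα).1
  rw [← Finset.sum_div, ← Nat.cast_sum, h, div_self]
  positivity

lemma domainPt_mem_hull {p : ℕ} (hp : 1 ≤ p) {K : Finset (Pt D)} {α : Pt D → ℕ}
    (hα : α ∈ multiIdx p K) : domainPt p K α ∈ hull K :=
  (convex_hull K).sum_mem (fun v _ => by positivity) (sum_div_eq_one hp hα)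
    fun v hv => subset_hull K hv

lemma nodes_subset_hull {p : ℕ} (hp : 1 ≤ p) {K : Finset (Pt D)} {σ : Pt D}
    (hσ : σ ∈ nodes p K) : σ ∈ hull K := by
  classical
  obtain ⟨α, hα, rfl⟩ := Finset.mem_image.1 hσ
  exact domainPt_mem_hull hp hα

lemma vertex_mem_nodes {p : ℕ} (hp : 1 ≤ p) {K : Finset (Pt D)} {v : Pt D} (hv : v ∈ K) :
    v ∈ nodes p K := by
  classical
  refine Finset.mem_image.2 ⟨fun w => if w = v then p else 0, ?_, ?_⟩
  · rw [mem_multiIdx]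
    refine ⟨by simp [hv], fun i hi => ?_⟩
    by_cases h : i = v
    · rwa [h]
    · simp [h] at hi
  · unfold domainPt
    rw [Finset.sum_eq_single v]
    · have : (p : ℝ) ≠ 0 := by positivity
      simp [this]
    · intro w _ hw
      simp [hw]
    · exact fun h => absurd hv h

lemma bernsteinPoly_nonneg {K : Finset (Pt D)} (hK : IsSimplex K) (α : Pt D → ℕ) {x : Pt D}
    (hx : x ∈ hull K) : 0 ≤ bernsteinPoly K α x :=
  mul_nonneg (Nat.cast_nonneg _)
    (Finset.prod_nonneg fun _ hv => pow_nonneg (hK.bary_nonneg hv hx) _)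

lemma contDiff_bernsteinPoly {K : Finset (Pt D)} (hK : IsSimplex K) (α : Pt D → ℕ) :
    ContDiff ℝ ⊤ (bernsteinPoly K α) := by
  unfold bernsteinPoly
  exact contDiff_const.mul (contDiff_prod fun v hv => (hK.contDiff_bary hv).pow _)

lemma sum_multinomial_mul_prod_pow (p : ℕ) (K : Finset (Pt D)) (y : Pt D → ℝ) :
    ∑ α ∈ multiIdx p K, (Nat.multinomial K α : ℝ) * ∏ v ∈ K, y v ^ α v = (∑ v ∈ K, y v) ^ p := by
  classical
  rw [Finset.sum_pow_eq_sum_piAntidiag]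
  unfold multiIdx
  congr!

lemma sum_bernsteinPoly {K : Finset (Pt D)} (hK : IsSimplex K) (p : ℕ) (x : Pt D) :
    ∑ α ∈ multiIdx p K, bernsteinPoly K α x = 1 := by
  unfold bernsteinPoly
  rw [sum_multinomial_mul_prod_pow, hK.sum_bary, one_pow]

/-- Replace `y w` by `s * y w` in the multinomial theorem and compare the derivatives in `s` at `s =
1`. At barycentric coordinates, where the sum is one, this first moment gives the linear precision
of Bernstein polynomials. -/
lemma sum_multinomial_deriv (p : ℕ) (K : Finset (Pt D)) (y : Pt D → ℝ) {w : Pt D} (hw : w ∈ K) :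
    ∑ α ∈ multiIdx p K, (Nat.multinomial K α : ℝ) * (∏ v ∈ K, y v ^ α v) * α w =
      p * (∑ v ∈ K, y v) ^ (p - 1) * y w := by
  classical
  have key : ∀ s : ℝ, ∑ α ∈ multiIdx p K, (Nat.multinomial K α : ℝ) * (∏ v ∈ K, y v ^ α v) * s ^ α w
      = (∑ v ∈ K, y v + (s - 1) * y w) ^ p := by
    intro s
    have h := sum_multinomial_mul_prod_pow p K (fun v => if v = w then s * y v else y v)
    have h1 : ∑ v ∈ K, (if v = w then s * y v else y v) = ∑ v ∈ K, y v + (s - 1) * y w := by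
      have : ∀ v ∈ K, (if v = w then s * y v else y v) = y v + if v = w then (s - 1) * y w else 0 := by
        intro v _
        split_ifs with h
        · subst h; ring
        · ring
      rw [Finset.sum_congr rfl this, Finset.sum_add_distrib]
      simp [hw]
    rw [← h1, ← h]
    refine Finset.sum_congr rfl fun α _ => ?_
    rw [mul_assoc]
    congr 1
    have : ∀ v ∈ K, (if v = w then s * y v else y v) ^ α v
        = y v ^ α v * if v = w then s ^ α w else 1 := by
      intro v _
      split_ifs with h
      · subst h; rw [mul_pow, mul_comm]
      · ring
    rw [Finset.prod_congr rfl this, Finset.prod_mul_distrib]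
    simp [hw]
  have d1 : HasDerivAt (fun s : ℝ => ∑ α ∈ multiIdx p K,
      (Nat.multinomial K α : ℝ) * (∏ v ∈ K, y v ^ α v) * s ^ α w)
      (∑ α ∈ multiIdx p K, (Nat.multinomial K α : ℝ) * (∏ v ∈ K, y v ^ α v) *
        ((α w : ℝ) * 1 ^ (α w - 1))) 1 := by
    refine HasDerivAt.fun_sum fun α _ => ?_
    exact (hasDerivAt_pow (α w) (1 : ℝ)).const_mul _
  have d2 : HasDerivAt (fun s : ℝ => (∑ v ∈ K, y v + (s - 1) * y w) ^ p)
      (p * (∑ v ∈ K, y v + ((1 : ℝ) - 1) * y w) ^ (p - 1) * (1 * y w)) 1 := by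
    have := (((hasDerivAt_id (1 : ℝ)).sub_const 1).mul_const (y w)).const_add (∑ v ∈ K, y v)
    exact this.pow p
  rw [funext key] at d1
  have := d1.unique d2
  simpa using this

/-- Bernstein polynomials reproduce affine functions. -/
lemma sum_bernsteinPoly_smul_domainPt {K : Finset (Pt D)} (hK : IsSimplex K) {p : ℕ} (hp : 1 ≤ p)
    (x : Pt D) : ∑ α ∈ multiIdx p K, bernsteinPoly K α x • domainPt p K α = x := by
  have hp0 : (p : ℝ) ≠ 0 := by positivity
  conv_rhs => rw [← hK.sum_bary_smul x]
  unfold domainPt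
  simp_rw [Finset.smul_sum]
  rw [Finset.sum_comm]
  refine Finset.sum_congr rfl fun w hw => ?_
  simp_rw [smul_smul]
  rw [← Finset.sum_smul]
  congr 1
  have h := sum_multinomial_deriv p K (fun v => bary K v x) hw
  rw [hK.sum_bary, one_pow, mul_one] at h
  simp_rw [← mul_div_assoc]
  rw [← Finset.sum_div, div_eq_iff hp0, mul_comm (bary K w x), ← h]
  rfl

/-! ### Shape functions and interpolation -/

/-- Grouping the multi-indices by their domain points avoids having to know that different
multi-indices have different domain points. -/
lemma interp_eq_sum {ι : Type} (p : ℕ) (K : Finset (Pt D)) (f : Pt D → ι → ℝ) (x : Pt D) :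
    interp p K f x = ∑ α ∈ multiIdx p K, bernsteinPoly K α x • f (domainPt p K α) := by
  classical
  unfold interp shape
  rw [← Finset.sum_fiberwise_of_maps_to (s := multiIdx p K) (t := nodes p K) (g := domainPt p K)]
  · refine Finset.sum_congr rfl fun σ _ => ?_
    rw [Finset.sum_smul]
    refine Finset.sum_congr (by congr!) fun α hα => ?_
    rw [(Finset.mem_filter.1 hα).2]
  · intro α hα
    unfold nodes
    convert! Finset.mem_image_of_mem (domainPt p K) hα

lemma shape_nonneg {K : Finset (Pt D)} (hK : IsSimplex K) (p : ℕ) (σ : Pt D) {x : Pt D}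
    (hx : x ∈ hull K) : 0 ≤ shape p K σ x :=
  Finset.sum_nonneg fun α _ => bernsteinPoly_nonneg hK α hx

lemma contDiff_shape {K : Finset (Pt D)} (hK : IsSimplex K) (p : ℕ) (σ : Pt D) :
    ContDiff ℝ ⊤ (shape p K σ) := by
  unfold shape
  exact ContDiff.sum fun α _ => contDiff_bernsteinPoly hK α

lemma continuous_shape {K : Finset (Pt D)} (hK : IsSimplex K) (p : ℕ) (σ : Pt D) :
    Continuous (shape p K σ) := (contDiff_shape hK p σ).continuous

section Interp

variable {ι : Type}

lemma interp_congr {p : ℕ} {K : Finset (Pt D)} {f g : Pt D → ι → ℝ}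
    (h : ∀ σ ∈ nodes p K, f σ = g σ) : interp p K f = interp p K g := by
  funext x
  exact Finset.sum_congr rfl fun σ hσ => by rw [h σ hσ]

lemma interp_sub (p : ℕ) (K : Finset (Pt D)) (f g : Pt D → ι → ℝ) (x : Pt D) :
    interp p K (f - g) x = interp p K f x - interp p K g x := by
  simp [interp, smul_sub, Finset.sum_sub_distrib]

/-- Interpolation reproduces affine functions. -/
lemma interp_affine {K : Finset (Pt D)} (hK : IsSimplex K) {p : ℕ} (hp : 1 ≤ p) (a : ι → ℝ)
    (B : Pt D →L[ℝ] (ι → ℝ)) (σ x : Pt D) :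
    interp p K (fun τ => a + B (τ - σ)) x = a + B (x - σ) := by
  rw [interp_eq_sum]
  simp_rw [smul_add]
  rw [Finset.sum_add_distrib, ← Finset.sum_smul, sum_bernsteinPoly hK, one_smul]
  congr 1
  simp_rw [← map_smul, smul_sub]
  rw [← map_sum, Finset.sum_sub_distrib, sum_bernsteinPoly_smul_domainPt hK hp, ← Finset.sum_smul,
    sum_bernsteinPoly hK, one_smul]

variable [Fintype ι]

lemma contDiff_interp {K : Finset (Pt D)} (hK : IsSimplex K) (p : ℕ) (f : Pt D → ι → ℝ) :
    ContDiff ℝ ⊤ (interp p K f) := by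
  unfold interp
  exact ContDiff.sum fun σ _ => (contDiff_shape hK p σ).smul contDiff_const

lemma continuous_interp {K : Finset (Pt D)} (hK : IsSimplex K) (p : ℕ) (f : Pt D → ι → ℝ) :
    Continuous (interp p K f) := (contDiff_interp hK p f).continuous

lemma interp_mulVec {κ : Type} [Fintype κ] (p : ℕ) (K : Finset (Pt D)) (P : Matrix κ ι ℝ)
    (f : Pt D → ι → ℝ) (x : Pt D) :
    interp p K (fun σ => P *ᵥ f σ) x = P *ᵥ interp p K f x := by
  simp [interp, Matrix.mulVec_sum, Matrix.mulVec_smul]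

/-- Values of a finite element function are averages of its coefficients. -/
lemma norm_interp_sub_le {K : Finset (Pt D)} (hK : IsSimplex K) {p : ℕ} {f : Pt D → ι → ℝ}
    {c : ι → ℝ} {η : ℝ} (h : ∀ σ ∈ nodes p K, ‖f σ - c‖ ≤ η) {x : Pt D} (hx : x ∈ hull K) :
    ‖interp p K f x - c‖ ≤ η := by
  classical
  have h1 : interp p K f x - c =
      ∑ α ∈ multiIdx p K, bernsteinPoly K α x • (f (domainPt p K α) - c) := by
    simp_rw [smul_sub]
    rw [Finset.sum_sub_distrib, ← Finset.sum_smul, sum_bernsteinPoly hK, one_smul, interp_eq_sum]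
  rw [h1]
  calc _ ≤ ∑ α ∈ multiIdx p K, bernsteinPoly K α x * η := by
        refine norm_sum_le_of_le _ fun α hα => ?_
        rw [norm_smul, Real.norm_of_nonneg (bernsteinPoly_nonneg hK α hx)]
        refine mul_le_mul_of_nonneg_left (h _ ?_) (bernsteinPoly_nonneg hK α hx)
        exact Finset.mem_image_of_mem _ hα
    _ = η := by rw [← Finset.sum_mul, sum_bernsteinPoly hK, one_mul]

end Interp

end Simplex

end

section

/-! ### Inverse estimates on regular simplices -/

section Regular

variable {D : ℕ}

/-- A shape-regular simplex of size `h`. -/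
structure IsRegularSimplex (K : Finset (Pt D)) (κ h : ℝ) : Prop where
  simplex : IsSimplex K
  card : K.card = D + 1
  h_pos : 0 < h
  kappa_pos : 0 < κ
  diam_le : Metric.diam (hull K) ≤ h
  ball : ∃ y : Pt D, Metric.ball y (h / κ) ⊆ hull K

lemma Mesh.IsRegular.simplex {T : Mesh D} {Ω : Set (Pt D)} {κ h : ℝ} (hT : T.IsRegular Ω κ h)
    (hκ : 0 < κ) {K : Finset (Pt D)} (hK : K ∈ T.elems) : IsRegularSimplex K κ h :=
  ⟨isSimplex_of_mem_elems hK, hK.2, hT.1, hκ, (hT.2 K hK).2.1, (hT.2 K hK).2.2⟩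

/-- `f` has derivatives up to order `n` at `x` that scale like a function of size `E` that varies on
the length `h`. -/
def DerivBound {V : Type*} [NormedAddCommGroup V] [NormedSpace ℝ V] (f : Pt D → V) (x : Pt D)
    (n : ℕ) (h E : ℝ) : Prop :=
  ∀ k ≤ n, ‖iteratedFDeriv ℝ k f x‖ ≤ E / h ^ k

/-- In the Leibniz formula the powers `h^i` and `h^(k-i)` always combine to `h^k`; the binomial
coefficients add up to `2^k ≤ 2^n`. -/
lemma DerivBound.mul {f g : Pt D → ℝ} {x : Pt D} {n : ℕ} {h E E' : ℝ} (hh : 0 < h) (hE : 0 ≤ E)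
    (hE' : 0 ≤ E') (hf : DerivBound f x n h E) (hg : DerivBound g x n h E')
    (cf : ContDiff ℝ ⊤ f) (cg : ContDiff ℝ ⊤ g) :
    DerivBound (fun y => f y * g y) x n h (2 ^ n * E * E') := by
  intro k hk
  refine (norm_iteratedFDeriv_mul_le cf cg x le_top).trans ?_
  calc _ ≤ ∑ i ∈ Finset.range (k + 1), (k.choose i : ℝ) * (E * E' / h ^ k) := by
        refine Finset.sum_le_sum fun i hi => ?_
        have hik : i ≤ k := by simpa [Nat.lt_succ_iff] using hi
        rw [mul_assoc]
        refine mul_le_mul_of_nonneg_left ?_ (Nat.cast_nonneg _)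
        have : E * E' / h ^ k = (E / h ^ i) * (E' / h ^ (k - i)) := by
          rw [div_mul_div_comm, ← pow_add, Nat.add_sub_cancel' hik]
        rw [this]
        exact mul_le_mul (hf i (hik.trans hk)) (hg _ ((Nat.sub_le _ _).trans hk)) (norm_nonneg _)
          (by positivity)
    _ = 2 ^ k * (E * E' / h ^ k) := by
        rw [← Finset.sum_mul, ← Nat.cast_sum, Nat.sum_range_choose]; simp
    _ ≤ 2 ^ n * (E * E' / h ^ k) := by
        refine mul_le_mul_of_nonneg_right ?_ (by positivity)
        exact pow_le_pow_right₀ (by norm_num) hk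
    _ = _ := by ring

lemma derivBound_const (c : ℝ) (x : Pt D) (n : ℕ) {h : ℝ} (hh : 0 < h) :
    DerivBound (fun _ => c) x n h |c| := by
  intro k _
  rcases Nat.eq_zero_or_pos k with rfl | hk
  · simp
  · rw [iteratedFDeriv_const_of_ne hk.ne']
    simp only [Pi.zero_apply, norm_zero]
    positivity

lemma DerivBound.pow {f : Pt D → ℝ} {x : Pt D} {n : ℕ} {h E : ℝ} (hh : 0 < h) (hE : 0 ≤ E)
    (hf : DerivBound f x n h E) (cf : ContDiff ℝ ⊤ f) (a : ℕ) :
    DerivBound (fun y => f y ^ a) x n h ((2 ^ n * E) ^ a) := by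
  induction a with
  | zero => simpa using derivBound_const 1 x n hh
  | succ a ih =>
    have := ih.mul hh (by positivity) hE hf (cf.pow a) cf
    simp_rw [pow_succ (f _)]
    convert this using 1
    ring

lemma DerivBound.prod {ι : Type*} (s : Finset ι) {f : ι → Pt D → ℝ} {x : Pt D} {n : ℕ} {h : ℝ}
    {E : ι → ℝ} (hh : 0 < h) (hE : ∀ i ∈ s, 0 ≤ E i) (hf : ∀ i ∈ s, DerivBound (f i) x n h (E i))
    (cf : ∀ i ∈ s, ContDiff ℝ ⊤ (f i)) :
    DerivBound (fun y => ∏ i ∈ s, f i y) x n h (∏ i ∈ s, 2 ^ n * E i) := by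
  classical
  induction s using Finset.induction_on with
  | empty => simpa using derivBound_const 1 x n hh
  | insert i s hi ih =>
    have h1 := ih (fun j hj => hE j (Finset.mem_insert_of_mem hj))
      (fun j hj => hf j (Finset.mem_insert_of_mem hj))
      (fun j hj => cf j (Finset.mem_insert_of_mem hj))
    have hi' := Finset.mem_insert_self i s
    have := (hf i hi').mul hh (hE i hi') (Finset.prod_nonneg fun j hj =>
      mul_nonneg (by positivity) (hE j (Finset.mem_insert_of_mem hj))) h1 (cf i hi')
      (contDiff_prod fun j hj => cf j (Finset.mem_insert_of_mem hj))
    simp_rw [Finset.prod_insert hi]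
    exact this

lemma DerivBound.sum {ι : Type*} {V : Type*} [NormedAddCommGroup V] [NormedSpace ℝ V]
    (s : Finset ι) {f : ι → Pt D → V} {x : Pt D} {n : ℕ} {h : ℝ}
    {E : ι → ℝ} (hf : ∀ i ∈ s, DerivBound (f i) x n h (E i))
    (cf : ∀ i ∈ s, ContDiff ℝ ⊤ (f i)) :
    DerivBound (fun y => ∑ i ∈ s, f i y) x n h (∑ i ∈ s, E i) := by
  intro k hk
  rw [iteratedFDeriv_fun_sum_apply fun i hi => ((cf i hi).of_le le_top).contDiffAt,
    Finset.sum_div]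
  exact norm_sum_le_of_le _ fun i hi => hf i hi k hk

lemma DerivBound.smul_const {V : Type*} [NormedAddCommGroup V] [NormedSpace ℝ V]
    {f : Pt D → ℝ} {x : Pt D} {n : ℕ} {h E : ℝ} (hf : DerivBound f x n h E)
    (cf : ContDiff ℝ ⊤ f) (v : V) : DerivBound (fun y => f y • v) x n h (E * ‖v‖) := by
  intro k hk
  have h1 := ContinuousLinearMap.norm_iteratedFDeriv_comp_left
    (ContinuousLinearMap.toSpanSingleton ℝ v) (n := k) (x := x) cf.contDiffAt le_top
  have h2 : (ContinuousLinearMap.toSpanSingleton ℝ v : ℝ →L[ℝ] V) ∘ f = fun y => f y • v := by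
    funext y; simp
  rw [h2, ContinuousLinearMap.norm_toSpanSingleton] at h1
  calc _ ≤ ‖v‖ * ‖iteratedFDeriv ℝ k f x‖ := h1
    _ ≤ ‖v‖ * (E / h ^ k) := mul_le_mul_of_nonneg_left (hf k hk) (norm_nonneg _)
    _ = _ := by ring

/-- The constant of the inverse estimates for Bernstein polynomials. -/
def inverseConst (D p : ℕ) (κ : ℝ) : ℝ :=
  2 ^ p * (2 ^ p) ^ (D + 1) * (2 ^ p * (1 + 2 * κ)) ^ p * (D + 1) ^ p

lemma inverseConst_nonneg (D p : ℕ) {κ : ℝ} (hκ : 0 < κ) : 0 ≤ inverseConst D p κ := by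
  unfold inverseConst; positivity

namespace IsRegularSimplex

variable {K : Finset (Pt D)} {κ h : ℝ}

lemma dist_le (hK : IsRegularSimplex K κ h) {x y : Pt D} (hx : x ∈ hull K) (hy : y ∈ hull K) :
    ‖x - y‖ ≤ h := by
  rw [← dist_eq_norm]
  exact (Metric.dist_le_diam_of_mem (isCompact_hull K).isBounded hx hy).trans hK.diam_le

/-- A step of length `h / (2κ)` from the centre of the inscribed ball stays in the simplex, where
the coordinate has values in `[0, 1]`. It thus changes by at most `1` over that length, which bounds
its slope. -/
lemma norm_bary_linear_le (hK : IsRegularSimplex K κ h) {v : Pt D} (hv : v ∈ K)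
    {l : Pt D →L[ℝ] ℝ} (hl : ∀ x y, bary K v x = bary K v y + l (x - y)) : ‖l‖ ≤ 2 * κ / h := by
  have hh := hK.h_pos
  have hκ := hK.kappa_pos
  obtain ⟨y, hy⟩ := hK.ball
  refine l.opNorm_le_bound (by positivity) fun x => ?_
  rcases eq_or_ne x 0 with rfl | hx
  · simp
  have hx' : 0 < ‖x‖ := norm_pos_iff.2 hx
  set t : ℝ := h / (2 * κ * ‖x‖) with ht
  have ht0 : 0 < t := by positivity
  have hy0 : y ∈ hull K := hy (Metric.mem_ball_self (by positivity))
  have hy1 : y + t • x ∈ hull K := by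
    refine hy ?_
    rw [Metric.mem_ball, dist_eq_norm, add_sub_cancel_left, norm_smul, Real.norm_of_nonneg ht0.le]
    have : t * ‖x‖ = h / κ / 2 := by rw [ht]; field_simp
    rw [this]
    exact half_lt_self (by positivity)
  have h1 := hl (y + t • x) y
  rw [add_sub_cancel_left, map_smul, smul_eq_mul] at h1
  have b1 := hK.simplex.bary_nonneg hv hy0
  have b2 := hK.simplex.bary_le_one hv hy0
  have b3 := hK.simplex.bary_nonneg hv hy1
  have b4 := hK.simplex.bary_le_one hv hy1
  have h2 : |t * l x| ≤ 1 := abs_le.2 ⟨by linarith, by linarith⟩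
  rw [abs_mul, abs_of_pos ht0] at h2
  rw [Real.norm_eq_abs]
  have h3 : t * (2 * κ / h * ‖x‖) = 1 := by rw [ht]; field_simp
  exact le_of_mul_le_mul_left (h2.trans h3.ge) ht0

lemma derivBound_bary (hK : IsRegularSimplex K κ h) {v x : Pt D} (hv : v ∈ K) (hx : x ∈ hull K)
    (n : ℕ) : DerivBound (bary K v) x n h (1 + 2 * κ) := by
  have hh := hK.h_pos
  have hκ := hK.kappa_pos
  obtain ⟨l, hl⟩ := hK.simplex.exists_bary_affine hv
  have hd : fderiv ℝ (bary K v) = fun _ => l := by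
    funext z
    have : bary K v = fun x => bary K v 0 + (l x - l 0) :=
      funext fun x => by rw [hl x 0, map_sub]
    rw [this]
    simp
  intro k _
  rcases k with _ | k
  · rw [norm_iteratedFDeriv_zero, pow_zero, div_one,
      Real.norm_of_nonneg (hK.simplex.bary_nonneg hv hx)]
    have := hK.simplex.bary_le_one hv hx
    linarith
  · rw [← norm_iteratedFDeriv_fderiv, hd]
    rcases Nat.eq_zero_or_pos k with rfl | hk
    · rw [norm_iteratedFDeriv_zero, zero_add, pow_one]
      refine (hK.norm_bary_linear_le hv hl).trans ?_
      gcongr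
      linarith
    · rw [iteratedFDeriv_const_of_ne hk.ne']
      simp only [Pi.zero_apply, norm_zero]
      positivity

/-- There are `D + 1` factors and the exponents sum to `p`, so the bound depends on `α` only through
the multinomial coefficient; these sum to `(D + 1)^p`, the last factor of `inverseConst`. -/
lemma derivBound_bernsteinPoly (hK : IsRegularSimplex K κ h) {p : ℕ} {α : Pt D → ℕ}
    (hα : α ∈ multiIdx p K) {x : Pt D} (hx : x ∈ hull K) :
    DerivBound (bernsteinPoly K α) x p h (Nat.multinomial K α *
      (2 ^ p * (2 ^ p) ^ (D + 1) * (2 ^ p * (1 + 2 * κ)) ^ p)) := by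
  have hh := hK.h_pos
  have hκ := hK.kappa_pos
  have h1 := DerivBound.prod K (f := fun v y => bary K v y ^ α v) (x := x) (n := p)
    (E := fun v => (2 ^ p * (1 + 2 * κ)) ^ α v) hh (fun v _ => by positivity)
    (fun v hv => (hK.derivBound_bary hv hx p).pow hh (by positivity)
      (hK.simplex.contDiff_bary hv) (α v))
    (fun v hv => (hK.simplex.contDiff_bary hv).pow _)
  have h2 := (derivBound_const (Nat.multinomial K α : ℝ) x p hh).mul hh (abs_nonneg _)
    (Finset.prod_nonneg fun v _ => by positivity) h1 contDiff_const
    (contDiff_prod fun v hv => (hK.simplex.contDiff_bary hv).pow _)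
  have h3 : (2 : ℝ) ^ p * |(Nat.multinomial K α : ℝ)| *
      ∏ v ∈ K, 2 ^ p * (2 ^ p * (1 + 2 * κ)) ^ α v = Nat.multinomial K α *
      (2 ^ p * (2 ^ p) ^ (D + 1) * (2 ^ p * (1 + 2 * κ)) ^ p) := by
    rw [Finset.prod_mul_distrib, Finset.prod_const, hK.card, Finset.prod_pow_eq_pow_sum,
      (mem_multiIdx.1 hα).1, abs_of_nonneg (Nat.cast_nonneg _)]
    ring
  rw [h3] at h2
  exact h2

lemma sum_multinomial (hK : IsRegularSimplex K κ h) (p : ℕ) :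
    ∑ α ∈ multiIdx p K, (Nat.multinomial K α : ℝ) = (D + 1) ^ p := by
  have := sum_multinomial_mul_prod_pow p K (fun _ => 1)
  simpa [hK.card] using this

/-- Inverse estimate for finite element functions. -/
lemma derivBound_interp {ι : Type} [Fintype ι] (hK : IsRegularSimplex K κ h) {p : ℕ}
    {f : Pt D → ι → ℝ} {δ : ℝ} (hf : ∀ σ ∈ nodes p K, ‖f σ‖ ≤ δ) {x : Pt D}
    (hx : x ∈ hull K) : DerivBound (interp p K f) x p h (inverseConst D p κ * δ) := by
  have hh := hK.h_pos
  have hκ := hK.kappa_pos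
  have e : interp p K f = fun x => ∑ α ∈ multiIdx p K, bernsteinPoly K α x • f (domainPt p K α) :=
    funext fun x => interp_eq_sum p K f x
  rw [e]
  have h1 := DerivBound.sum (multiIdx p K)
    (fun α hα => (hK.derivBound_bernsteinPoly hα hx).smul_const
      (contDiff_bernsteinPoly hK.simplex α) (f (domainPt p K α)))
    (fun α _ => (contDiff_bernsteinPoly hK.simplex α).smul contDiff_const)
  intro k hk
  refine (h1 k hk).trans ?_
  refine div_le_div_of_nonneg_right ?_ (by positivity)
  calc _ ≤ ∑ α ∈ multiIdx p K, (Nat.multinomial K α : ℝ) *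
        ((2 ^ p * (2 ^ p) ^ (D + 1) * (2 ^ p * (1 + 2 * κ)) ^ p) * δ) := by
        refine Finset.sum_le_sum fun α hα => ?_
        rw [mul_assoc]
        gcongr
        exact hf _ (Finset.mem_image_of_mem _ hα)
    _ = _ := by rw [← Finset.sum_mul, hK.sum_multinomial]; unfold inverseConst; ring

lemma derivBound_shape (hK : IsRegularSimplex K κ h) (p : ℕ) (σ : Pt D) {x : Pt D}
    (hx : x ∈ hull K) : DerivBound (shape p K σ) x p h (inverseConst D p κ) := by
  have hh := hK.h_pos
  have hκ := hK.kappa_pos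
  unfold shape
  have h1 := DerivBound.sum ((multiIdx p K).filter fun α => domainPt p K α = σ)
    (fun α hα => hK.derivBound_bernsteinPoly (Finset.mem_filter.1 hα).1 hx)
    (fun α _ => contDiff_bernsteinPoly hK.simplex α)
  intro k hk
  refine (h1 k hk).trans ?_
  refine div_le_div_of_nonneg_right ?_ (by positivity)
  refine (Finset.sum_le_sum_of_subset_of_nonneg (Finset.filter_subset _ _)
    fun α _ _ => by positivity).trans ?_
  rw [← Finset.sum_mul, hK.sum_multinomial]
  unfold inverseConst
  exact le_of_eq (by ring)

lemma norm_fderiv_interp_le {ι : Type} [Fintype ι] (hK : IsRegularSimplex K κ h) {p : ℕ}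
    (hp : 1 ≤ p) {f : Pt D → ι → ℝ} {δ : ℝ} (hf : ∀ σ ∈ nodes p K, ‖f σ‖ ≤ δ) {x : Pt D}
    (hx : x ∈ hull K) : ‖fderiv ℝ (interp p K f) x‖ ≤ inverseConst D p κ * δ / h := by
  have := hK.derivBound_interp hf hx 1 hp
  rwa [pow_one, ← zero_add 1, ← norm_iteratedFDeriv_fderiv, norm_iteratedFDeriv_zero] at this

/-- If coefficients are affine up to `δ`, the derivative of the finite element function is that
of the affine function up to `C δ / h`. -/
lemma norm_fderiv_interp_sub_le {ι : Type} [Fintype ι] (hK : IsRegularSimplex K κ h) {p : ℕ}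
    (hp : 1 ≤ p) {f : Pt D → ι → ℝ} {a : ι → ℝ} {B : Pt D →L[ℝ] (ι → ℝ)} {σ : Pt D} {δ : ℝ}
    (hf : ∀ τ ∈ nodes p K, ‖f τ - (a + B (τ - σ))‖ ≤ δ) {x : Pt D}
    (hx : x ∈ hull K) : ‖fderiv ℝ (interp p K f) x - B‖ ≤ inverseConst D p κ * δ / h := by
  set A : Pt D → ι → ℝ := fun τ => a + B (τ - σ) with hA
  have h1 : interp p K (f - A) = fun x => interp p K f x - (a + (B x - B σ)) := by
    funext y
    rw [interp_sub, hA, interp_affine hK.simplex hp, map_sub]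
  have h2 : fderiv ℝ (interp p K (f - A)) x = fderiv ℝ (interp p K f) x - B := by
    have hd : DifferentiableAt ℝ (interp p K f) x :=
      (contDiff_interp hK.simplex p f).differentiable (by simp) x
    rw [h1]
    exact (hd.hasFDerivAt.sub ((B.hasFDerivAt.sub_const (B σ)).const_add a)).fderiv
  rw [← h2]
  exact hK.norm_fderiv_interp_le hp (fun τ hτ => hf τ hτ) hx

/-- Moving from `x` by `-(v - w) / (4κ)`, for another vertex `w`, is a displacement of at most `h /
(4κ)` and stays in the inscribed ball. It lowers the coordinate of `v` by exactly `1 / (4κ)`, and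
the result is still nonnegative. -/
lemma bary_ge (hD : 1 ≤ D) (hK : IsRegularSimplex K κ h) {y : Pt D}
    (hy : Metric.ball y (h / κ) ⊆ hull K) {v x : Pt D} (hv : v ∈ K)
    (hx : x ∈ Metric.ball y (h / (2 * κ))) : 1 / (4 * κ) ≤ bary K v x := by
  have hh := hK.h_pos
  have hκ := hK.kappa_pos
  obtain ⟨w, hw, hwv⟩ : ∃ w ∈ K, w ≠ v :=
    Finset.exists_mem_ne (by rw [hK.card]; omega) v
  obtain ⟨l, hl⟩ := hK.simplex.exists_bary_affine hv
  have h1 : l (v - w) = 1 := by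
    have := hl v w
    rw [hK.simplex.bary_self hv, hK.simplex.bary_of_ne hv hw hwv.symm] at this
    linarith
  have h2 : x - (1 / (4 * κ)) • (v - w) ∈ hull K := by
    refine hy ?_
    rw [Metric.mem_ball, dist_eq_norm] at hx ⊢
    have h3 := hK.dist_le (subset_hull K hv) (subset_hull K hw)
    calc _ = ‖(x - y) - (1 / (4 * κ)) • (v - w)‖ := by congr 1; abel
      _ ≤ ‖x - y‖ + ‖(1 / (4 * κ)) • (v - w)‖ := norm_sub_le _ _
      _ ≤ ‖x - y‖ + 1 / (4 * κ) * h := by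
          rw [norm_smul, Real.norm_of_nonneg (by positivity)]
          gcongr
      _ < h / (2 * κ) + h / (2 * κ) := by
          refine add_lt_add hx ?_
          rw [one_div_mul_eq_div]
          exact div_lt_div_of_pos_left hh (by positivity) (by linarith)
      _ = h / κ := by field_simp; norm_num
  have h4 := hl (x - (1 / (4 * κ)) • (v - w)) x
  have h5 := hK.simplex.bary_nonneg hv h2
  rw [h4, sub_sub_cancel_left, map_neg, map_smul, h1, smul_eq_mul, mul_one] at h5
  linarith

end IsRegularSimplex

/-- Lower bound for the normalized mass of a Bernstein polynomial. -/
def massConst (D p : ℕ) (κ : ℝ) : ℝ :=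
  (1 / (4 * κ)) ^ p * (1 / (2 * κ)) ^ D * volume.real (Metric.ball (0 : Pt D) 1)

lemma massConst_pos (D p : ℕ) {κ : ℝ} (hκ : 0 < κ) : 0 < massConst D p κ := by
  unfold massConst
  have : 0 < volume.real (Metric.ball (0 : Pt D) 1) :=
    ENNReal.toReal_pos (Metric.measure_ball_pos _ _ one_pos).ne' measure_ball_lt_top.ne
  positivity

lemma integrableOn_hull {V : Type*} [NormedAddCommGroup V]
    {K : Finset (Pt D)} {g : Pt D → V} (hg : Continuous g) :
    IntegrableOn g (hull K) :=
  hg.continuousOn.integrableOn_compact (isCompact_hull K)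

/-- On the concentric ball of half the radius all barycentric coordinates are at least `1 / (4κ)`,
and one Bernstein polynomial with domain point `σ` suffices because the others are nonnegative. The
resulting mass of order `h^D` is what the face terms are measured against. -/
lemma IsRegularSimplex.integral_shape_ge (hD : 1 ≤ D) {K : Finset (Pt D)} {κ h : ℝ}
    (hK : IsRegularSimplex K κ h) {p : ℕ} {σ : Pt D} (hσ : σ ∈ nodes p K) :
    massConst D p κ * h ^ D ≤ ∫ x in hull K, shape p K σ x := by
  classical
  have hh := hK.h_pos
  have hκ := hK.kappa_pos
  obtain ⟨y, hy⟩ := hK.ball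
  have hsub : Metric.ball y (h / (2 * κ)) ⊆ hull K := by
    refine (Metric.ball_subset_ball ?_).trans hy
    exact div_le_div_of_nonneg_left hh.le hκ (by linarith)
  obtain ⟨α, hα, hασ⟩ := Finset.mem_image.1 hσ
  have hα' : α ∈ multiIdx p K := hα
  have hge : ∀ x ∈ Metric.ball y (h / (2 * κ)), (1 / (4 * κ)) ^ p ≤ shape p K σ x := by
    intro x hx
    have h1 : bernsteinPoly K α x ≤ shape p K σ x := by
      unfold shape
      refine Finset.single_le_sum (f := fun α => bernsteinPoly K α x)
        (fun β _ => bernsteinPoly_nonneg hK.simplex β (hsub hx)) ?_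
      exact Finset.mem_filter.2 ⟨hα', hασ⟩
    refine le_trans ?_ h1
    unfold bernsteinPoly
    have h2 : (1 / (4 * κ)) ^ p ≤ ∏ v ∈ K, bary K v x ^ α v := by
      rw [← (mem_multiIdx.1 hα').1, ← Finset.prod_pow_eq_pow_sum]
      refine Finset.prod_le_prod (fun v _ => by positivity) fun v hv => ?_
      exact pow_le_pow_left₀ (by positivity) (hK.bary_ge hD hy hv hx) _
    have h3 : (1 : ℝ) ≤ Nat.multinomial K α := by exact_mod_cast Nat.multinomial_pos K α
    refine h2.trans (le_mul_of_one_le_left ?_ h3)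
    exact le_trans (by positivity) h2
  have hint := integrableOn_hull (K := K) (continuous_shape hK.simplex p σ)
  calc massConst D p κ * h ^ D
      = (1 / (4 * κ)) ^ p * volume.real (Metric.ball y (h / (2 * κ))) := by
        rw [Measure.real, Measure.addHaar_ball_of_pos _ _ (by positivity), ENNReal.toReal_mul,
          ENNReal.toReal_ofReal (by positivity), finrank_euclideanSpace_fin]
        unfold massConst Measure.real
        rw [div_eq_mul_one_div h, mul_pow]
        ring
    _ ≤ ∫ x in Metric.ball y (h / (2 * κ)), shape p K σ x :=
        setIntegral_ge_of_const_le_real measurableSet_ball measure_ball_lt_top.ne hge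
          (hint.mono_set hsub)
    _ ≤ ∫ x in hull K, shape p K σ x := by
        refine setIntegral_mono_set hint ?_ hsub.eventuallyLE
        filter_upwards [ae_restrict_mem (measurableSet_hull K)] with x hx
        exact shape_nonneg hK.simplex p σ hx

/-! ### Averages over the cell of a degree of freedom -/

section Cells

variable {p : ℕ} {T : Mesh D} {σ : Pt D}

lemma finite_elemsAt (hp : 1 ≤ p) (T : Mesh D) (σ : Pt D) : (elemsAt p T σ).Finite := by
  refine (T.locallyFinite σ).subset fun K hK => ?_
  exact ⟨hK.1.1, nodes_subset_hull hp hK.2⟩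

lemma integral_shape_nonneg {K : Finset (Pt D)} (hK : K ∈ T.elems) (σ : Pt D) :
    0 ≤ ∫ x in hull K, shape p K σ x :=
  setIntegral_nonneg (measurableSet_hull K) fun _ hx =>
    shape_nonneg (isSimplex_of_mem_elems hK) p σ hx

lemma cellVol_eq (hp : 1 ≤ p) (T : Mesh D) (σ : Pt D) :
    cellVol p T σ = ∑ K ∈ (finite_elemsAt hp T σ).toFinset, ∫ x in hull K, shape p K σ x :=
  finsum_mem_eq_finite_toFinset_sum _ _

lemma cellVol_pos (hD : 1 ≤ D) (hp : 1 ≤ p) {Ω : Set (Pt D)} {κ h : ℝ} (hκ : 0 < κ)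
    (hT : T.IsRegular Ω κ h) (hσ : σ ∈ dofs p T) : 0 < cellVol p T σ := by
  obtain ⟨K, hK, hσK⟩ := hσ
  rw [cellVol_eq hp]
  have h1 := (hT.simplex hκ hK).integral_shape_ge hD hσK
  have h2 : 0 < massConst D p κ * h ^ D := mul_pos (massConst_pos D p hκ) (pow_pos hT.1 _)
  refine (h2.trans_le h1).trans_le ?_
  refine Finset.single_le_sum (f := fun K => ∫ x in hull K, shape p K σ x)
    (fun K hK => integral_shape_nonneg (T := T)
      ((finite_elemsAt hp T σ).mem_toFinset.1 hK).1 σ) ?_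
  exact (finite_elemsAt hp T σ).mem_toFinset.2 ⟨hK, hσK⟩

/-- Contributions of the elements around `σ` that are `c` times the mass of `φ_σ` up to a relative
error `η` sum up to `c`, up to `η`, after normalization. -/
lemma norm_normalized_sum_sub_le {V : Type*} [NormedAddCommGroup V] [NormedSpace ℝ V]
    (hp : 1 ≤ p) (hpos : 0 < cellVol p T σ) {ψ : Finset (Pt D) → V} {c : V} {η : ℝ}
    (h : ∀ K ∈ elemsAt p T σ,
      ‖ψ K - (∫ x in hull K, shape p K σ x) • c‖ ≤ (∫ x in hull K, shape p K σ x) * η) :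
    ‖(cellVol p T σ)⁻¹ • (∑ᶠ K ∈ elemsAt p T σ, ψ K) - c‖ ≤ η := by
  have e : (cellVol p T σ)⁻¹ • (∑ᶠ K ∈ elemsAt p T σ, ψ K) - c =
      (cellVol p T σ)⁻¹ • ∑ K ∈ (finite_elemsAt hp T σ).toFinset,
        (ψ K - (∫ x in hull K, shape p K σ x) • c) := by
    rw [Finset.sum_sub_distrib, ← Finset.sum_smul, ← cellVol_eq hp, smul_sub, smul_smul,
      inv_mul_cancel₀ hpos.ne', one_smul, finsum_mem_eq_finite_toFinset_sum]
  rw [e, norm_smul, norm_inv, Real.norm_of_nonneg hpos.le, inv_mul_le_iff₀ hpos]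
  refine (norm_sum_le_of_le _ fun K hK => h K ((finite_elemsAt hp T σ).mem_toFinset.1 hK)).trans ?_
  rw [← Finset.sum_mul, ← cellVol_eq hp]

/-- Bernstein polynomials are nonnegative on the element, so integration against `φ_σ` is a weighted
average and loses no constant. -/
lemma norm_integral_shape_smul_sub_le {V : Type*} [NormedAddCommGroup V] [NormedSpace ℝ V]
    [CompleteSpace V] {K : Finset (Pt D)} (hK : IsSimplex K) (σ : Pt D) {ψ : Pt D → V}
    (hψ : Continuous ψ) {c : V} {η : ℝ} (h : ∀ x ∈ hull K, ‖ψ x - c‖ ≤ η) :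
    ‖(∫ x in hull K, shape p K σ x • ψ x) - (∫ x in hull K, shape p K σ x) • c‖ ≤
      (∫ x in hull K, shape p K σ x) * η := by
  have cs := continuous_shape hK p σ
  have i1 : IntegrableOn (fun x => shape p K σ x • ψ x) (hull K) :=
    integrableOn_hull (cs.smul hψ)
  have i2 : IntegrableOn (fun x => shape p K σ x • c) (hull K) :=
    integrableOn_hull (cs.smul continuous_const)
  rw [← integral_smul_const, ← integral_sub i1 i2, ← integral_mul_const]
  refine norm_integral_le_of_norm_le (integrableOn_hull (cs.mul continuous_const)) ?_
  filter_upwards [ae_restrict_mem (measurableSet_hull K)] with x hx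
  rw [← smul_sub, norm_smul, Real.norm_of_nonneg (shape_nonneg hK p σ hx)]
  exact mul_le_mul_of_nonneg_left (h x hx) (shape_nonneg hK p σ hx)

end Cells

end Regular

end

section

/-! ### Consistency of the Galerkin residuals with jump stabilization -/

section Galerkin

variable {D L : ℕ}

lemma hull_mono {e K : Finset (Pt D)} (h : e ⊆ K) : hull e ⊆ hull K :=
  convexHull_mono (by exact_mod_cast h)

/-- A simplex with `D` vertices in `ℝ^D` of diameter `h` has `(D - 1)`-dimensional measure
`O(h ^ (D - 1))`. -/
lemma exists_measure_face_le (hD : 1 ≤ D) : ∃ C : ℝ, 0 ≤ C ∧ ∀ (e : Finset (Pt D)) (h : ℝ),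
    e.card = D → 0 ≤ h → (∀ x ∈ e, ∀ y ∈ e, ‖x - y‖ ≤ h) →
    (μHE[D - 1] : Measure (Pt D)) (hull e) ≤ ENNReal.ofReal (C * h ^ (D - 1)) := by
  obtain ⟨d, rfl⟩ : ∃ d, D = d + 1 := ⟨D - 1, by omega⟩
  rw [Nat.add_sub_cancel]
  -- `μHE[d]` is this multiple of `μH[d]`; the factor goes into the constant.
  set c : NNReal :=
    Measure.addHaarScalarFactor (volume : Measure (EuclideanSpace ℝ (Fin d))) μH[d] with hc
  refine ⟨c * (d : ℝ) ^ d, by positivity, fun e h he hh hdiam => ?_⟩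
  let v : Fin (d + 1) → Pt (d + 1) := fun i => (e.equivFinOfCardEq he).symm i
  have hv : ∀ i, v i ∈ e := fun i => ((e.equivFinOfCardEq he).symm i).2
  have hv' : ∀ x ∈ e, ∃ i, v i = x := fun x hx =>
    ⟨e.equivFinOfCardEq he ⟨x, hx⟩, by simp [v]⟩
  let l : (Fin d → ℝ) →ₗ[ℝ] Pt (d + 1) :=
    Fintype.linearCombination ℝ (fun i : Fin d => v i.succ - v 0)
  have hl : ∀ t, l t = ∑ i, t i • (v i.succ - v 0) := fun t =>
    Fintype.linearCombination_apply ℝ _ t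
  -- The face is covered by an affine image of the unit cube of dimension `d = D - 1`. The map has
  -- Lipschitz constant `d * h` for the sup norm, and the cube has Hausdorff measure one.
  have hsub : hull e ⊆ (fun t => v 0 + l t) '' Icc 0 1 := by
    have hconv : Convex ℝ ((fun t => v 0 + l t) '' Icc 0 1) := by
      have := ((convex_Icc (0 : Fin d → ℝ) 1).linear_image l).translate (v 0)
      rwa [image_image] at this
    refine convexHull_min (fun x hx => ?_) hconv
    obtain ⟨i, rfl⟩ := hv' x hx
    refine Fin.cases ?_ (fun j => ?_) i
    · exact ⟨0, ⟨le_rfl, zero_le_one⟩, by simp⟩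
    · refine ⟨Pi.single j 1, ⟨?_, ?_⟩, ?_⟩
      · exact Pi.single_nonneg.2 zero_le_one
      · intro i
        by_cases hij : i = j
        · subst hij; simp
        · simp [hij]
      · simp only [hl]
        rw [Finset.sum_eq_single j]
        · simp
        · intro i _ hij
          simp [hij]
        · simp
  have hlip : LipschitzWith (d * h).toNNReal (fun t => v 0 + l t) := by
    refine LipschitzWith.of_dist_le_mul fun s t => ?_
    rw [Real.coe_toNNReal _ (by positivity), dist_add_left, dist_eq_norm, dist_eq_norm, ← map_sub,
      hl]
    calc _ ≤ ∑ _i : Fin d, ‖s - t‖ * h := by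
          refine norm_sum_le_of_le _ fun i _ => ?_
          rw [norm_smul]
          exact mul_le_mul (norm_le_pi_norm (s - t) i) (hdiam _ (hv _) _ (hv _)) (norm_nonneg _)
            (norm_nonneg _)
      _ = _ := by simp; ring
  have h1 := (measure_mono hsub).trans
    (hlip.hausdorffMeasure_image_le (d := d) (Nat.cast_nonneg d) (Icc 0 1))
  have hvol : (μH[(d : ℝ)] : Measure (Fin d → ℝ)) (Icc 0 1) = 1 := by
    have := hausdorffMeasure_pi_real (ι := Fin d)
    rw [Fintype.card_fin] at this
    rw [this, Real.volume_Icc_pi]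
    simp
  rw [hvol, mul_one, ENNReal.rpow_natCast] at h1
  rw [Measure.euclideanHausdorffMeasure_def, ← hc]
  calc (c • (μH[(d : ℝ)] : Measure (Pt (d + 1)))) (hull e)
      = c * (μH[(d : ℝ)] : Measure (Pt (d + 1))) (hull e) := rfl
    _ ≤ c * ENNReal.ofReal (d * h) ^ d := by gcongr; exact h1
    _ = _ := by
        rw [ENNReal.ofReal_mul (by positivity), ENNReal.ofReal_mul (by positivity),
          ENNReal.ofReal_mul (by positivity), mul_pow, ENNReal.ofReal_pow (by positivity),
          ENNReal.ofReal_pow (by positivity), ENNReal.ofReal_coe_nnreal, mul_assoc]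

lemma norm_faceNormal_le (e : Finset (Pt D)) : ‖faceNormal e‖ ≤ 1 := by
  unfold faceNormal
  split_ifs with h
  · exact h.choose_spec.1.le
  · simp

lemma norm_dirDeriv_le {V : Type} [NormedAddCommGroup V] [NormedSpace ℝ V] {g : Pt D → V}
    {x n : Pt D} {k m : ℕ} {h E : ℝ} (hg : DerivBound g x m h E) (hk : k ≤ m) (hn : ‖n‖ ≤ 1) :
    ‖dirDeriv k g n x‖ ≤ E / h ^ k := by
  refine le_trans ?_ (hg k hk)
  refine ((iteratedFDeriv ℝ k g x).le_opNorm _).trans ?_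
  refine mul_le_of_le_one_right (norm_nonneg _) ?_
  exact Finset.prod_le_one (fun _ _ => norm_nonneg _) fun _ _ => hn

lemma continuous_dirDeriv {V : Type} [NormedAddCommGroup V] [NormedSpace ℝ V] {g : Pt D → V}
    (hg : ContDiff ℝ ⊤ g) (k : ℕ) (n : Pt D) : Continuous (dirDeriv k g n) := by
  have h1 : Continuous fun x => iteratedFDeriv ℝ k g x :=
    hg.continuous_iteratedFDeriv (m := k) le_top
  have h2 : Continuous fun T : ContinuousMultilinearMap ℝ (fun _ : Fin k => Pt D) V =>
      T (fun _ => n) := by fun_prop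
  exact h2.comp h1

lemma dirDeriv_add {V : Type} [NormedAddCommGroup V] [NormedSpace ℝ V] {f g : Pt D → V}
    (hf : ContDiff ℝ ⊤ f) (hg : ContDiff ℝ ⊤ g) (k : ℕ) (n x : Pt D) :
    dirDeriv k (fun y => f y + g y) n x = dirDeriv k f n x + dirDeriv k g n x := by
  unfold dirDeriv
  have := iteratedFDeriv_add_apply (i := k) (x := x) (hf.of_le le_top).contDiffAt
    (hg.of_le le_top).contDiffAt
  change iteratedFDeriv ℝ k (f + g) x (fun _ => n) = _
  rw [this]
  rfl

lemma dirDeriv_interp {K : Finset (Pt D)} (hK : IsSimplex K) (p k : ℕ)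
    (f : Pt D → Fin L → ℝ) (n x : Pt D) :
    dirDeriv k (interp p K f) n x = ∑ τ ∈ nodes p K, dirDeriv k (shape p K τ) n x • f τ := by
  unfold dirDeriv interp
  have hc : ∀ τ ∈ nodes p K, ContDiffAt ℝ k (fun y => shape p K τ y • f τ) x := fun τ _ =>
    (((contDiff_shape hK p τ).smul contDiff_const).of_le le_top).contDiffAt
  rw [iteratedFDeriv_fun_sum_apply hc, sum_apply]
  refine Finset.sum_congr rfl fun τ _ => ?_
  have h2 : (fun y => shape p K τ y • f τ) =
      (ContinuousLinearMap.toSpanSingleton ℝ (f τ) : ℝ →L[ℝ] Fin L → ℝ) ∘ shape p K τ := by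
    funext y; simp
  rw [h2, ContinuousLinearMap.iteratedFDeriv_comp_left _ (contDiff_shape hK p τ).contDiffAt le_top]
  simp

lemma pderiv_interp {K : Finset (Pt D)} (hK : IsSimplex K) (p : ℕ) (d : Fin D)
    (f : Pt D → Fin L → ℝ) (x : Pt D) :
    pderiv d (interp p K f) x =
      ∑ τ ∈ nodes p K, fderiv ℝ (shape p K τ) x (unitDir d) • f τ := by
  unfold pderiv interp
  rw [fderiv_fun_sum fun τ _ => ((contDiff_shape hK p τ).differentiable (by simp) x).smul_const _]
  rw [sum_apply]
  refine Finset.sum_congr rfl fun τ _ => ?_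
  rw [fderiv_smul_const ((contDiff_shape hK p τ).differentiable (by simp) x)]
  simp

lemma continuous_setIntegral_sum {X ι V : Type*} [TopologicalSpace X] [NormedAddCommGroup V]
    [NormedSpace ℝ V] [CompleteSpace V] (μ : Measure (Pt D)) {s : Set (Pt D)} (hs : IsCompact s)
    (hμ : μ s < ⊤) (N : Finset ι) {c : ι → Pt D → ℝ} (hc : ∀ i, Continuous (c i))
    {g : ι → X → V} (hg : ∀ i, Continuous (g i)) :
    Continuous fun f : X => ∫ x in s, ∑ i ∈ N, c i x • g i f ∂μ := by
  -- For faces `μ` is `μHE[D - 1]`, which is not locally finite on `ℝ^D`; integrability of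
  -- continuous functions comes from the restriction to `s`.
  have : IsFiniteMeasure (μ.restrict s) := ⟨by simpa using hμ⟩
  have hi : ∀ i, IntegrableOn (c i) s μ := by
    intro i
    have := (hc i).continuousOn.integrableOn_compact (μ := μ.restrict s) hs
    rwa [IntegrableOn, Measure.restrict_restrict_of_subset subset_rfl] at this
  have e : (fun f : X => ∫ x in s, ∑ i ∈ N, c i x • g i f ∂μ) =
      fun f => ∑ i ∈ N, (∫ x in s, c i x ∂μ) • g i f := by
    funext f
    rw [integral_finsetSum _ fun i _ => (hi i).smul_const _]
    exact Finset.sum_congr rfl fun i _ => integral_smul_const _ _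
  rw [e]
  exact continuous_finsetSum _ fun i _ => (hg i).const_smul _

lemma lam_eq (Λ : Fin D → Fin L → ℝ) (d : Fin D) (v : Fin L → ℝ) : lam Λ d v = Λ d * v := by
  funext i
  simp [lam, Matrix.mulVec_diagonal]

lemma continuous_lam (Λ : Fin D → Fin L → ℝ) (d : Fin D) : Continuous (lam Λ d) := by
  have : lam Λ d = fun v => Λ d * v := funext (lam_eq Λ d)
  rw [this]
  fun_prop

lemma norm_lam_sub_le (Λ : Fin D → Fin L → ℝ) (d : Fin D) (v w : Fin L → ℝ) :
    ‖lam Λ d v - lam Λ d w‖ ≤ ‖Λ d‖ * ‖v - w‖ := by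
  rw [lam_eq, lam_eq, ← mul_sub]
  exact norm_mul_le _ _

lemma norm_unitDir (d : Fin D) : ‖(unitDir d : Pt D)‖ = 1 := by simp [unitDir]

/-- The sum `∑_d Λ_d B e_d` depends on the linear map `B` in a Lipschitz continuous way. -/
lemma norm_sum_lam_sub_le (Λ : Fin D → Fin L → ℝ) (B B' : Pt D →L[ℝ] (Fin L → ℝ)) :
    ‖∑ d, lam Λ d (B (unitDir d)) - ∑ d, lam Λ d (B' (unitDir d))‖ ≤ (∑ d, ‖Λ d‖) * ‖B - B'‖ := by
  rw [← Finset.sum_sub_distrib, Finset.sum_mul]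
  refine norm_sum_le_of_le _ fun d _ => (norm_lam_sub_le Λ d _ _).trans ?_
  gcongr
  have := (B - B').le_opNorm (unitDir d)
  rwa [norm_unitDir, mul_one] at this

lemma continuous_sum_lam_pderiv {K : Finset (Pt D)} (hK : IsSimplex K) (p : ℕ)
    (Λ : Fin D → Fin L → ℝ) (f : Pt D → Fin L → ℝ) :
    Continuous fun x => ∑ d, lam Λ d (pderiv d (interp p K f) x) := by
  refine continuous_finsetSum _ fun d _ => (continuous_lam Λ d).comp ?_
  exact ((contDiff_interp hK p f).continuous_fderiv (by simp)).clm_apply continuous_const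

variable {p : ℕ} {T : Mesh D}

lemma measure_face_lt_top (hD : 1 ≤ D) {e : Finset (Pt D)} (he : e.card = D) :
    (μHE[D - 1] : Measure (Pt D)) (hull e) < ⊤ := by
  obtain ⟨C, _, hC⟩ := exists_measure_face_le hD
  refine (hC e (Metric.diam (hull e)) he Metric.diam_nonneg fun x hx y hy => ?_).trans_lt
    ENNReal.ofReal_lt_top
  rw [← dist_eq_norm]
  exact Metric.dist_le_diam_of_mem (isCompact_hull e).isBounded (subset_hull e hx)
    (subset_hull e hy)

lemma continuous_jumpTerm (hD : 1 ≤ D) {K e : Finset (Pt D)} (hK : K ∈ T.elems) (he : e.card = D)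
    (k : ℕ) (σ : Pt D) :
    Continuous (jumpTerm p T k K e σ : (Pt D → Fin L → ℝ) → Fin L → ℝ) := by
  unfold jumpTerm
  split_ifs with hK'
  swap
  · exact continuous_const
  have s1 := isSimplex_of_mem_elems hK
  have s2 := isSimplex_of_mem_elems hK'.choose_spec.1
  set K' := hK'.choose
  set n := faceNormal e
  have c1 := fun τ => continuous_dirDeriv (contDiff_shape s1 p τ) k n
  have c2 := fun τ => continuous_dirDeriv (contDiff_shape s2 p τ) k n
  -- A disjoint sum of the two node sets: a node shared by both elements contributes once from each
  -- side of the face.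
  have key := continuous_setIntegral_sum (X := Pt D → Fin L → ℝ) (V := Fin L → ℝ)
    (μHE[D - 1] : Measure (Pt D)) (isCompact_hull e) (measure_face_lt_top hD he)
    ((nodes p K).disjSum (nodes p K'))
    (c := Sum.elim
      (fun τ x => (dirDeriv k (shape p K σ) n x - dirDeriv k (shape p K' σ) n x) *
        dirDeriv k (shape p K τ) n x)
      (fun τ x => -((dirDeriv k (shape p K σ) n x - dirDeriv k (shape p K' σ) n x) *
        dirDeriv k (shape p K' τ) n x)))
    (fun i => by
      rcases i with τ | τ
      · exact ((c1 σ).sub (c2 σ)).mul (c1 τ)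
      · exact (((c1 σ).sub (c2 σ)).mul (c2 τ)).neg)
    (g := Sum.elim (fun τ f => f τ) (fun τ f => f τ))
    (fun i => by rcases i with τ | τ <;> exact continuous_apply τ)
  refine key.congr fun f => integral_congr_ae (.of_forall fun x => ?_)
  beta_reduce
  rw [Finset.sum_disjSum, dirDeriv_interp s1, dirDeriv_interp s2]
  simp only [Sum.elim_inl, Sum.elim_inr, smul_sub, Finset.smul_sum, mul_smul, neg_smul,
    Finset.sum_neg_distrib]
  rw [← sub_eq_add_neg]

lemma continuous_galerkinJump (hD : 1 ≤ D) (Λ : Fin D → Fin L → ℝ) (θ : ℕ → ℝ)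
    {K : Finset (Pt D)} (hK : K ∈ T.elems) (σ : Pt D) :
    Continuous (galerkinJump p Λ θ T K σ) := by
  have s1 := isSimplex_of_mem_elems hK
  unfold galerkinJump
  refine Continuous.add ?_ (continuous_finsetSum _ fun k _ => continuous_finsetSum _ fun e he =>
    (continuous_jumpTerm hD hK (Finset.mem_powersetCard.1 he).2 k σ).const_smul
      (θ k * faceSize K e ^ (2 * k)))
  have key := continuous_setIntegral_sum (X := Pt D → Fin L → ℝ) (V := Fin L → ℝ)
    (volume : Measure (Pt D)) (isCompact_hull K) (isCompact_hull K).measure_lt_top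
    ((Finset.univ : Finset (Fin D)) ×ˢ nodes p K)
    (c := fun i x => shape p K σ x * fderiv ℝ (shape p K i.2) x (unitDir i.1))
    (fun i => (continuous_shape s1 p σ).mul
      (((contDiff_shape s1 p i.2).continuous_fderiv (by simp)).clm_apply continuous_const))
    (g := fun i f => lam Λ i.1 (f i.2))
    (fun i => (continuous_lam Λ i.1).comp (continuous_apply i.2))
  refine key.congr fun f => integral_congr_ae (.of_forall fun x => ?_)
  beta_reduce
  rw [Finset.sum_product, Finset.smul_sum]
  refine Finset.sum_congr rfl fun d _ => ?_
  rw [pderiv_interp s1]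
  simp only [lam, Matrix.mulVec_sum, Matrix.mulVec_smul, Finset.smul_sum, mul_smul]

lemma nodes_subset_dofs {K : Finset (Pt D)} (hK : K ∈ T.elems) :
    ∀ τ ∈ nodes p K, τ ∈ dofs p T := fun _ hτ => ⟨K, hK, hτ⟩

lemma galerkinJump_congr (Λ : Fin D → Fin L → ℝ) (θ : ℕ → ℝ)
    {K : Finset (Pt D)} (hK : K ∈ T.elems) (σ : Pt D) {f g : Pt D → Fin L → ℝ}
    (h : ∀ τ ∈ dofs p T, f τ = g τ) :
    galerkinJump p Λ θ T K σ f = galerkinJump p Λ θ T K σ g := by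
  have e : ∀ K ∈ T.elems, interp p K f = interp p K g := fun K hK =>
    interp_congr fun τ hτ => h τ (nodes_subset_dofs hK τ hτ)
  unfold galerkinJump
  rw [e K hK]
  congr 1
  refine Finset.sum_congr rfl fun k _ => Finset.sum_congr rfl fun e' _ => ?_
  congr 1
  unfold jumpTerm
  split_ifs with hK'
  · rw [e K hK, e _ hK'.choose_spec.1]
  · rfl

/-- Jumps see only the deviation of the coefficients from an affine function. -/
lemma norm_jumpTerm_le (hp : 1 ≤ p) {κ h C : ℝ}
    (hC : ∀ (e : Finset (Pt D)) (h : ℝ),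
      e.card = D → 0 ≤ h → (∀ x ∈ e, ∀ y ∈ e, ‖x - y‖ ≤ h) →
      (μHE[D - 1] : Measure (Pt D)) (hull e) ≤ ENNReal.ofReal (C * h ^ (D - 1)))
    (hC0 : 0 ≤ C) (hreg : ∀ K ∈ T.elems, IsRegularSimplex K κ h) {K e : Finset (Pt D)}
    (hK : K ∈ T.elems) (he : e ∈ K.powersetCard D) {k : ℕ} (hk : k ≤ p) (σ : Pt D)
    {f : Pt D → Fin L → ℝ} {a : Fin L → ℝ} {B : Pt D →L[ℝ] (Fin L → ℝ)} {δ : ℝ} (hδ : 0 ≤ δ)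
    (hf : ∀ K' ∈ T.elems, e ⊆ K' → ∀ τ ∈ nodes p K', ‖f τ - (a + B (τ - σ))‖ ≤ δ) :
    ‖jumpTerm p T k K e σ f‖ ≤ (2 * inverseConst D p κ / h ^ k) *
      (2 * (inverseConst D p κ * δ) / h ^ k) * (C * h ^ (D - 1)) := by
  have hh := (hreg K hK).h_pos
  have hE := inverseConst_nonneg D p (hreg K hK).kappa_pos
  obtain ⟨heK, hecard⟩ := Finset.mem_powersetCard.1 he
  unfold jumpTerm
  split_ifs with hK'
  swap
  · rw [norm_zero]; positivity
  obtain ⟨m', -, heK'⟩ := hK'.choose_spec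
  set K' := hK'.choose
  have r1 := hreg K hK
  have r2 := hreg K' m'
  set n := faceNormal e
  have hn : ‖n‖ ≤ 1 := norm_faceNormal_le e
  set A : Pt D → Fin L → ℝ := fun τ => a + B (τ - σ) with hA
  have cA : ContDiff ℝ ⊤ A := by
    rw [hA]; fun_prop
  -- Both elements reproduce the affine function `A`, so its derivatives cancel in the jump; only
  -- the interpolant of `f - A`, with coefficients of size `δ`, remains.
  have split : ∀ K'' ∈ T.elems, ∀ x, dirDeriv k (interp p K'' f) n x =
      dirDeriv k A n x + dirDeriv k (interp p K'' (f - A)) n x := by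
    intro K'' h'' x
    have s := isSimplex_of_mem_elems h''
    rw [← dirDeriv_add cA (contDiff_interp s p _)]
    congr 1
    funext y
    rw [interp_sub, hA, interp_affine s hp, add_sub_cancel]
  have hμ : (μHE[D - 1] : Measure (Pt D)).real (hull e) ≤ C * h ^ (D - 1) := by
    have := hC e h hecard hh.le fun x hx y hy =>
      r1.dist_le (subset_hull K (heK hx)) (subset_hull K (heK hy))
    exact ENNReal.toReal_le_of_le_ofReal (by positivity) this
  have hfin : (μHE[D - 1] : Measure (Pt D)) (hull e) < ⊤ :=
    (hC e h hecard hh.le fun x hx y hy =>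
      r1.dist_le (subset_hull K (heK hx)) (subset_hull K (heK hy))).trans_lt ENNReal.ofReal_lt_top
  refine (norm_setIntegral_le_of_norm_le_const hfin (C := (2 * inverseConst D p κ / h ^ k) *
      (2 * (inverseConst D p κ * δ) / h ^ k)) fun x hx => ?_).trans
      (mul_le_mul_of_nonneg_left hμ (by positivity))
  have x1 : x ∈ hull K := hull_mono heK hx
  have x2 : x ∈ hull K' := hull_mono heK' hx
  rw [split K hK, split K' m', add_sub_add_left_eq_sub, norm_smul]
  refine mul_le_mul ?_ ?_ (norm_nonneg _) (by positivity)
  · refine (norm_sub_le _ _).trans ?_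
    have b1 := norm_dirDeriv_le (r1.derivBound_shape p σ x1) hk hn
    have b2 := norm_dirDeriv_le (r2.derivBound_shape p σ x2) hk hn
    rw [two_mul, add_div]
    exact add_le_add b1 b2
  · refine (norm_sub_le _ _).trans ?_
    have b1 := norm_dirDeriv_le (r1.derivBound_interp (f := f - A)
      (fun τ hτ => hf K hK heK τ hτ) x1) hk hn
    have b2 := norm_dirDeriv_le (r2.derivBound_interp (f := f - A)
      (fun τ hτ => hf K' m' heK' τ hτ) x2) hk hn
    rw [two_mul, add_div]
    exact add_le_add b1 b2

lemma faceSize_le {κ h : ℝ} {K e : Finset (Pt D)} (hK : IsRegularSimplex K κ h) (he : e ⊆ K) :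
    0 ≤ faceSize K e ∧ faceSize K e ≤ h := by
  unfold faceSize
  split_ifs
  · exact ⟨Metric.diam_nonneg, hK.diam_le⟩
  · exact ⟨Metric.diam_nonneg, (Metric.diam_mono (hull_mono he)
      (isCompact_hull K).isBounded).trans hK.diam_le⟩

/-- The volume term is a weighted average of derivatives that differ from `B` by `O(δ / h)`. In the
jump term of order `k` the two inverse estimates give `δ h^(-2k)`, compensated by `h_e^(2k)`; the
face has measure `O(h^(D-1))`, and relative to a mass at least of order `h^D` the contribution is
again `O(δ / h)`. -/
theorem isConsistentResidual_galerkinJump (hD : 1 ≤ D) (hp : 1 ≤ p) (Λ : Fin D → Fin L → ℝ)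
    (Ω : Set (Pt D)) {κ : ℝ} (hκ : 0 < κ) (θ : ℕ → ℝ) :
    IsConsistentResidual p Λ Ω κ (galerkinJump p Λ θ) := by
  refine ⟨fun T K hK σ _ => ⟨continuous_galerkinJump hD Λ θ hK σ,
    fun f g h => galerkinJump_congr Λ θ hK σ h⟩, fun R _ => ?_⟩
  obtain ⟨C, hC0, hC⟩ := exists_measure_face_le hD
  set E := inverseConst D p κ with hEdef
  have hE : 0 ≤ E := inverseConst_nonneg D p hκ
  have hm : 0 < massConst D p κ := massConst_pos D p hκ
  set C1 : ℝ := (∑ d, ‖Λ d‖) * E with hC1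
  set C2 : ℝ := (∑ k ∈ Finset.Icc 1 p, |θ k|) * (D + 1) * (4 * E ^ 2 * C) / massConst D p κ with hC2
  have hC1' : 0 ≤ C1 := by positivity
  have hC2' : 0 ≤ C2 := by positivity
  -- Two layers are needed: the neighbour across a face of `K` may fail to contain `σ`, but it
  -- shares with `K` a vertex of that face, and vertices are nodes because `1 ≤ p`.
  refine ⟨C1 + C2, 2, fun T h hT σ hσ f a B δ _ _ hδ _ hf => ?_⟩
  have hh : 0 < h := hT.1
  have hreg : ∀ K ∈ T.elems, IsRegularSimplex K κ h := fun K hK => hT.simplex hκ hK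
  have main : ‖(cellVol p T σ)⁻¹ • (∑ᶠ K ∈ elemsAt p T σ, galerkinJump p Λ θ T K σ f) -
      ∑ d, lam Λ d (B (unitDir d))‖ ≤ (C1 + C2) * (δ / h) := by
    refine norm_normalized_sum_sub_le hp (cellVol_pos hD hp hκ hT hσ) fun K hKσ => ?_
    obtain ⟨hK, hσK⟩ := hKσ
    have rK := hreg K hK
    have hmass := rK.integral_shape_ge hD hσK
    have l1 : ∀ τ ∈ nodes p K, τ ∈ layers p T 1 σ := fun τ hτ => ⟨σ, rfl, K, hK, hσK, hτ⟩
    have l2 : ∀ ρ ∈ layers p T 1 σ, ∀ K' ∈ T.elems, ρ ∈ nodes p K' → ∀ τ ∈ nodes p K',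
        τ ∈ layers p T 2 σ := fun ρ hρ K' hK' hρ' τ hτ => ⟨ρ, hρ, K', hK', hρ', hτ⟩
    have f1 : ∀ τ ∈ nodes p K, ‖f τ - (a + B (τ - σ))‖ ≤ δ := fun τ hτ =>
      hf τ (l2 σ (l1 σ hσK) K hK hσK τ hτ)
    have g1 := norm_integral_shape_smul_sub_le rK.simplex (p := p) σ
      (continuous_sum_lam_pderiv rK.simplex p Λ f) (c := ∑ d, lam Λ d (B (unitDir d)))
      (η := C1 * (δ / h)) fun x hx => by
        refine (norm_sum_lam_sub_le Λ (fderiv ℝ (interp p K f) x) B).trans ?_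
        rw [hC1, mul_assoc, ← mul_div_assoc E]
        gcongr
        exact rK.norm_fderiv_interp_sub_le hp f1 hx
    have g2 : ‖∑ k ∈ Finset.Icc 1 p, ∑ e ∈ K.powersetCard D,
        (θ k * faceSize K e ^ (2 * k)) • jumpTerm p T k K e σ f‖ ≤
        (∫ x in hull K, shape p K σ x) * (C2 * (δ / h)) := by
      calc _ ≤ ∑ k ∈ Finset.Icc 1 p, ∑ e ∈ K.powersetCard D,
            |θ k| * (4 * E ^ 2 * C * δ * h ^ (D - 1)) := by
            refine norm_sum_le_of_le _ fun k hk => norm_sum_le_of_le _ fun e he => ?_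
            obtain ⟨heK, hecard⟩ := Finset.mem_powersetCard.1 he
            obtain ⟨v, hv⟩ : e.Nonempty := Finset.card_pos.1 (by omega)
            have j1 := norm_jumpTerm_le hp hC hC0 hreg hK he (Finset.mem_Icc.1 hk).2 σ hδ
              fun K' hK' he' τ hτ => hf τ (l2 v (l1 v (vertex_mem_nodes hp (heK hv))) K' hK'
                (vertex_mem_nodes hp (he' hv)) τ hτ)
            obtain ⟨s0, s1⟩ := faceSize_le rK heK
            rw [norm_smul, norm_mul, Real.norm_eq_abs, mul_assoc, norm_pow,
              Real.norm_of_nonneg s0]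
            refine mul_le_mul_of_nonneg_left ?_ (abs_nonneg _)
            calc _ ≤ h ^ (2 * k) * ((2 * E / h ^ k) * (2 * (E * δ) / h ^ k) *
                  (C * h ^ (D - 1))) :=
                  mul_le_mul (pow_le_pow_left₀ s0 s1 _) j1 (norm_nonneg _) (by positivity)
              _ = _ := by
                  have : h ^ (2 * k) = h ^ k * h ^ k := by rw [two_mul, pow_add]
                  rw [this]
                  field_simp
                  ring
        _ = C2 * (δ / h) * (massConst D p κ * h ^ D) := by
            simp only [Finset.sum_const, Finset.card_powersetCard, rK.card]
            rw [Nat.choose_symm_of_eq_add (show D + 1 = D + 1 from rfl), Nat.choose_one_right,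
              ← Finset.smul_sum, ← Finset.sum_mul, hC2]
            obtain ⟨d, rfl⟩ : ∃ d, D = d + 1 := ⟨D - 1, by omega⟩
            rw [Nat.add_sub_cancel, nsmul_eq_mul, pow_succ h d]
            push_cast
            field_simp
        _ ≤ _ := by
            rw [mul_comm]
            exact mul_le_mul_of_nonneg_right hmass (by positivity)
    unfold galerkinJump
    rw [add_sub_right_comm, add_mul, mul_add]
    exact (norm_add_le _ _).trans (add_le_add g1 g2)
  refine main.trans (mul_le_mul_of_nonneg_left ?_ (by positivity))
  linarith

end Galerkin

end

section

/-! ### The scheme in explicit form -/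

section ExplicitForm

variable {D q L S : ℕ}

/-- The normalized average `|C_σ|⁻¹ ∑_{K ∋ σ} ∫_K φ_σ ψ_K dx`. -/
def cellAvg {V : Type} [NormedAddCommGroup V] [NormedSpace ℝ V] (p : ℕ) (T : Mesh D) (σ : Pt D)
    (ψ : Finset (Pt D) → Pt D → V) : V :=
  (cellVol p T σ)⁻¹ • ∑ᶠ K ∈ elemsAt p T σ, ∫ x in hull K, shape p K σ x • ψ K x

/-- The normalized sum of the advection residuals. -/
def Scheme.adv (X : Scheme D q L S) (T : Mesh D) (σ : Pt D) (f : Pt D → Fin L → ℝ) : Fin L → ℝ :=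
  (cellVol X.p T σ)⁻¹ • ∑ᶠ K ∈ elemsAt X.p T σ, X.φ T K σ f

/-- The normalized relaxation source without the factor `1 / ε`. -/
def Scheme.source (X : Scheme D q L S) (T : Mesh D) (σ : Pt D) (f : Pt D → Fin L → ℝ) :
    Fin L → ℝ :=
  cellAvg X.p T σ fun K x => X.maxw (X.P *ᵥ interp X.p K f x) - interp X.p K f x

/-- Quadrature weights of the time interpolation, normalized by `Δt`. -/
def Scheme.weight (X : Scheme D q L S) (m j : Fin (S + 1)) : ℝ :=
  ∫ s in (0 : ℝ)..X.c m, (Lagrange.basis Finset.univ X.c j).eval s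

lemma eval_basis_scale (c : Fin (S + 1) → ℝ) {Δt : ℝ} (hΔ : Δt ≠ 0) (j : Fin (S + 1)) (s : ℝ) :
    (Lagrange.basis Finset.univ (fun m => c m * Δt) j).eval (s * Δt) =
      (Lagrange.basis Finset.univ c j).eval s := by
  simp only [Lagrange.basis, Lagrange.basisDivisor, Polynomial.eval_prod, Polynomial.eval_mul,
    Polynomial.eval_C, Polynomial.eval_sub, Polynomial.eval_X]
  refine Finset.prod_congr rfl fun i _ => ?_
  rw [← sub_mul, ← sub_mul, mul_inv]
  field_simp

/-- After time is scaled by `Δt` the quadrature weights depend on the nodes `c` alone, so they are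
bounded uniformly in the timestep. -/
lemma Scheme.integral_timeInterp (X : Scheme D q L S) {ι : Type} [Fintype ι] {Δt : ℝ} (hΔ : 0 < Δt)
    (m : Fin (S + 1)) (g : Fin (S + 1) → ι → ℝ) :
    ∫ s in (0 : ℝ)..X.dt Δt m, timeInterp (X.dt Δt) g s = Δt • ∑ j, X.weight m j • g j := by
  unfold timeInterp
  rw [intervalIntegral.integral_finsetSum]
  · rw [Finset.smul_sum]
    refine Finset.sum_congr rfl fun j _ => ?_
    rw [intervalIntegral.integral_smul_const, smul_smul]
    congr 1
    have h1 := intervalIntegral.smul_integral_comp_mul_right (a := 0) (b := X.c m)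
      (fun s => (Lagrange.basis Finset.univ (X.dt Δt) j).eval s) Δt
    rw [zero_mul] at h1
    change (∫ s in (0 : ℝ)..X.c m * Δt, _) = _
    rw [← h1, smul_eq_mul]
    congr 1
    exact intervalIntegral.integral_congr fun s _ => eval_basis_scale X.c hΔ.ne' j s
  · intro j _
    exact Continuous.intervalIntegrable
      ((Polynomial.continuous _).smul continuous_const) _ _

/-- The Lagrange basis sums to one. Exactness on constants is the only property of the time
quadrature on which the consistency of the corrections rests. -/
lemma Scheme.sum_weight (X : Scheme D q L S) (hc : StrictMono X.c) (m : Fin (S + 1)) :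
    ∑ j, X.weight m j = X.c m := by
  unfold Scheme.weight
  rw [← intervalIntegral.integral_finsetSum]
  · have : ∀ s : ℝ, ∑ j, (Lagrange.basis Finset.univ X.c j).eval s = 1 := by
      intro s
      rw [← Polynomial.eval_finsetSum,
        Lagrange.sum_basis hc.injective.injOn Finset.univ_nonempty, Polynomial.eval_one]
    simp_rw [this]
    simp
  · intro j _
    exact (Polynomial.continuous _).intervalIntegrable _ _

variable {p : ℕ} {T : Mesh D} {σ : Pt D}

lemma cellVol_smul_cellAvg {V : Type} [NormedAddCommGroup V] [NormedSpace ℝ V]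
    (hC : cellVol p T σ ≠ 0) (ψ : Finset (Pt D) → Pt D → V) :
    ∑ᶠ K ∈ elemsAt p T σ, (∫ x in hull K, shape p K σ x • ψ K x) =
      cellVol p T σ • cellAvg p T σ ψ := by
  rw [cellAvg, smul_smul, mul_inv_cancel₀ hC, one_smul]

lemma Scheme.cellVol_smul_adv (X : Scheme D q L S) (hC : cellVol X.p T σ ≠ 0)
    (f : Pt D → Fin L → ℝ) :
    ∑ᶠ K ∈ elemsAt X.p T σ, X.φ T K σ f = cellVol X.p T σ • X.adv T σ f := by
  rw [Scheme.adv, smul_smul, mul_inv_cancel₀ hC, one_smul]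

lemma Scheme.finsum_mulVec (X : Scheme D q L S) (hp : 1 ≤ X.p) (hC : cellVol X.p T σ ≠ 0)
    (f : Pt D → Fin L → ℝ) :
    ∑ᶠ K ∈ elemsAt X.p T σ, X.P *ᵥ X.φ T K σ f = cellVol X.p T σ • (X.P *ᵥ X.adv T σ f) := by
  rw [← Matrix.mulVec_smul, ← X.cellVol_smul_adv hC,
    finsum_mem_eq_finite_toFinset_sum _ (finite_elemsAt hp T σ),
    finsum_mem_eq_finite_toFinset_sum _ (finite_elemsAt hp T σ), Matrix.mulVec_sum]

lemma Scheme.L1u_eq (X : Scheme D q L S) (hp : 1 ≤ X.p) (hC : cellVol X.p T σ ≠ 0) (Δt : ℝ)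
    (m : Fin (S + 1)) (f0 : Pt D → Fin L → ℝ) (um : Pt D → Fin q → ℝ) :
    X.L1u T Δt m σ f0 um =
      cellVol X.p T σ • (um σ - X.P *ᵥ (f0 σ - X.dt Δt m • X.adv T σ f0)) := by
  rw [Scheme.L1u, X.finsum_mulVec hp hC, Matrix.mulVec_sub, Matrix.mulVec_smul]
  module

lemma Scheme.L1f_eq (X : Scheme D q L S) (hC : cellVol X.p T σ ≠ 0) {ε Δt : ℝ}
    (m : Fin (S + 1)) (f0 : Pt D → Fin L → ℝ) (um : Pt D → Fin q → ℝ)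
    (fm : Pt D → Fin L → ℝ) :
    X.L1f ε T Δt m σ f0 um fm = cellVol X.p T σ • ((1 + X.dt Δt m / ε) • fm σ -
      (f0 σ - X.dt Δt m • X.adv T σ f0) - (X.dt Δt m / ε) • X.maxw (um σ)) := by
  rw [Scheme.L1f, X.cellVol_smul_adv hC]
  module

lemma Scheme.L2u_eq (X : Scheme D q L S) (hp : 1 ≤ X.p) (hC : cellVol X.p T σ ≠ 0) {Δt : ℝ}
    (hΔ : 0 < Δt) (m : Fin (S + 1)) (u : Fin (S + 1) → Pt D → Fin q → ℝ)
    (f : Fin (S + 1) → Pt D → Fin L → ℝ) :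
    X.L2u T Δt m σ u f = cellVol X.p T σ • (
      cellAvg X.p T σ (fun K => interp X.p K (u m - u 0)) +
        Δt • ∑ j, X.weight m j • (X.P *ᵥ X.adv T σ (f j))) := by
  have hfin := finite_elemsAt hp T σ
  unfold Scheme.L2u
  rw [finsum_mem_add_distrib hfin, smul_add, ← cellVol_smul_cellAvg hC]
  congr 1
  · simp_rw [interp_sub]
  · simp_rw [X.integral_timeInterp hΔ]
    rw [finsum_mem_eq_finite_toFinset_sum _ hfin, ← Finset.smul_sum, Finset.sum_comm, smul_comm]
    congr 1
    rw [Finset.smul_sum]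
    refine Finset.sum_congr rfl fun j _ => ?_
    rw [← Finset.smul_sum, ← finsum_mem_eq_finite_toFinset_sum _ hfin, X.finsum_mulVec hp hC,
      smul_comm]

lemma Scheme.L2f_eq (X : Scheme D q L S) (hp : 1 ≤ X.p) (hC : cellVol X.p T σ ≠ 0) {ε Δt : ℝ}
    (hΔ : 0 < Δt) (m : Fin (S + 1)) (f : Fin (S + 1) → Pt D → Fin L → ℝ) :
    X.L2f ε T Δt m σ f = cellVol X.p T σ • (
      cellAvg X.p T σ (fun K => interp X.p K (f m - f 0)) +
        Δt • ∑ j, X.weight m j • (X.adv T σ (f j) - (1 / ε) • X.source T σ (f j))) := by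
  have hfin := finite_elemsAt hp T σ
  unfold Scheme.L2f
  rw [finsum_mem_add_distrib hfin, smul_add, ← cellVol_smul_cellAvg hC]
  congr 1
  · simp_rw [interp_sub]
  · simp_rw [X.integral_timeInterp hΔ]
    rw [finsum_mem_eq_finite_toFinset_sum _ hfin, ← Finset.smul_sum, Finset.sum_comm, smul_comm]
    congr 1
    rw [Finset.smul_sum]
    refine Finset.sum_congr rfl fun j _ => ?_
    rw [← Finset.smul_sum, smul_comm, smul_sub, ← X.cellVol_smul_adv hC, smul_comm _ (1 / ε),
      Scheme.source, ← cellVol_smul_cellAvg hC, finsum_mem_eq_finite_toFinset_sum _ hfin,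
      finsum_mem_eq_finite_toFinset_sum _ hfin, Finset.smul_sum (r := 1 / ε),
      ← Finset.sum_sub_distrib]
    congr 1
    refine Finset.sum_congr rfl fun K _ => ?_
    unfold Scheme.fullResidual
    rw [← integral_smul]
    simp_rw [smul_comm (1 / ε)]

/-- `ε / (ε + Δt^m)`. -/
def Scheme.relax (X : Scheme D q L S) (ε Δt : ℝ) (m : Fin (S + 1)) : ℝ := ε / (ε + X.dt Δt m)

lemma Scheme.L1u_eq_zero_iff (X : Scheme D q L S) (hp : 1 ≤ X.p) (hC : cellVol X.p T σ ≠ 0)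
    (Δt : ℝ) (m : Fin (S + 1)) (f0 : Pt D → Fin L → ℝ) (um : Pt D → Fin q → ℝ) :
    X.L1u T Δt m σ f0 um = 0 ↔ um σ = X.P *ᵥ (f0 σ - X.dt Δt m • X.adv T σ f0) := by
  rw [X.L1u_eq hp hC, smul_eq_zero_iff_right hC, sub_eq_zero]

/-- The Maxwellian is evaluated at `um`, not at `P fm`, so the implicit equation is linear in `fm
σ`. Its solution is a convex combination of an explicit transport step and the equilibrium. -/
lemma Scheme.L1f_eq_zero_iff (X : Scheme D q L S) (hC : cellVol X.p T σ ≠ 0) {ε Δt : ℝ}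
    (hε : 0 < ε) {m : Fin (S + 1)} (hm : 0 < X.dt Δt m) (f0 : Pt D → Fin L → ℝ)
    (um : Pt D → Fin q → ℝ) (fm : Pt D → Fin L → ℝ) :
    X.L1f ε T Δt m σ f0 um fm = 0 ↔ fm σ =
      X.relax ε Δt m • (f0 σ - X.dt Δt m • X.adv T σ f0) +
        (1 - X.relax ε Δt m) • X.maxw (um σ) := by
  have h0 : ε + X.dt Δt m ≠ 0 := by positivity
  have e : X.L1f ε T Δt m σ f0 um fm = (cellVol X.p T σ * (1 + X.dt Δt m / ε)) • (fm σ -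
      (X.relax ε Δt m • (f0 σ - X.dt Δt m • X.adv T σ f0) +
        (1 - X.relax ε Δt m) • X.maxw (um σ))) := by
    have e1 : (1 + X.dt Δt m / ε) * X.relax ε Δt m = 1 := by
      unfold Scheme.relax; field_simp
    have e2 : (1 + X.dt Δt m / ε) * (1 - X.relax ε Δt m) = X.dt Δt m / ε := by
      rw [mul_sub, e1]; ring
    rw [X.L1f_eq hC, mul_smul, smul_sub (1 + X.dt Δt m / ε), smul_add (1 + X.dt Δt m / ε),
      smul_smul (1 + X.dt Δt m / ε), smul_smul (1 + X.dt Δt m / ε), e1, e2, one_smul, sub_sub]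
  rw [e, smul_eq_zero_iff_right (by positivity), sub_eq_zero]

/-- Both iterations start from the same values, so the transport parts of the two operators `L1`
cancel and only the difference of the new and the old value is left. -/
lemma Scheme.correct_u_iff (X : Scheme D q L S) (hp : 1 ≤ X.p) (hC : cellVol X.p T σ ≠ 0) {Δt : ℝ}
    (hΔ : 0 < Δt) (m : Fin (S + 1)) {f0 g0 : Pt D → Fin L → ℝ} (h0 : g0 σ = f0 σ)
    (hadv : X.adv T σ g0 = X.adv T σ f0) (um' : Pt D → Fin q → ℝ)
    (u : Fin (S + 1) → Pt D → Fin q → ℝ) (f : Fin (S + 1) → Pt D → Fin L → ℝ) :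
    X.L1u T Δt m σ g0 um' - X.L1u T Δt m σ f0 (u m) + X.L2u T Δt m σ u f = 0 ↔
      um' σ = u m σ - (cellAvg X.p T σ (fun K => interp X.p K (u m - u 0)) +
        Δt • ∑ j, X.weight m j • (X.P *ᵥ X.adv T σ (f j))) := by
  rw [X.L1u_eq hp hC, X.L1u_eq hp hC, X.L2u_eq hp hC hΔ, h0, hadv, ← smul_sub, ← smul_add,
    smul_eq_zero_iff_right hC, sub_sub_sub_cancel_right, ← sub_eq_zero (b := _ - _)]
  refine Eq.congr_left ?_
  abel

/-- Division by the implicit factor `1 + Δt^m / ε` turns the stiff coefficient `Δt / ε` of the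
source into `Δt / (ε + Δt^m)`, which stays bounded as `ε → 0`. This is the origin of constants that
do not depend on `ε`. -/
lemma Scheme.correct_f_iff (X : Scheme D q L S) (hp : 1 ≤ X.p) (hC : cellVol X.p T σ ≠ 0)
    {ε Δt : ℝ} (hε : 0 < ε) (hΔ : 0 < Δt) {m : Fin (S + 1)} (hm : 0 < X.dt Δt m)
    {f0 g0 : Pt D → Fin L → ℝ} (h0 : g0 σ = f0 σ) (hadv : X.adv T σ g0 = X.adv T σ f0)
    (um um' : Pt D → Fin q → ℝ) (fm' : Pt D → Fin L → ℝ)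
    (f : Fin (S + 1) → Pt D → Fin L → ℝ) :
    X.L1f ε T Δt m σ g0 um' fm' - X.L1f ε T Δt m σ f0 um (f m) + X.L2f ε T Δt m σ f = 0 ↔
      fm' σ = f m σ + (1 - X.relax ε Δt m) • (X.maxw (um' σ) - X.maxw (um σ)) -
        X.relax ε Δt m • (cellAvg X.p T σ (fun K => interp X.p K (f m - f 0)) +
          Δt • ∑ j, X.weight m j • X.adv T σ (f j)) +
        (Δt / (ε + X.dt Δt m)) • ∑ j, X.weight m j • X.source T σ (f j) := by
  have h1 : ε + X.dt Δt m ≠ 0 := by positivity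
  have e1 : (1 + X.dt Δt m / ε) * X.relax ε Δt m = 1 := by
    unfold Scheme.relax; field_simp
  have e2 : (1 + X.dt Δt m / ε) * (1 - X.relax ε Δt m) = X.dt Δt m / ε := by
    rw [mul_sub, e1]; ring
  have e3 : (1 + X.dt Δt m / ε) * (Δt / (ε + X.dt Δt m)) = Δt * (1 / ε) := by field_simp
  have e : X.L1f ε T Δt m σ g0 um' fm' - X.L1f ε T Δt m σ f0 um (f m) + X.L2f ε T Δt m σ f =
      (cellVol X.p T σ * (1 + X.dt Δt m / ε)) • (fm' σ -
      (f m σ + (1 - X.relax ε Δt m) • (X.maxw (um' σ) - X.maxw (um σ)) -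
        X.relax ε Δt m • (cellAvg X.p T σ (fun K => interp X.p K (f m - f 0)) +
          Δt • ∑ j, X.weight m j • X.adv T σ (f j)) +
        (Δt / (ε + X.dt Δt m)) • ∑ j, X.weight m j • X.source T σ (f j))) := by
    rw [X.L1f_eq hC, X.L1f_eq hC, X.L2f_eq hp hC hΔ, h0, hadv, mul_smul, smul_sub
      (1 + X.dt Δt m / ε), smul_add (1 + X.dt Δt m / ε), smul_sub (1 + X.dt Δt m / ε),
      smul_add (1 + X.dt Δt m / ε), smul_smul (1 + X.dt Δt m / ε) (1 - X.relax ε Δt m),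
      smul_smul (1 + X.dt Δt m / ε) (X.relax ε Δt m),
      smul_smul (1 + X.dt Δt m / ε) (Δt / (ε + X.dt Δt m)), e1, e2, e3, one_smul]
    simp_rw [smul_sub (X.weight m _), Finset.sum_sub_distrib, smul_comm (X.weight m _) (1 / ε)]
    rw [← Finset.smul_sum]
    module
  rw [e, smul_eq_zero_iff_right (by positivity), sub_eq_zero]

/-- The prediction and the corrections of one timestep in explicit form, with start values
`us` and `fs`. -/
structure Scheme.IsStep (X : Scheme D q L S) (ε : ℝ) (T : Mesh D) (Δt : ℝ)
    (us : Pt D → Fin q → ℝ) (fs : Pt D → Fin L → ℝ) (u : ℕ → Fin (S + 1) → Pt D → Fin q → ℝ)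
    (f : ℕ → Fin (S + 1) → Pt D → Fin L → ℝ) : Prop where
  start_u : ∀ k, ∀ σ ∈ dofs X.p T, u k 0 σ = us σ
  start_f : ∀ k, ∀ σ ∈ dofs X.p T, f k 0 σ = fs σ
  predict_u : ∀ m ≠ 0, ∀ σ ∈ dofs X.p T,
    u 1 m σ = X.P *ᵥ (fs σ - X.dt Δt m • X.adv T σ fs)
  predict_f : ∀ m ≠ 0, ∀ σ ∈ dofs X.p T, f 1 m σ =
    X.relax ε Δt m • (fs σ - X.dt Δt m • X.adv T σ fs) +
      (1 - X.relax ε Δt m) • X.maxw (u 1 m σ)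
  correct_u : ∀ k, 1 ≤ k → k < X.iters → ∀ m ≠ 0, ∀ σ ∈ dofs X.p T, u (k + 1) m σ = u k m σ -
    (cellAvg X.p T σ (fun K => interp X.p K (u k m - u k 0)) +
      Δt • ∑ j, X.weight m j • (X.P *ᵥ X.adv T σ (f k j)))
  correct_f : ∀ k, 1 ≤ k → k < X.iters → ∀ m ≠ 0, ∀ σ ∈ dofs X.p T, f (k + 1) m σ = f k m σ +
    (1 - X.relax ε Δt m) • (X.maxw (u (k + 1) m σ) - X.maxw (u k m σ)) -
      X.relax ε Δt m • (cellAvg X.p T σ (fun K => interp X.p K (f k m - f k 0)) +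
        Δt • ∑ j, X.weight m j • X.adv T σ (f k j)) +
      (Δt / (ε + X.dt Δt m)) • ∑ j, X.weight m j • X.source T σ (f k j)

/-- The structural conditions on the data of the scheme. -/
structure Scheme.IsAdmissible (X : Scheme D q L S) (Λ : Fin D → Fin L → ℝ) (Ω : Set (Pt D))
    (κ : ℝ) : Prop where
  one_le_D : 1 ≤ D
  one_le_p : 1 ≤ X.p
  one_le_iters : 1 ≤ X.iters
  kappa_pos : 0 < κ
  strictMono_c : StrictMono X.c
  c_zero : X.c 0 = 0
  c_last : X.c (Fin.last S) = 1
  consistent : IsConsistentResidual X.p Λ Ω κ X.φ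
  lipschitz : ∃ lip, LipschitzWith lip X.maxw

namespace Scheme.IsAdmissible

variable {X : Scheme D q L S} {Λ : Fin D → Fin L → ℝ} {Ω : Set (Pt D)} {κ h Δt ε : ℝ}

lemma c_pos (hX : X.IsAdmissible Λ Ω κ) {m : Fin (S + 1)} (hm : m ≠ 0) : 0 < X.c m := by
  rw [← hX.c_zero]
  exact hX.strictMono_c (Fin.pos_iff_ne_zero.2 hm)

lemma c_le_one (hX : X.IsAdmissible Λ Ω κ) (m : Fin (S + 1)) : X.c m ≤ 1 := by
  rw [← hX.c_last]
  exact hX.strictMono_c.monotone (Fin.le_last m)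

lemma c_nonneg (hX : X.IsAdmissible Λ Ω κ) (m : Fin (S + 1)) : 0 ≤ X.c m := by
  rw [← hX.c_zero]
  exact hX.strictMono_c.monotone (Fin.zero_le m)

lemma dt_pos (hX : X.IsAdmissible Λ Ω κ) (hΔ : 0 < Δt) {m : Fin (S + 1)} (hm : m ≠ 0) :
    0 < X.dt Δt m := mul_pos (hX.c_pos hm) hΔ

lemma cellVol_pos (hX : X.IsAdmissible Λ Ω κ) (hT : T.IsRegular Ω κ h)
    (hσ : σ ∈ dofs X.p T) : 0 < cellVol X.p T σ :=
  IMEXRD.cellVol_pos hX.one_le_D hX.one_le_p hX.kappa_pos hT hσ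

lemma adv_congr (hX : X.IsAdmissible Λ Ω κ) {f g : Pt D → Fin L → ℝ}
    (hfg : ∀ τ ∈ dofs X.p T, f τ = g τ) (σ : Pt D) : X.adv T σ f = X.adv T σ g := by
  unfold Scheme.adv
  congr 1
  exact finsum_mem_congr rfl fun K hK => (hX.consistent.1 T K hK.1 σ hK.2).2 f g hfg

lemma continuous_adv (hX : X.IsAdmissible Λ Ω κ) (σ : Pt D) : Continuous (X.adv T σ) := by
  have e : X.adv T σ = fun f => (cellVol X.p T σ)⁻¹ •
      ∑ K ∈ (finite_elemsAt hX.one_le_p T σ).toFinset, X.φ T K σ f := by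
    funext f
    unfold Scheme.adv
    rw [finsum_mem_eq_finite_toFinset_sum]
  rw [e]
  have : Continuous fun f =>
      ∑ K ∈ (finite_elemsAt hX.one_le_p T σ).toFinset, X.φ T K σ f := by
    refine continuous_finsetSum _ fun K hK => ?_
    obtain ⟨h1, h2⟩ := (finite_elemsAt hX.one_le_p T σ).mem_toFinset.1 hK
    exact (hX.consistent.1 T K h1 σ h2).1
  exact this.const_smul (cellVol X.p T σ)⁻¹

/-- A run of the scheme consists of timesteps in explicit form. -/
lemma isStep_of_isRun (hX : X.IsAdmissible Λ Ω κ) (hT : T.IsRegular Ω κ h) (hΔ : 0 < Δt)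
    (hε : 0 < ε) {U0 : Pt D → Fin q → ℝ} {u : History D q S} {f : History D L S}
    (hr : X.IsRun ε T Δt U0 u f) (n : ℕ) :
    X.IsStep ε T Δt (u n 1 0) (f n 1 0) (u n) (f n) := by
  have su : ∀ k, ∀ σ ∈ dofs X.p T, u n k 0 σ = u n 1 0 σ := by
    intro k σ hσ
    rcases n with _ | n
    · rw [hr.init_u k σ hσ, hr.init_u 1 σ hσ]
    · rw [hr.next_u n k σ hσ, hr.next_u n 1 σ hσ]
  have sf : ∀ k, ∀ σ ∈ dofs X.p T, f n k 0 σ = f n 1 0 σ := by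
    intro k σ hσ
    rcases n with _ | n
    · rw [hr.init_f k σ hσ, hr.init_f 1 σ hσ]
    · rw [hr.next_f n k σ hσ, hr.next_f n 1 σ hσ]
  have sff : ∀ k, ∀ σ ∈ dofs X.p T, f n (k + 1) 0 σ = f n k 0 σ := fun k σ hσ => by
    rw [sf (k + 1) σ hσ, sf k σ hσ]
  have hp := hX.one_le_p
  refine ⟨su, sf, fun m hm σ hσ => ?_, fun m hm σ hσ => ?_, fun k h1 h2 m hm σ hσ => ?_,
    fun k h1 h2 m hm σ hσ => ?_⟩
  · exact (X.L1u_eq_zero_iff hp (hX.cellVol_pos hT hσ).ne' Δt m _ _).1 (hr.predict_u n m hm σ hσ)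
  · exact (X.L1f_eq_zero_iff (hX.cellVol_pos hT hσ).ne' hε (hX.dt_pos hΔ hm) _ _ _).1
      (hr.predict_f n m hm σ hσ)
  · exact (X.correct_u_iff hp (hX.cellVol_pos hT hσ).ne' hΔ m (sff k σ hσ)
      (hX.adv_congr (sff k) σ) _ _ _).1 (hr.correct_u n k h1 h2 m hm σ hσ)
  · exact (X.correct_f_iff hp (hX.cellVol_pos hT hσ).ne' hε hΔ (hX.dt_pos hΔ hm) (sff k σ hσ)
      (hX.adv_congr (sff k) σ) _ _ _ _).1 (hr.correct_f n k h1 h2 m hm σ hσ)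

lemma exists_isStep (X : Scheme D q L S) (ε : ℝ) (T : Mesh D) (Δt : ℝ)
    (us : Pt D → Fin q → ℝ) (fs : Pt D → Fin L → ℝ) : ∃ u f, X.IsStep ε T Δt us fs u f := by
  classical
  let predU : Fin (S + 1) → Pt D → Fin q → ℝ := fun m σ =>
    if m = 0 then us σ else X.P *ᵥ (fs σ - X.dt Δt m • X.adv T σ fs)
  let predF : Fin (S + 1) → Pt D → Fin L → ℝ := fun m σ =>
    if m = 0 then fs σ else X.relax ε Δt m • (fs σ - X.dt Δt m • X.adv T σ fs) +
      (1 - X.relax ε Δt m) • X.maxw (predU m σ)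
  let corrU : (Fin (S + 1) → Pt D → Fin q → ℝ) → (Fin (S + 1) → Pt D → Fin L → ℝ) →
      Fin (S + 1) → Pt D → Fin q → ℝ := fun u f m σ =>
    if m = 0 then us σ else u m σ - (cellAvg X.p T σ (fun K => interp X.p K (u m - u 0)) +
      Δt • ∑ j, X.weight m j • (X.P *ᵥ X.adv T σ (f j)))
  let corrF : (Fin (S + 1) → Pt D → Fin q → ℝ) → (Fin (S + 1) → Pt D → Fin L → ℝ) →
      Fin (S + 1) → Pt D → Fin L → ℝ := fun u f m σ =>
    if m = 0 then fs σ else f m σ +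
      (1 - X.relax ε Δt m) • (X.maxw (corrU u f m σ) - X.maxw (u m σ)) -
      X.relax ε Δt m • (cellAvg X.p T σ (fun K => interp X.p K (f m - f 0)) +
        Δt • ∑ j, X.weight m j • X.adv T σ (f j)) +
      (Δt / (ε + X.dt Δt m)) • ∑ j, X.weight m j • X.source T σ (f j)
  -- By truncated subtraction `st 0` is the prediction as well; iteration `0` is constrained only at
  -- sub-timestep `0`, so this default is harmless.
  let st : ℕ → (Fin (S + 1) → Pt D → Fin q → ℝ) × (Fin (S + 1) → Pt D → Fin L → ℝ) := fun k =>
    Nat.rec (predU, predF) (fun _ w => (corrU w.1 w.2, corrF w.1 w.2)) (k - 1)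
  have st1 : st 1 = (predU, predF) := rfl
  have stk : ∀ k, 1 ≤ k →
      st (k + 1) = (corrU (st k).1 (st k).2, corrF (st k).1 (st k).2) := by
    intro k hk
    obtain ⟨k, rfl⟩ : ∃ l, k = l + 1 := ⟨k - 1, by omega⟩
    rfl
  have st0 : ∀ k σ, (st k).1 0 σ = us σ ∧ (st k).2 0 σ = fs σ := by
    intro k σ
    have e1 : predU 0 σ = us σ := if_pos rfl
    have e2 : predF 0 σ = fs σ := if_pos rfl
    have e3 : ∀ u f, corrU u f 0 σ = us σ := fun u f => if_pos rfl
    have e4 : ∀ u f, corrF u f 0 σ = fs σ := fun u f => if_pos rfl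
    rcases k with _ | _ | k
    · exact ⟨e1, e2⟩
    · exact ⟨e1, e2⟩
    · rw [stk (k + 1) (by omega)]
      exact ⟨e3 (st (k + 1)).1 (st (k + 1)).2, e4 (st (k + 1)).1 (st (k + 1)).2⟩
  refine ⟨fun k => (st k).1, fun k => (st k).2, fun k σ _ => (st0 k σ).1, fun k σ _ => (st0 k σ).2,
    fun m hm σ _ => if_neg hm, fun m hm σ _ => if_neg hm, fun k h1 _ m hm σ _ => ?_,
    fun k h1 _ m hm σ _ => ?_⟩
  · rw [stk k h1]
    exact if_neg hm
  · rw [stk k h1]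
    exact if_neg hm

/-- The scheme is well defined. -/
lemma exists_isRun (hX : X.IsAdmissible Λ Ω κ) (hT : T.IsRegular Ω κ h) (hΔ : 0 < Δt)
    (hε : 0 < ε) (U0 : Pt D → Fin q → ℝ) : ∃ u f, X.IsRun ε T Δt U0 u f := by
  choose stepU stepF hstep using exists_isStep X ε T Δt
  let st : ℕ → (Pt D → Fin q → ℝ) × (Pt D → Fin L → ℝ) := fun n =>
    Nat.rec (U0, fun σ => X.maxw (U0 σ)) (fun _ w =>
      (stepU w.1 w.2 X.iters (Fin.last S), stepF w.1 w.2 X.iters (Fin.last S))) n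
  have hp := hX.one_le_p
  have hs := fun n => hstep (st n).1 (st n).2
  have a0 : ∀ n k, ∀ τ ∈ dofs X.p T, stepF (st n).1 (st n).2 k 0 τ = (st n).2 τ := fun n k τ hτ =>
    (hs n).start_f k τ hτ
  have sff : ∀ n k, ∀ τ ∈ dofs X.p T, stepF (st n).1 (st n).2 (k + 1) 0 τ =
      stepF (st n).1 (st n).2 k 0 τ := fun n k τ hτ => by rw [a0 n _ τ hτ, a0 n _ τ hτ]
  refine ⟨fun n => stepU (st n).1 (st n).2, fun n => stepF (st n).1 (st n).2, ?_⟩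
  refine ⟨fun k σ hσ => (hs 0).start_u k σ hσ, fun k σ hσ => (hs 0).start_f k σ hσ,
    fun n k σ hσ => (hs (n + 1)).start_u k σ hσ, fun n k σ hσ => (hs (n + 1)).start_f k σ hσ,
    fun n m hm σ hσ => ?_, fun n m hm σ hσ => ?_, fun n k h1 h2 m hm σ hσ => ?_,
    fun n k h1 h2 m hm σ hσ => ?_⟩
  · rw [X.L1u_eq_zero_iff hp (hX.cellVol_pos hT hσ).ne', (hs n).predict_u m hm σ hσ,
      hX.adv_congr (a0 n 1) σ, a0 n 1 σ hσ]
  · rw [X.L1f_eq_zero_iff (hX.cellVol_pos hT hσ).ne' hε (hX.dt_pos hΔ hm),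
      (hs n).predict_f m hm σ hσ, hX.adv_congr (a0 n 1) σ, a0 n 1 σ hσ]
  · exact (X.correct_u_iff hp (hX.cellVol_pos hT hσ).ne' hΔ m (sff n k σ hσ)
      (hX.adv_congr (sff n k) σ) _ _ _).2 ((hs n).correct_u k h1 h2 m hm σ hσ)
  · exact (X.correct_f_iff hp (hX.cellVol_pos hT hσ).ne' hε hΔ (hX.dt_pos hΔ hm) (sff n k σ hσ)
      (hX.adv_congr (sff n k) σ) _ _ _ _).2 ((hs n).correct_f k h1 h2 m hm σ hσ)

end Scheme.IsAdmissible

end ExplicitForm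

end

section

/-! ### Convergence of the scheme for `ε → 0` -/

section Limit

variable {D q L S : ℕ} {p : ℕ} {T : Mesh D} {σ : Pt D}

/-- Integrals of `φ_σ G(f_h)` are continuous functions of the coefficients. -/
lemma continuous_integral_shape_smul {ι : Type} [Fintype ι] {V : Type} [NormedAddCommGroup V]
    [NormedSpace ℝ V] {K : Finset (Pt D)} (hK : IsSimplex K) (p : ℕ)
    (σ : Pt D) {G : (ι → ℝ) → V} (hG : Continuous G) :
    Continuous fun f : Pt D → ι → ℝ => ∫ x in hull K, shape p K σ x • G (interp p K f x) := by
  classical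
  -- The integral sees only the finitely many coefficients at the nodes of `K`. Restriction to them
  -- gives a finite-dimensional parameter space, where joint continuity of the integrand and
  -- compactness of the element give continuity of the integral.
  let ext : ({τ // τ ∈ nodes p K} → ι → ℝ) → Pt D → ι → ℝ := fun c τ =>
    if h : τ ∈ nodes p K then c ⟨τ, h⟩ else 0
  have hext : ∀ τ, Continuous fun c => ext c τ := by
    intro τ
    by_cases h : τ ∈ nodes p K
    · simp only [ext, h, dite_true]
      exact continuous_apply _
    · simp only [ext, h, dite_false]
      exact continuous_const
  have hres : ∀ f : Pt D → ι → ℝ, interp p K f = interp p K (ext fun τ => f τ) := fun f =>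
    interp_congr fun τ hτ => by simp [ext, hτ]
  have hjoint : Continuous fun y : ({τ // τ ∈ nodes p K} → ι → ℝ) × Pt D =>
      shape p K σ y.2 • G (interp p K (ext y.1) y.2) := by
    have cs := fun τ => (continuous_shape hK p τ).comp
      (continuous_snd (X := {τ // τ ∈ nodes p K} → ι → ℝ) (Y := Pt D))
    refine (cs σ).smul (hG.comp ?_)
    unfold interp
    exact continuous_finsetSum _ fun τ _ => (cs τ).smul ((hext τ).comp continuous_fst)
  have h1 := continuous_parametric_integral_of_continuous (μ := volume)
    (f := fun c x => shape p K σ x • G (interp p K (ext c) x)) hjoint (isCompact_hull K)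
  have h2 : Continuous fun (f : Pt D → ι → ℝ) (τ : {τ // τ ∈ nodes p K}) => f τ :=
    continuous_pi fun τ => continuous_apply _
  refine (h1.comp h2).congr fun f => ?_
  simp only [Function.comp_apply]
  rw [hres f]

lemma continuous_cellAvg {ι : Type} [Fintype ι] {V : Type} [NormedAddCommGroup V]
    [NormedSpace ℝ V] (hp : 1 ≤ p) (T : Mesh D) (σ : Pt D)
    {G : (ι → ℝ) → V} (hG : Continuous G) :
    Continuous fun f : Pt D → ι → ℝ => cellAvg p T σ fun K x => G (interp p K f x) := by
  have e : (fun f : Pt D → ι → ℝ => cellAvg p T σ fun K x => G (interp p K f x)) =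
      fun f => (cellVol p T σ)⁻¹ • ∑ K ∈ (finite_elemsAt hp T σ).toFinset,
        ∫ x in hull K, shape p K σ x • G (interp p K f x) := by
    funext f
    unfold cellAvg
    rw [finsum_mem_eq_finite_toFinset_sum]
  rw [e]
  have : Continuous fun f : Pt D → ι → ℝ => ∑ K ∈ (finite_elemsAt hp T σ).toFinset,
        ∫ x in hull K, shape p K σ x • G (interp p K f x) := by
    refine continuous_finsetSum _ fun K hK => ?_
    have hK' := (finite_elemsAt hp T σ).mem_toFinset.1 hK
    exact continuous_integral_shape_smul (isSimplex_of_mem_elems hK'.1) p σ hG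
  exact this.const_smul (cellVol p T σ)⁻¹

lemma cellAvg_congr {ι : Type} {V : Type} [NormedAddCommGroup V]
    [NormedSpace ℝ V] (T : Mesh D) (σ : Pt D) (G : (ι → ℝ) → V) {f g : Pt D → ι → ℝ}
    (h : ∀ τ ∈ dofs p T, f τ = g τ) :
    cellAvg p T σ (fun K x => G (interp p K f x)) =
      cellAvg p T σ fun K x => G (interp p K g x) := by
  unfold cellAvg
  congr 1
  refine finsum_mem_congr rfl fun K hK => ?_
  simp only [interp_congr fun τ hτ => h τ (nodes_subset_dofs hK.1 τ hτ)]

/-- The coefficients `g ε` converge at all degrees of freedom for `ε → 0+`. -/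
def NodalConv {V : Type} [TopologicalSpace V] (p : ℕ) (T : Mesh D) (g : ℝ → Pt D → V) : Prop :=
  ∀ σ ∈ dofs p T, ∃ l, Tendsto (fun ε => g ε σ) (𝓝[>] 0) (𝓝 l)

/-- Coefficients outside the degrees of freedom need not converge. Since `Φ` ignores them they may
be set to `0`, which gives convergence in the full product topology. -/
lemma NodalConv.map {V W : Type} [TopologicalSpace V] [Zero V] [TopologicalSpace W]
    {g : ℝ → Pt D → V} (hg : NodalConv p T g) {Φ : (Pt D → V) → W} (hΦ : Continuous Φ)
    (hcongr : ∀ f f' : Pt D → V, (∀ τ ∈ dofs p T, f τ = f' τ) → Φ f = Φ f') :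
    ∃ l, Tendsto (fun ε => Φ (g ε)) (𝓝[>] 0) (𝓝 l) := by
  classical
  choose! l hl using hg
  let g' : ℝ → Pt D → V := fun ε τ => if τ ∈ dofs p T then g ε τ else 0
  have h1 : Tendsto g' (𝓝[>] 0) (𝓝 fun τ => if τ ∈ dofs p T then l τ else 0) := by
    rw [tendsto_pi_nhds]
    intro τ
    by_cases h : τ ∈ dofs p T
    · simpa only [g', h, if_true] using hl τ h
    · simpa only [g', h, if_false] using tendsto_const_nhds
  refine ⟨_, ((hΦ.tendsto _).comp h1).congr fun ε => hcongr _ _ fun τ hτ => ?_⟩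
  simp only [g', hτ, if_true]

lemma tendsto_sum_smul {V : Type} [NormedAddCommGroup V] [NormedSpace ℝ V]
    {g : ℝ → Fin (S + 1) → V} (w : Fin (S + 1) → ℝ)
    (hg : ∀ j, ∃ l, Tendsto (fun ε => g ε j) (𝓝[>] 0) (𝓝 l)) :
    ∃ l, Tendsto (fun ε => ∑ j, w j • g ε j) (𝓝[>] 0) (𝓝 l) := by
  choose l hl using hg
  exact ⟨∑ j, w j • l j, tendsto_finsetSum _ fun j _ => (hl j).const_smul (w j)⟩

namespace Scheme.IsAdmissible

variable {X : Scheme D q L S} {Λ : Fin D → Fin L → ℝ} {Ω : Set (Pt D)} {κ h Δt : ℝ}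

lemma continuous_maxw (hX : X.IsAdmissible Λ Ω κ) : Continuous X.maxw :=
  hX.lipschitz.choose_spec.continuous

lemma tendsto_adv (hX : X.IsAdmissible Λ Ω κ) {g : ℝ → Pt D → Fin L → ℝ}
    (hg : NodalConv X.p T g) (σ : Pt D) :
    ∃ l, Tendsto (fun ε => X.adv T σ (g ε)) (𝓝[>] 0) (𝓝 l) :=
  hg.map (hX.continuous_adv σ) fun _ _ h => hX.adv_congr h σ

lemma tendsto_source (hX : X.IsAdmissible Λ Ω κ) {g : ℝ → Pt D → Fin L → ℝ}
    (hg : NodalConv X.p T g) (σ : Pt D) :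
    ∃ l, Tendsto (fun ε => X.source T σ (g ε)) (𝓝[>] 0) (𝓝 l) := by
  have hP : Continuous fun v : Fin L → ℝ => X.P *ᵥ v :=
    Continuous.matrix_mulVec continuous_const continuous_id
  exact hg.map (Φ := X.source T σ)
    (continuous_cellAvg hX.one_le_p T σ (G := fun v => X.maxw (X.P *ᵥ v) - v)
      ((hX.continuous_maxw.comp hP).sub continuous_id))
    fun _ _ h => cellAvg_congr T σ (fun v => X.maxw (X.P *ᵥ v) - v) h

lemma tendsto_cellAvg_sub (hX : X.IsAdmissible Λ Ω κ) {ι : Type} [Fintype ι]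
    {g g' : ℝ → Pt D → ι → ℝ} (hg : NodalConv X.p T g) (hg' : NodalConv X.p T g') (σ : Pt D) :
    ∃ l, Tendsto (fun ε => cellAvg X.p T σ fun K => interp X.p K (g ε - g' ε))
      (𝓝[>] 0) (𝓝 l) := by
  have h : NodalConv X.p T fun ε => g ε - g' ε := fun σ hσ => by
    obtain ⟨l, hl⟩ := hg σ hσ
    obtain ⟨l', hl'⟩ := hg' σ hσ
    exact ⟨l - l', hl.sub hl'⟩
  exact h.map (continuous_cellAvg hX.one_le_p T σ continuous_id)
    fun _ _ h => cellAvg_congr T σ id h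

lemma tendsto_relax (hX : X.IsAdmissible Λ Ω κ) (hΔ : 0 < Δt) {m : Fin (S + 1)} (hm : m ≠ 0) :
    Tendsto (fun ε => X.relax ε Δt m) (𝓝[>] 0) (𝓝 0) := by
  have h1 := hX.dt_pos hΔ hm
  have : ContinuousAt (fun ε : ℝ => X.relax ε Δt m) 0 := by
    unfold Scheme.relax
    exact continuousAt_id.div (continuousAt_id.add continuousAt_const) (by simpa using h1.ne')
  have h2 : X.relax 0 Δt m = 0 := by simp [Scheme.relax]
  have h3 := this.tendsto.mono_left (nhdsWithin_le_nhds (s := Ioi 0))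
  rwa [h2] at h3

/-- One timestep converges if its start values do. -/
lemma tendsto_step (hX : X.IsAdmissible Λ Ω κ) (hΔ : 0 < Δt)
    {us : ℝ → Pt D → Fin q → ℝ} {fs : ℝ → Pt D → Fin L → ℝ}
    {u : ℝ → ℕ → Fin (S + 1) → Pt D → Fin q → ℝ} {f : ℝ → ℕ → Fin (S + 1) → Pt D → Fin L → ℝ}
    (hstep : ∀ ε > 0, X.IsStep ε T Δt (us ε) (fs ε) (u ε) (f ε))
    (hus : NodalConv X.p T us) (hfs : NodalConv X.p T fs) (k : ℕ) (h1 : 1 ≤ k)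
    (h2 : k ≤ X.iters) :
    ∀ m, NodalConv X.p T (fun ε => u ε k m) ∧ NodalConv X.p T (fun ε => f ε k m) := by
  have hpos : ∀ᶠ ε : ℝ in 𝓝[>] 0, 0 < ε := eventually_mem_nhdsWithin
  have hP : Continuous fun v : Fin L → ℝ => X.P *ᵥ v :=
    Continuous.matrix_mulVec continuous_const continuous_id
  have start : ∀ k, NodalConv X.p T (fun ε => u ε k 0) ∧ NodalConv X.p T (fun ε => f ε k 0) := by
    intro k
    refine ⟨fun σ hσ => ?_, fun σ hσ => ?_⟩
    · obtain ⟨l, hl⟩ := hus σ hσ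
      exact ⟨l, hl.congr' (hpos.mono fun ε hε => ((hstep ε hε).start_u k σ hσ).symm)⟩
    · obtain ⟨l, hl⟩ := hfs σ hσ
      exact ⟨l, hl.congr' (hpos.mono fun ε hε => ((hstep ε hε).start_f k σ hσ).symm)⟩
  induction k, h1 using Nat.le_induction with
  | base =>
    intro m
    rcases eq_or_ne m 0 with rfl | hm
    · exact start 1
    have e1 : ∀ σ ∈ dofs X.p T, ∃ l,
        Tendsto (fun ε => fs ε σ - X.dt Δt m • X.adv T σ (fs ε)) (𝓝[>] 0) (𝓝 l) := by
      intro σ hσ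
      obtain ⟨l, hl⟩ := hfs σ hσ
      obtain ⟨l', hl'⟩ := hX.tendsto_adv hfs σ
      exact ⟨_, hl.sub (hl'.const_smul (X.dt Δt m))⟩
    have hu : NodalConv X.p T (fun ε => u ε 1 m) := by
      intro σ hσ
      obtain ⟨l, hl⟩ := e1 σ hσ
      exact ⟨_, ((hP.tendsto l).comp hl).congr'
        (hpos.mono fun ε hε => ((hstep ε hε).predict_u m hm σ hσ).symm)⟩
    refine ⟨hu, fun σ hσ => ?_⟩
    obtain ⟨l, hl⟩ := e1 σ hσ
    obtain ⟨l', hl'⟩ := hu σ hσ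
    have hr := hX.tendsto_relax hΔ hm
    exact ⟨_, ((hr.smul hl).add ((hr.const_sub 1).smul
      ((hX.continuous_maxw.tendsto l').comp hl'))).congr'
        (hpos.mono fun ε hε => ((hstep ε hε).predict_f m hm σ hσ).symm)⟩
  | succ k h1 ih =>
    have ih := ih (by omega)
    have hk : k < X.iters := by omega
    intro m
    rcases eq_or_ne m 0 with rfl | hm
    · exact start (k + 1)
    have hadv : ∀ σ j, ∃ l, Tendsto (fun ε => X.adv T σ (f ε k j)) (𝓝[>] 0) (𝓝 l) := fun σ j =>
      hX.tendsto_adv (ih j).2 σ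
    have hu : NodalConv X.p T (fun ε => u ε (k + 1) m) := by
      intro σ hσ
      obtain ⟨l1, hl1⟩ := (ih m).1 σ hσ
      obtain ⟨l2, hl2⟩ := hX.tendsto_cellAvg_sub (ih m).1 (ih 0).1 σ
      obtain ⟨l3, hl3⟩ := tendsto_sum_smul (X.weight m)
        (g := fun ε j => X.P *ᵥ X.adv T σ (f ε k j)) fun j => by
          obtain ⟨l, hl⟩ := hadv σ j
          exact ⟨_, (hP.tendsto l).comp hl⟩
      exact ⟨_, (hl1.sub (hl2.add (hl3.const_smul Δt))).congr'
        (hpos.mono fun ε hε => ((hstep ε hε).correct_u k h1 hk m hm σ hσ).symm)⟩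
    refine ⟨hu, fun σ hσ => ?_⟩
    have hr := hX.tendsto_relax hΔ hm
    obtain ⟨l1, hl1⟩ := (ih m).2 σ hσ
    obtain ⟨l2, hl2⟩ := hu σ hσ
    obtain ⟨l3, hl3⟩ := (ih m).1 σ hσ
    obtain ⟨l4, hl4⟩ := hX.tendsto_cellAvg_sub (ih m).2 (ih 0).2 σ
    obtain ⟨l5, hl5⟩ := tendsto_sum_smul (X.weight m)
      (g := fun ε j => X.adv T σ (f ε k j)) (hadv σ)
    obtain ⟨l6, hl6⟩ := tendsto_sum_smul (X.weight m)
      (g := fun ε j => X.source T σ (f ε k j)) fun j => hX.tendsto_source (ih j).2 σ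
    -- The only coefficient inherited from `1 / ε`; its limit `1 / c_m` is finite because `m ≠ 0`.
    have h7 : Tendsto (fun ε => Δt / (ε + X.dt Δt m)) (𝓝[>] 0) (𝓝 (Δt / (0 + X.dt Δt m))) := by
      have h8 := hX.dt_pos hΔ hm
      have : ContinuousAt (fun ε : ℝ => Δt / (ε + X.dt Δt m)) 0 :=
        continuousAt_const.div (continuousAt_id.add continuousAt_const) (by simpa using h8.ne')
      exact this.tendsto.mono_left nhdsWithin_le_nhds
    exact ⟨_, (((hl1.add ((hr.const_sub 1).smul
      (((hX.continuous_maxw.tendsto l2).comp hl2).sub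
        ((hX.continuous_maxw.tendsto l3).comp hl3)))).sub
      (hr.smul (hl4.add (hl5.const_smul Δt)))).add (h7.smul hl6)).congr'
        (hpos.mono fun ε hε => ((hstep ε hε).correct_f k h1 hk m hm σ hσ).symm)⟩

/-- The scheme converges for `ε → 0+`, at fixed mesh and timestep. -/
lemma exists_limit (hX : X.IsAdmissible Λ Ω κ) (hT : T.IsRegular Ω κ h) (hΔ : 0 < Δt)
    {U0 : Pt D → Fin q → ℝ} {u : ℝ → History D q S} {f : ℝ → History D L S}
    (hr : ∀ ε > 0, X.IsRun ε T Δt U0 (u ε) (f ε)) :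
    ∃ (u' : History D q S) (f' : History D L S), ∀ n k, 1 ≤ k → k ≤ X.iters →
      ∀ m, ∀ σ ∈ dofs X.p T,
        Tendsto (fun ε => u ε n k m σ) (𝓝[>] 0) (𝓝 (u' n k m σ)) ∧
        Tendsto (fun ε => f ε n k m σ) (𝓝[>] 0) (𝓝 (f' n k m σ)) := by
  have hpos : ∀ᶠ ε : ℝ in 𝓝[>] 0, 0 < ε := eventually_mem_nhdsWithin
  have step : ∀ n, NodalConv X.p T (fun ε => u ε n 1 0) →
      NodalConv X.p T (fun ε => f ε n 1 0) → ∀ k, 1 ≤ k → k ≤ X.iters →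
      ∀ m, NodalConv X.p T (fun ε => u ε n k m) ∧ NodalConv X.p T (fun ε => f ε n k m) :=
    fun n h1 h2 k hk hk' => hX.tendsto_step hΔ
      (fun ε hε => hX.isStep_of_isRun hT hΔ hε (hr ε hε) n) h1 h2 k hk hk'
  have start : ∀ n, NodalConv X.p T (fun ε => u ε n 1 0) ∧
      NodalConv X.p T (fun ε => f ε n 1 0) := by
    intro n
    induction n with
    | zero =>
      exact ⟨fun σ hσ => ⟨U0 σ, tendsto_const_nhds.congr'
          (hpos.mono fun ε hε => ((hr ε hε).init_u 1 σ hσ).symm)⟩,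
        fun σ hσ => ⟨X.maxw (U0 σ), tendsto_const_nhds.congr'
          (hpos.mono fun ε hε => ((hr ε hε).init_f 1 σ hσ).symm)⟩⟩
    | succ n ih =>
      have h1 := step n ih.1 ih.2 X.iters hX.one_le_iters le_rfl (Fin.last S)
      refine ⟨fun σ hσ => ?_, fun σ hσ => ?_⟩
      · obtain ⟨l, hl⟩ := h1.1 σ hσ
        exact ⟨l, hl.congr' (hpos.mono fun ε hε => ((hr ε hε).next_u n 1 σ hσ).symm)⟩
      · obtain ⟨l, hl⟩ := h1.2 σ hσ
        exact ⟨l, hl.congr' (hpos.mono fun ε hε => ((hr ε hε).next_f n 1 σ hσ).symm)⟩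
  have all := fun n => step n (start n).1 (start n).2
  -- The conditions are placed under the existential so that `choose` yields a total history; the
  -- value at irrelevant indices is `0`.
  have hu : ∀ n k m σ, ∃ l, 1 ≤ k → k ≤ X.iters → σ ∈ dofs X.p T →
      Tendsto (fun ε => u ε n k m σ) (𝓝[>] 0) (𝓝 l) := by
    intro n k m σ
    by_cases h : 1 ≤ k ∧ k ≤ X.iters ∧ σ ∈ dofs X.p T
    · obtain ⟨l, hl⟩ := (all n k h.1 h.2.1 m).1 σ h.2.2
      exact ⟨l, fun _ _ _ => hl⟩
    · exact ⟨0, fun h1 h2 h3 => absurd ⟨h1, h2, h3⟩ h⟩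
  have hf : ∀ n k m σ, ∃ l, 1 ≤ k → k ≤ X.iters → σ ∈ dofs X.p T →
      Tendsto (fun ε => f ε n k m σ) (𝓝[>] 0) (𝓝 l) := by
    intro n k m σ
    by_cases h : 1 ≤ k ∧ k ≤ X.iters ∧ σ ∈ dofs X.p T
    · obtain ⟨l, hl⟩ := (all n k h.1 h.2.1 m).2 σ h.2.2
      exact ⟨l, fun _ _ _ => hl⟩
    · exact ⟨0, fun h1 h2 h3 => absurd ⟨h1, h2, h3⟩ h⟩
  choose u' hu' using hu
  choose f' hf' using hf
  exact ⟨u', f', fun n k h1 h2 m σ hσ => ⟨hu' n k m σ h1 h2 hσ, hf' n k m σ h1 h2 hσ⟩⟩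

end Scheme.IsAdmissible

end Limit

end

section

/-! ### Slowly varying coefficients -/

section Slow

variable {D q L S : ℕ} {p : ℕ} {T : Mesh D}
variable {V : Type} [NormedAddCommGroup V] [NormedSpace ℝ V]

/-- The coefficients `g` are bounded by `s` and their oscillation on each element by `s h`. -/
def SlowNodal (p : ℕ) (T : Mesh D) (h s : ℝ) (g : Pt D → V) : Prop :=
  (∀ σ ∈ dofs p T, ‖g σ‖ ≤ s) ∧
    ∀ K ∈ T.elems, ∀ σ ∈ nodes p K, ∀ τ ∈ nodes p K, ‖g σ - g τ‖ ≤ s * h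

namespace SlowNodal

variable {h s s' : ℝ} {g g' : Pt D → V}

omit [NormedSpace ℝ V] in
lemma mono (hh : 0 ≤ h) (hg : SlowNodal p T h s g) (hs : s ≤ s') : SlowNodal p T h s' g :=
  ⟨fun σ hσ => (hg.1 σ hσ).trans hs, fun K hK σ hσ τ hτ =>
    (hg.2 K hK σ hσ τ hτ).trans (mul_le_mul_of_nonneg_right hs hh)⟩

omit [NormedSpace ℝ V] in
lemma congr (hg : SlowNodal p T h s g) (he : ∀ σ ∈ dofs p T, g σ = g' σ) :
    SlowNodal p T h s g' :=
  ⟨fun σ hσ => by rw [← he σ hσ]; exact hg.1 σ hσ, fun K hK σ hσ τ hτ => by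
    rw [← he σ ⟨K, hK, hσ⟩, ← he τ ⟨K, hK, hτ⟩]; exact hg.2 K hK σ hσ τ hτ⟩

omit [NormedSpace ℝ V] in
lemma add (hg : SlowNodal p T h s g) (hg' : SlowNodal p T h s' g') :
    SlowNodal p T h (s + s') fun σ => g σ + g' σ := by
  refine ⟨fun σ hσ => (norm_add_le _ _).trans (add_le_add (hg.1 σ hσ) (hg'.1 σ hσ)),
    fun K hK σ hσ τ hτ => ?_⟩
  rw [add_sub_add_comm, add_mul]
  exact (norm_add_le _ _).trans (add_le_add (hg.2 K hK σ hσ τ hτ) (hg'.2 K hK σ hσ τ hτ))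

lemma smul (hg : SlowNodal p T h s g) (c : ℝ) : SlowNodal p T h (|c| * s) fun σ => c • g σ := by
  refine ⟨fun σ hσ => ?_, fun K hK σ hσ τ hτ => ?_⟩
  · rw [norm_smul]
    exact mul_le_mul_of_nonneg_left (hg.1 σ hσ) (abs_nonneg _)
  · rw [← smul_sub, norm_smul, mul_assoc]
    exact mul_le_mul_of_nonneg_left (hg.2 K hK σ hσ τ hτ) (abs_nonneg _)

omit [NormedSpace ℝ V] in
lemma neg (hg : SlowNodal p T h s g) : SlowNodal p T h s fun σ => -g σ := by
  refine ⟨fun σ hσ => by rw [norm_neg]; exact hg.1 σ hσ, fun K hK σ hσ τ hτ => ?_⟩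
  rw [neg_sub_neg, norm_sub_rev]
  exact hg.2 K hK σ hσ τ hτ

omit [NormedSpace ℝ V] in
lemma sub (hg : SlowNodal p T h s g) (hg' : SlowNodal p T h s' g') :
    SlowNodal p T h (s + s') fun σ => g σ - g' σ := by
  simp_rw [sub_eq_add_neg]
  exact hg.add hg'.neg

/-- Multiplication by a factor in `[0, 1]`. -/
lemma smul_le (hh : 0 ≤ h) (hs : 0 ≤ s) (hg : SlowNodal p T h s g) {c : ℝ} (h0 : 0 ≤ c)
    (h1 : c ≤ 1) : SlowNodal p T h s fun σ => c • g σ :=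
  (hg.smul c).mono hh (by rw [abs_of_nonneg h0]; exact mul_le_of_le_one_left hs h1)

omit [NormedSpace ℝ V] in
lemma map {W : Type} [NormedAddCommGroup W] (hg : SlowNodal p T h s g) {Φ : V → W} {c : ℝ}
    (hΦ : ∀ v w, Φ (v - w) = Φ v - Φ w) (hc : 0 ≤ c) (hb : ∀ v, ‖Φ v‖ ≤ c * ‖v‖) :
    SlowNodal p T h (c * s) fun σ => Φ (g σ) := by
  refine ⟨fun σ hσ => (hb _).trans (mul_le_mul_of_nonneg_left (hg.1 σ hσ) hc),
    fun K hK σ hσ τ hτ => ?_⟩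
  rw [← hΦ, mul_assoc]
  exact (hb _).trans (mul_le_mul_of_nonneg_left (hg.2 K hK σ hσ τ hτ) hc)

omit [NormedSpace ℝ V] in
/-- Coefficients of size `s h` are slowly varying. -/
lemma of_small (hh1 : h ≤ 1) (hs : 0 ≤ s) (hg : ∀ σ ∈ dofs p T, ‖g σ‖ ≤ s * h) :
    SlowNodal p T h (2 * s) g := by
  refine ⟨fun σ hσ => (hg σ hσ).trans ?_, fun K hK σ hσ τ hτ => ?_⟩
  · nlinarith
  · refine (norm_sub_le _ _).trans ?_
    have h1 := hg σ ⟨K, hK, hσ⟩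
    have h2 := hg τ ⟨K, hK, hτ⟩
    linarith

lemma sum {ι : Type} (N : Finset ι) {G : ι → Pt D → V} {w : ι → ℝ}
    (hG : ∀ i ∈ N, SlowNodal p T h s (G i)) :
    SlowNodal p T h ((∑ i ∈ N, |w i|) * s) fun σ => ∑ i ∈ N, w i • G i σ := by
  refine ⟨fun σ hσ => ?_, fun K hK σ hσ τ hτ => ?_⟩
  · rw [Finset.sum_mul]
    refine norm_sum_le_of_le _ fun i hi => ?_
    rw [norm_smul]
    exact mul_le_mul_of_nonneg_left ((hG i hi).1 σ hσ) (abs_nonneg _)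
  · rw [← Finset.sum_sub_distrib, mul_assoc, Finset.sum_mul]
    refine norm_sum_le_of_le _ fun i hi => ?_
    rw [← smul_sub, norm_smul]
    exact mul_le_mul_of_nonneg_left ((hG i hi).2 K hK σ hσ τ hτ) (abs_nonneg _)

end SlowNodal

section Average

variable {κ h : ℝ} {Ω : Set (Pt D)} {σ : Pt D}

/-- Averages over a cell of functions close to `c`. -/
lemma norm_cellAvg_sub_le [CompleteSpace V] (hp : 1 ≤ p) (hpos : 0 < cellVol p T σ)
    {ψ : Finset (Pt D) → Pt D → V}
    (hψ : ∀ K ∈ T.elems, Continuous (ψ K)) {c : V} {η : ℝ}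
    (hη : ∀ K ∈ elemsAt p T σ, ∀ x ∈ hull K, ‖ψ K x - c‖ ≤ η) : ‖cellAvg p T σ ψ - c‖ ≤ η :=
  norm_normalized_sum_sub_le hp hpos fun K hK =>
    norm_integral_shape_smul_sub_le (isSimplex_of_mem_elems hK.1) σ (hψ K hK.1) (hη K hK)

/-- Averages of slowly varying coefficients. -/
lemma SlowNodal.norm_cellAvg_sub_le {ι : Type} [Fintype ι] {s : ℝ} {g : Pt D → ι → ℝ}
    (hg : SlowNodal p T h s g) (hp : 1 ≤ p) (hpos : 0 < cellVol p T σ) :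
    ‖cellAvg p T σ (fun K => interp p K g) - g σ‖ ≤ s * h :=
  IMEXRD.norm_cellAvg_sub_le hp hpos
    (fun _ hK => continuous_interp (isSimplex_of_mem_elems hK) p g) fun K hK _ hx =>
      norm_interp_sub_le (isSimplex_of_mem_elems hK.1) (fun τ hτ => hg.2 K hK.1 τ hτ σ hK.2) hx

/-- The average differs from the nodal value by at most `s h`, and a difference of that size is
slowly varying with constant `2 s`. No comparison of neighbouring cells is required. -/
lemma SlowNodal.cellAvg {ι : Type} [Fintype ι] {s : ℝ} {g : Pt D → ι → ℝ}
    (hg : SlowNodal p T h s g) (hp : 1 ≤ p) (hpos : ∀ σ ∈ dofs p T, 0 < cellVol p T σ)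
    (hs : 0 ≤ s) (hh1 : h ≤ 1) :
    SlowNodal p T h (3 * s) fun σ => IMEXRD.cellAvg p T σ (fun K => interp p K g) := by
  have h1 : SlowNodal p T h (2 * s)
      fun σ => IMEXRD.cellAvg p T σ (fun K => interp p K g) - g σ :=
    SlowNodal.of_small hh1 hs fun σ hσ => hg.norm_cellAvg_sub_le hp (hpos σ hσ)
  have h2 := hg.add h1
  have e : s + 2 * s = 3 * s := by ring
  rw [e] at h2
  exact h2.congr fun σ _ => add_sub_cancel _ _

lemma mulVec_cellAvg {ι ι' : Type} [Fintype ι] [Fintype ι'] (hp : 1 ≤ p) (P : Matrix ι' ι ℝ)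
    {ψ : Finset (Pt D) → Pt D → ι → ℝ} (hψ : ∀ K ∈ T.elems, Continuous (ψ K)) :
    P *ᵥ cellAvg p T σ ψ = cellAvg p T σ fun K x => P *ᵥ ψ K x := by
  unfold cellAvg
  rw [Matrix.mulVec_smul, finsum_mem_eq_finite_toFinset_sum _ (finite_elemsAt hp T σ),
    finsum_mem_eq_finite_toFinset_sum _ (finite_elemsAt hp T σ), Matrix.mulVec_sum]
  congr 1
  refine Finset.sum_congr rfl fun K hK => ?_
  have hK' := ((finite_elemsAt hp T σ).mem_toFinset.1 hK).1
  have h1 : IntegrableOn (fun x => shape p K σ x • ψ K x) (hull K) :=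
    integrableOn_hull ((continuous_shape (isSimplex_of_mem_elems hK') p σ).smul (hψ K hK'))
  have := (LinearMap.toContinuousLinearMap (Matrix.mulVecLin P)).integral_comp_comm h1
  simp only [LinearMap.coe_toContinuousLinearMap', Matrix.mulVecLin_apply,
    Matrix.mulVec_smul] at this
  exact this.symm

end Average

end Slow

/-! ### Smooth reference states -/

section Reference

variable {D q L S : ℕ}

/-- Data of the model that are uniform with respect to mesh, timestep and relaxation time:
bounds by the constant `G` and smoothness of the Maxwellian in the `ρ`-neighbourhood of `𝒦`. -/
structure Scheme.IsSmooth (X : Scheme D q L S) (Λ : Fin D → Fin L → ℝ) (𝒰 𝒦 : Set (Fin q → ℝ))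
    (ρ G : ℝ) : Prop where
  one_le : 1 ≤ G
  rho_pos : 0 < ρ
  thick : Metric.cthickening ρ 𝒦 ⊆ 𝒰
  proj : ∀ w ∈ 𝒰, X.P *ᵥ X.maxw w = w
  diff : ∀ w ∈ 𝒰, DifferentiableAt ℝ X.maxw w
  lip : ∀ v w, ‖X.maxw v - X.maxw w‖ ≤ G * ‖v - w‖
  lip_fderiv : ∀ a ∈ 𝒦, ∀ v ∈ Metric.closedBall a ρ, ∀ w ∈ Metric.closedBall a ρ,
    ‖fderiv ℝ X.maxw v - fderiv ℝ X.maxw w‖ ≤ G * ‖v - w‖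
  norm_P : ∀ v, ‖X.P *ᵥ v‖ ≤ G * ‖v‖
  norm_Λ : ∑ d, ‖Λ d‖ ≤ G
  norm_weight : ∀ m, ∑ j, |X.weight m j| ≤ G
  inv_c : ∀ m ≠ 0, (X.c m)⁻¹ ≤ G

/-- A smooth reference state `u0` and the derivative `B` of its Maxwellian, on a mesh. -/
structure Scheme.IsReference (X : Scheme D q L S) (𝒦 : Set (Fin q → ℝ)) (ρ G : ℝ) (T : Mesh D)
    (h Δt : ℝ) (u0 : Pt D → Fin q → ℝ) (B : Pt D → Pt D →L[ℝ] (Fin L → ℝ)) : Prop where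
  dt_pos : 0 < Δt
  dt_le : Δt ≤ G * h
  h_pos : 0 < h
  h_le : h ≤ 1
  h_small : G * h ≤ ρ / 2
  mem : ∀ K ∈ T.elems, ∀ x ∈ hull K, u0 x ∈ 𝒦
  norm_le : ∀ K ∈ T.elems, ∀ x ∈ hull K, ‖X.maxw (u0 x)‖ ≤ G
  lip : ∀ K ∈ T.elems, ∀ x ∈ hull K, ∀ y ∈ hull K, ‖u0 x - u0 y‖ ≤ G * h
  norm_B : ∀ K ∈ T.elems, ∀ x ∈ hull K, ‖B x‖ ≤ G
  lip_B : ∀ K ∈ T.elems, ∀ x ∈ hull K, ∀ y ∈ hull K, ‖B x - B y‖ ≤ G * h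
  taylor : ∀ K ∈ T.elems, ∀ x ∈ hull K, ∀ y ∈ hull K,
    ‖X.maxw (u0 y) - X.maxw (u0 x) - B x (y - x)‖ ≤ G * h ^ 2
  fderiv_B : ∀ K ∈ T.elems, ∀ x ∈ hull K, ∀ z, fderiv ℝ X.maxw (u0 x) (X.P *ᵥ B x z) = B x z

namespace Scheme.IsSmooth

variable {X : Scheme D q L S} {Λ : Fin D → Fin L → ℝ} {𝒰 𝒦 : Set (Fin q → ℝ)} {ρ G : ℝ}

lemma mem_of_dist (hM : X.IsSmooth Λ 𝒰 𝒦 ρ G) {a w : Fin q → ℝ} (ha : a ∈ 𝒦)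
    (hw : ‖w - a‖ ≤ ρ) : w ∈ 𝒰 :=
  hM.thick (Metric.closedBall_subset_cthickening ha ρ (by rwa [mem_closedBall_iff_norm]))

/-- Second differences of the Maxwellian. -/
lemma norm_second_diff_le (hM : X.IsSmooth Λ 𝒰 𝒦 ρ G) {a b w w' : Fin q → ℝ} (ha : a ∈ 𝒦)
    (hb : ‖b - a‖ ≤ ρ / 2) (hw : ‖w‖ ≤ ρ / 2) :
    ‖(X.maxw (a + w) - X.maxw a) - (X.maxw (b + w') - X.maxw b)‖ ≤
      G * ‖w‖ * ‖a - b‖ + G * ‖w - w'‖ := by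
  have hρ := hM.rho_pos
  -- Mean value inequality for `z ↦ M(z + w) - M(z)`, whose derivative is at most `G ‖w‖`. The
  -- segment stays in the ball of radius `ρ / 2`, so the shift by `w` remains within distance `ρ` of
  -- `a`.
  have h1 : ‖(X.maxw (a + w) - X.maxw a) - (X.maxw (b + w) - X.maxw b)‖ ≤
      G * ‖w‖ * ‖a - b‖ := by
    have hd : ∀ z ∈ Metric.closedBall a (ρ / 2),
        HasFDerivWithinAt (fun z => X.maxw (z + w) - X.maxw z)
          (fderiv ℝ X.maxw (z + w) - fderiv ℝ X.maxw z) (Metric.closedBall a (ρ / 2)) z ∧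
        ‖fderiv ℝ X.maxw (z + w) - fderiv ℝ X.maxw z‖ ≤ G * ‖w‖ := by
      intro z hz
      rw [mem_closedBall_iff_norm] at hz
      have z1 : ‖z - a‖ ≤ ρ := by linarith
      have z2 : ‖z + w - a‖ ≤ ρ := by
        rw [add_sub_right_comm]
        exact (norm_add_le _ _).trans (by linarith)
      constructor
      · have d1 := (hM.diff _ (hM.mem_of_dist ha z1)).hasFDerivAt
        have d2 := (hM.diff _ (hM.mem_of_dist ha z2)).hasFDerivAt
        exact (((hasFDerivAt_comp_add_right w).2 d2).sub d1).hasFDerivWithinAt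
      · have := hM.lip_fderiv a ha (z + w) (mem_closedBall_iff_norm.2 z2) z
          (mem_closedBall_iff_norm.2 z1)
        rwa [add_sub_cancel_left] at this
    exact (convex_closedBall a (ρ / 2)).norm_image_sub_le_of_norm_hasFDerivWithin_le
      (fun z hz => (hd z hz).1) (fun z hz => (hd z hz).2)
      (mem_closedBall_iff_norm.2 hb) (Metric.mem_closedBall_self (by positivity))
  have h2 : ‖X.maxw (b + w) - X.maxw (b + w')‖ ≤ G * ‖w - w'‖ := by
    have := hM.lip (b + w) (b + w')
    rwa [add_sub_add_left_eq_sub] at this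
  calc _ = ‖((X.maxw (a + w) - X.maxw a) - (X.maxw (b + w) - X.maxw b)) +
        (X.maxw (b + w) - X.maxw (b + w'))‖ := by congr 1; abel
    _ ≤ _ := (norm_add_le _ _).trans (add_le_add h1 h2)

end Scheme.IsSmooth

/-- `∑_d Λ_d B e_d`. -/
def fluxDeriv (Λ : Fin D → Fin L → ℝ) (B : Pt D → Pt D →L[ℝ] (Fin L → ℝ)) (σ : Pt D) :
    Fin L → ℝ := ∑ d, lam Λ d (B σ (unitDir d))

/-! ### Coefficients near the reference state and consistency of advection there -/

section Nodal

variable {X : Scheme D q L S} {Λ : Fin D → Fin L → ℝ} {Ω : Set (Pt D)} {κ : ℝ}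
  {𝒰 𝒦 : Set (Fin q → ℝ)} {ρ G : ℝ} {T : Mesh D} {h Δt : ℝ} {u0 : Pt D → Fin q → ℝ}
  {B : Pt D → Pt D →L[ℝ] (Fin L → ℝ)}

lemma norm_fluxDeriv_sub_le (hM : X.IsSmooth Λ 𝒰 𝒦 ρ G) (σ : Pt D) (C : Pt D →L[ℝ] (Fin L → ℝ)) :
    ‖∑ d, lam Λ d (C (unitDir d)) - fluxDeriv Λ B σ‖ ≤ G * ‖C - B σ‖ :=
  (norm_sum_lam_sub_le Λ C (B σ)).trans
    (mul_le_mul_of_nonneg_right hM.norm_Λ (norm_nonneg _))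

lemma slowNodal_fluxDeriv (hp : 1 ≤ p) (hM : X.IsSmooth Λ 𝒰 𝒦 ρ G)
    (hR : X.IsReference 𝒦 ρ G T h Δt u0 B) : SlowNodal p T h (G * G) (fluxDeriv Λ B) := by
  have hG : 0 ≤ G := zero_le_one.trans hM.one_le
  refine ⟨fun σ hσ => ?_, fun K hK σ hσ τ hτ => ?_⟩
  · obtain ⟨K, hK, hσ⟩ := hσ
    have := norm_fluxDeriv_sub_le (B := B) hM σ 0
    have h0 : ∑ d, lam Λ d ((0 : Pt D →L[ℝ] (Fin L → ℝ)) (unitDir d)) = 0 := by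
      simp [lam]
    rw [h0, zero_sub, zero_sub, norm_neg, norm_neg] at this
    exact this.trans (mul_le_mul_of_nonneg_left
      (hR.norm_B K hK σ (nodes_subset_hull hp hσ)) hG)
  · rw [mul_assoc]
    exact (norm_fluxDeriv_sub_le hM τ (B σ)).trans (mul_le_mul_of_nonneg_left
      (hR.lip_B K hK σ (nodes_subset_hull hp hσ) τ (nodes_subset_hull hp hτ)) hG)

/-- The Maxwellian of a slowly varying perturbation of the reference state. -/
lemma SlowNodal.maxw (hp : 1 ≤ p) (hM : X.IsSmooth Λ 𝒰 𝒦 ρ G)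
    (hR : X.IsReference 𝒦 ρ G T h Δt u0 B) {c : ℝ} (hc : 0 ≤ c) (hch : c * h ≤ ρ / 2)
    {u : Pt D → Fin q → ℝ} (hu : SlowNodal p T h (c * h) fun σ => u σ - u0 σ) :
    SlowNodal p T h (2 * G ^ 2 * c * h) fun σ => X.maxw (u σ) - X.maxw (u0 σ) := by
  have hG := hM.one_le
  have hh := hR.h_pos
  have hG2 : G ≤ G ^ 2 := by nlinarith
  refine ⟨fun σ hσ => ?_, fun K hK σ hσ τ hτ => ?_⟩
  · calc _ ≤ G * ‖u σ - u0 σ‖ := hM.lip _ _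
      _ ≤ G * (c * h) := by gcongr; exact hu.1 σ hσ
      _ ≤ G ^ 2 * (c * h) := by gcongr
      _ ≤ _ := by nlinarith [mul_nonneg (sq_nonneg G) (mul_nonneg hc hh.le)]
  · have s1 := nodes_subset_hull hp hσ
    have t1 := nodes_subset_hull hp hτ
    have hd := hR.lip K hK σ s1 τ t1
    have hw := hu.1 σ ⟨K, hK, hσ⟩
    have hd' := hR.lip K hK τ t1 σ s1
    -- Lipschitz continuity of `M` would bound the oscillation only by `O(h)`; the second difference
    -- gives the required `O(h^2)`.
    have key := hM.norm_second_diff_le (a := u0 σ) (b := u0 τ) (w := u σ - u0 σ)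
      (w' := u τ - u0 τ) (hR.mem K hK σ s1) (hd'.trans hR.h_small) (hw.trans hch)
    rw [add_sub_cancel, add_sub_cancel] at key
    refine key.trans ?_
    calc _ ≤ G * (c * h) * (G * h) + G * (c * h * h) := by
          gcongr
          exact hu.2 K hK σ hσ τ hτ
      _ ≤ G * (c * h) * (G * h) + G ^ 2 * (c * h * h) := by gcongr
      _ = _ := by ring

/-- Coefficients close to the Maxwellian of the reference state are locally affine, in a number of
layers of elements. -/
lemma norm_layers_le (hp : 1 ≤ p) (hκ : 0 < κ) (hT : T.IsRegular Ω κ h)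
    (hM : X.IsSmooth Λ 𝒰 𝒦 ρ G) (hR : X.IsReference 𝒦 ρ G T h Δt u0 B) {c : ℝ}
    {f : Pt D → Fin L → ℝ} (hf : SlowNodal p T h (c * h) fun σ => f σ - X.maxw (u0 σ))
    {σ : Pt D} (hσ : σ ∈ dofs p T) (r : ℕ) : ∀ τ ∈ layers p T r σ, τ ∈ dofs p T ∧
      ‖B τ - B σ‖ ≤ r * G * h ∧ ‖f τ - (f σ + B σ (τ - σ))‖ ≤ (r * c + r ^ 2 * G) * h ^ 2 := by
  have hG := hM.one_le
  have hh := hR.h_pos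
  induction r with
  | zero =>
    intro τ hτ
    have : τ = σ := hτ
    subst this
    simpa using hσ
  | succ r ih =>
    rintro τ ⟨η, hη, K, hK, hηK, hτK⟩
    obtain ⟨i1, i2, i3⟩ := ih η hη
    have e1 := nodes_subset_hull hp hηK
    have t1 := nodes_subset_hull hp hτK
    refine ⟨⟨K, hK, hτK⟩, ?_, ?_⟩
    · have := hR.lip_B K hK τ t1 η e1
      have h3 := norm_sub_le_norm_sub_add_norm_sub (B τ) (B η) (B σ)
      push_cast
      linarith
    · have j1 : ‖f τ - X.maxw (u0 τ) - (f η - X.maxw (u0 η))‖ ≤ c * h * h :=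
        hf.2 K hK τ hτK η hηK
      have j2 := hR.taylor K hK η e1 τ t1
      have j3 : ‖(B η - B σ) (τ - η)‖ ≤ r * G * h * h := by
        refine ((B η - B σ).le_opNorm _).trans ?_
        exact mul_le_mul i2 ((hT.simplex hκ hK).dist_le t1 e1) (norm_nonneg _) (by positivity)
      -- One more element in the chain from `σ` to `τ` adds the oscillation `c h^2` of the
      -- perturbation, a Taylor remainder `G h^2` at `η`, and the change of slope between `σ` and
      -- `η` times the step, `r G h^2`. This fits since `r^2 + r + 1 ≤ (r + 1)^2`.
      have e : f τ - (f σ + B σ (τ - σ)) = ((f τ - X.maxw (u0 τ)) - (f η - X.maxw (u0 η))) +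
          (X.maxw (u0 τ) - X.maxw (u0 η) - B η (τ - η)) + (B η - B σ) (τ - η) +
          (f η - (f σ + B σ (η - σ))) := by
        simp only [sub_apply, map_sub]
        abel
      rw [e]
      refine (norm_add_le _ _).trans ?_
      have k1 := norm_add_le (((f τ - X.maxw (u0 τ)) - (f η - X.maxw (u0 η))) +
          (X.maxw (u0 τ) - X.maxw (u0 η) - B η (τ - η))) ((B η - B σ) (τ - η))
      have k2 := norm_add_le ((f τ - X.maxw (u0 τ)) - (f η - X.maxw (u0 η)))
          (X.maxw (u0 τ) - X.maxw (u0 η) - B η (τ - η))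
      have k3 : (0 : ℝ) ≤ r * G * h ^ 2 := by positivity
      rw [Nat.cast_succ]
      linarith

/-- Consistency of the advection residuals at coefficients close to the Maxwellian of a smooth
state. -/
lemma Scheme.IsAdmissible.exists_norm_adv_sub_le (hX : X.IsAdmissible Λ Ω κ)
    (hM : X.IsSmooth Λ 𝒰 𝒦 ρ G) {c : ℝ} (hc : 0 ≤ c) : ∃ C, 0 ≤ C ∧ ∃ h1 > 0,
    ∀ (T : Mesh D) (h Δt : ℝ) (u0 : Pt D → Fin q → ℝ) (B : Pt D → Pt D →L[ℝ] (Fin L → ℝ)),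
      T.IsRegular Ω κ h → X.IsReference 𝒦 ρ G T h Δt u0 B → h ≤ h1 →
      ∀ f : Pt D → Fin L → ℝ, SlowNodal X.p T h (c * h) (fun σ => f σ - X.maxw (u0 σ)) →
        ∀ σ ∈ dofs X.p T, ‖X.adv T σ f - fluxDeriv Λ B σ‖ ≤ C * h := by
  have hG := hM.one_le
  -- The parameter `c + G + 1` bounds at once the value `‖f σ‖ ≤ c h + G`, the slope `‖B σ‖ ≤ G` and
  -- the ratio `δ / h = b h`, which is at most `1` for `h ≤ 1 / (b + 1)`.
  obtain ⟨C, r, hC⟩ := hX.consistent.2 (c + G + 1) (by positivity)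
  set b : ℝ := r * c + r ^ 2 * G with hb
  have hb0 : 0 ≤ b := by positivity
  refine ⟨|C| * (b + 1), by positivity, 1 / (b + 1), by positivity,
    fun T h Δt u0 B hT hR hh1 f hf σ hσ => ?_⟩
  have hh := hR.h_pos
  obtain ⟨K, hK, hσK⟩ := id hσ
  have s1 := nodes_subset_hull hX.one_le_p hσK
  have h2 : (b + 1) * h ≤ 1 := by
    rwa [le_div_iff₀' (by positivity)] at hh1
  have key := hC T h hT σ hσ f (f σ) (B σ) (b * h ^ 2) ?_ ?_ (by positivity) ?_
    fun τ hτ => (norm_layers_le hX.one_le_p hX.kappa_pos hT hM hR hf hσ r τ hτ).2.2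
  · refine key.trans ?_
    have e : b * h ^ 2 / h + h = (b + 1) * h := by field_simp
    rw [e, mul_assoc]
    exact mul_le_mul_of_nonneg_right (le_abs_self C) (by positivity)
  · have n1 := hf.1 σ hσ
    have n2 := hR.norm_le K hK σ s1
    have n3 : ‖f σ‖ ≤ ‖f σ - X.maxw (u0 σ)‖ + ‖X.maxw (u0 σ)‖ := by
      simpa using norm_add_le (f σ - X.maxw (u0 σ)) (X.maxw (u0 σ))
    have n4 : c * h ≤ c := mul_le_of_le_one_right hc hR.h_le
    linarith
  · exact (hR.norm_B K hK σ s1).trans (by linarith)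
  · have : b * h ^ 2 ≤ 1 * h := by
      have : b * h ≤ 1 := by linarith
      nlinarith
    refine this.trans (mul_le_mul_of_nonneg_right ?_ hh.le)
    linarith

end Nodal

end Reference

end

section

/-! ### Estimates for one timestep -/

section Step

variable {D q L S : ℕ}

/-- The convex combination in increment form: a backward Euler step. It isolates the relaxation term
at the new value, which is `O(h)` before division by `ε`. -/
lemma relax_predict {V : Type} [AddCommGroup V] [Module ℝ V] {ε d : ℝ} (hε : ε ≠ 0)
    (hd : ε + d ≠ 0) {f A M : V} (hf : f = (ε / (ε + d)) • A + (1 - ε / (ε + d)) • M) :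
    f - A = (d / ε) • (M - f) := by
  subst hf
  match_scalars <;> field_simp <;> ring

lemma relax_correct {V : Type} [AddCommGroup V] [Module ℝ V] {ε d Δ : ℝ} (hε : ε ≠ 0)
    (hd : ε + d ≠ 0) {f f' M M' A Q : V} (hf : f' = f + (1 - ε / (ε + d)) • (M' - M) -
      (ε / (ε + d)) • A + (Δ / (ε + d)) • Q) :
    f' - f = -A + (d / ε) • (M' - f') - (d / ε) • (M - f) + (Δ / ε) • Q := by
  subst hf
  match_scalars <;> field_simp <;> ring

/-- The coefficients `u`, `f` are close to those of the reference state and its Maxwellian. -/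
structure Scheme.IsNear (X : Scheme D q L S) (T : Mesh D) (h c : ℝ) (u0 : Pt D → Fin q → ℝ)
    (u : Pt D → Fin q → ℝ) (f : Pt D → Fin L → ℝ) : Prop where
  proj : ∀ σ ∈ dofs X.p T, X.P *ᵥ f σ = u σ
  slow : SlowNodal X.p T h (c * h) fun σ => f σ - X.maxw (u0 σ)

/-- The estimates for the values at sub-timestep `m` of an iteration with start values `us`, `fs`. -/
structure Scheme.StepBound (X : Scheme D q L S) (Λ : Fin D → Fin L → ℝ) (T : Mesh D)
    (h Δt ε c : ℝ) (u0 : Pt D → Fin q → ℝ) (B : Pt D → Pt D →L[ℝ] (Fin L → ℝ))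
    (us : Pt D → Fin q → ℝ) (fs : Pt D → Fin L → ℝ) (m : Fin (S + 1))
    (u : Pt D → Fin q → ℝ) (f : Pt D → Fin L → ℝ) : Prop where
  near : X.IsNear T h c u0 u f
  inc_u : ∀ σ ∈ dofs X.p T,
    ‖u σ - us σ + X.dt Δt m • (X.P *ᵥ fluxDeriv Λ B σ)‖ ≤ c * Δt * h
  inc_f : ∀ σ ∈ dofs X.p T,
    ‖f σ - fs σ + X.dt Δt m • fluxDeriv Λ B σ‖ ≤ c * Δt * (h + h / ε)

variable {X : Scheme D q L S} {Λ : Fin D → Fin L → ℝ} {Ω : Set (Pt D)} {κ : ℝ}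
  {𝒰 𝒦 : Set (Fin q → ℝ)} {ρ G : ℝ} {T : Mesh D} {h Δt ε c : ℝ} {u0 : Pt D → Fin q → ℝ}
  {B : Pt D → Pt D →L[ℝ] (Fin L → ℝ)} {u us : Pt D → Fin q → ℝ} {f fs : Pt D → Fin L → ℝ}

lemma Scheme.IsNear.mono (hn : X.IsNear T h c u0 u f) (hh : 0 ≤ h) {c' : ℝ} (hc : c ≤ c') :
    X.IsNear T h c' u0 u f :=
  ⟨hn.proj, hn.slow.mono hh (mul_le_mul_of_nonneg_right hc hh)⟩

lemma Scheme.IsNear.congr (hn : X.IsNear T h c u0 us fs) (hu : ∀ σ ∈ dofs X.p T, u σ = us σ)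
    (hf : ∀ σ ∈ dofs X.p T, f σ = fs σ) : X.IsNear T h c u0 u f :=
  ⟨fun σ hσ => by rw [hf σ hσ, hu σ hσ, hn.proj σ hσ],
    hn.slow.congr fun σ hσ => by rw [hf σ hσ]⟩

lemma Scheme.StepBound.mono {m : Fin (S + 1)}
    (hb : X.StepBound Λ T h Δt ε c u0 B us fs m u f) (hh : 0 ≤ h) (hΔ : 0 ≤ Δt) (hε : 0 < ε)
    {c' : ℝ} (hc : c ≤ c') : X.StepBound Λ T h Δt ε c' u0 B us fs m u f :=
  ⟨hb.near.mono hh hc, fun σ hσ => (hb.inc_u σ hσ).trans (by gcongr),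
    fun σ hσ => (hb.inc_f σ hσ).trans (by gcongr)⟩

lemma Scheme.IsReference.mem_dofs (hp : 1 ≤ X.p) (hR : X.IsReference 𝒦 ρ G T h Δt u0 B)
    {σ : Pt D} (hσ : σ ∈ dofs X.p T) : u0 σ ∈ 𝒦 := by
  obtain ⟨K, hK, hσ⟩ := hσ
  exact hR.mem K hK σ (nodes_subset_hull hp hσ)

lemma Scheme.IsSmooth.mem_self (hM : X.IsSmooth Λ 𝒰 𝒦 ρ G) {a : Fin q → ℝ} (ha : a ∈ 𝒦) :
    a ∈ 𝒰 := hM.mem_of_dist ha (by simpa using hM.rho_pos.le)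

lemma SlowNodal.mulVec (hM : X.IsSmooth Λ 𝒰 𝒦 ρ G) {s : ℝ} {g : Pt D → Fin L → ℝ}
    (hg : SlowNodal X.p T h s g) : SlowNodal X.p T h (G * s) fun σ => X.P *ᵥ g σ :=
  hg.map (Φ := fun v => X.P *ᵥ v) (fun _ _ => Matrix.mulVec_sub _ _ _)
    (zero_le_one.trans hM.one_le) hM.norm_P

lemma Scheme.IsNear.slow_u (hn : X.IsNear T h c u0 u f) (hp : 1 ≤ X.p)
    (hM : X.IsSmooth Λ 𝒰 𝒦 ρ G) (hR : X.IsReference 𝒦 ρ G T h Δt u0 B) :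
    SlowNodal X.p T h (G * c * h) fun σ => u σ - u0 σ := by
  have := hn.slow.mulVec hM
  rw [← mul_assoc] at this
  refine this.congr fun σ hσ => ?_
  rw [Matrix.mulVec_sub, hn.proj σ hσ, hM.proj _ (hM.mem_self (hR.mem_dofs hp hσ))]

/-- The deviation of `f_h` from the Maxwellian of the reference state varies slowly. -/
lemma Scheme.IsNear.norm_interp_le (hn : X.IsNear T h c u0 u f) (hp : 1 ≤ X.p) (hκ : 0 < κ)
    (hT : T.IsRegular Ω κ h) (hM : X.IsSmooth Λ 𝒰 𝒦 ρ G)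
    (hR : X.IsReference 𝒦 ρ G T h Δt u0 B) {K : Finset (Pt D)} (hK : K ∈ T.elems) {σ x : Pt D}
    (hσ : σ ∈ nodes X.p K) (hx : x ∈ hull K) :
    ‖(interp X.p K f x - X.maxw (u0 x)) - (f σ - X.maxw (u0 σ))‖ ≤ (c + 2 * G) * h ^ 2 := by
  have hs := isSimplex_of_mem_elems hK
  have h1 : ∀ τ ∈ nodes X.p K, ‖(f - fun τ => f σ + B σ (τ - σ)) τ - 0‖ ≤ (c + G) * h ^ 2 := by
    intro τ hτ
    have := (norm_layers_le hp hκ hT hM hR hn.slow ⟨K, hK, hσ⟩ 1 τ ⟨σ, rfl, K, hK, hσ, hτ⟩).2.2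
    simpa using this
  have h2 := norm_interp_sub_le hs h1 hx
  rw [sub_zero, interp_sub, interp_affine hs hp] at h2
  have h3 := hR.taylor K hK σ (nodes_subset_hull hp hσ) x hx
  have e : (interp X.p K f x - X.maxw (u0 x)) - (f σ - X.maxw (u0 σ)) =
      (interp X.p K f x - (f σ + B σ (x - σ))) -
        (X.maxw (u0 x) - X.maxw (u0 σ) - B σ (x - σ)) := by abel
  rw [e]
  refine (norm_sub_le _ _).trans ?_
  linarith

lemma Scheme.IsNear.interp_u (hn : X.IsNear T h c u0 u f) {K : Finset (Pt D)}
    (hK : K ∈ T.elems) (x : Pt D) : X.P *ᵥ interp X.p K f x = interp X.p K u x := by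
  rw [← interp_mulVec, interp_congr fun τ hτ => hn.proj τ ⟨K, hK, hτ⟩]

lemma Scheme.IsNear.norm_interp_u_le (hn : X.IsNear T h c u0 u f) (hp : 1 ≤ X.p)
    (hM : X.IsSmooth Λ 𝒰 𝒦 ρ G)
    (hR : X.IsReference 𝒦 ρ G T h Δt u0 B) {K : Finset (Pt D)} (hK : K ∈ T.elems) {y x : Pt D}
    (hy : y ∈ hull K) (hx : x ∈ hull K) :
    ‖interp X.p K u x - u0 y‖ ≤ (G * c + G) * h := by
  refine norm_interp_sub_le (isSimplex_of_mem_elems hK) (fun τ hτ => ?_) hx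
  have h1 := (hn.slow_u hp hM hR).1 τ ⟨K, hK, hτ⟩
  have h2 := hR.lip K hK τ (nodes_subset_hull hp hτ) y hy
  have h3 := norm_sub_le_norm_sub_add_norm_sub (u τ) (u0 τ) (u0 y)
  linarith

lemma Scheme.continuous_relaxTerm (hX : X.IsAdmissible Λ Ω κ) (f : Pt D → Fin L → ℝ)
    {K : Finset (Pt D)} (hK : K ∈ T.elems) :
    Continuous fun x => X.maxw (X.P *ᵥ interp X.p K f x) - interp X.p K f x := by
  have hP : Continuous fun v : Fin L → ℝ => X.P *ᵥ v :=
    Continuous.matrix_mulVec continuous_const continuous_id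
  have hi := continuous_interp (isSimplex_of_mem_elems hK) X.p f
  exact (hX.continuous_maxw.comp (hP.comp hi)).sub hi

/-- The averaged relaxation term agrees with the nodal one up to `O(h^2)`. -/
lemma Scheme.IsNear.norm_source_sub_le (hn : X.IsNear T h c u0 u f) (hX : X.IsAdmissible Λ Ω κ)
    (hT : T.IsRegular Ω κ h) (hM : X.IsSmooth Λ 𝒰 𝒦 ρ G)
    (hR : X.IsReference 𝒦 ρ G T h Δt u0 B) (hch : G * c * h ≤ ρ / 2) {σ : Pt D}
    (hσ : σ ∈ dofs X.p T) :
    ‖X.source T σ f - (X.maxw (u σ) - f σ)‖ ≤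
      (G ^ 3 * c + (G ^ 2 + 1) * (c + 2 * G)) * h ^ 2 := by
  have hp := hX.one_le_p
  have hG : 0 ≤ G := zero_le_one.trans hM.one_le
  have hh := hR.h_pos
  refine norm_cellAvg_sub_le hp (hX.cellVol_pos hT hσ)
    (fun K hK => Scheme.continuous_relaxTerm hX f hK) fun K hK x hx => ?_
  have s1 := nodes_subset_hull hp hK.2
  have h1 := hn.norm_interp_le hp hX.kappa_pos hT hM hR hK.1 hK.2 hx
  have hw := (hn.slow_u hp hM hR).1 σ hσ
  have h2 : ‖(u σ - u0 σ) - (interp X.p K u x - u0 x)‖ ≤ G * ((c + 2 * G) * h ^ 2) := by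
    have e : (interp X.p K u x - u0 x) - (u σ - u0 σ) =
        X.P *ᵥ ((interp X.p K f x - X.maxw (u0 x)) - (f σ - X.maxw (u0 σ))) := by
      rw [Matrix.mulVec_sub, Matrix.mulVec_sub, Matrix.mulVec_sub, hn.interp_u hK.1,
        hn.proj σ hσ, hM.proj _ (hM.mem_self (hR.mem K hK.1 x hx)),
        hM.proj _ (hM.mem_self (hR.mem_dofs hp hσ))]
    rw [norm_sub_rev, e]
    exact (hM.norm_P _).trans (mul_le_mul_of_nonneg_left h1 hG)
  have hl := hR.lip K hK.1 σ s1 x hx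
  have hl' := hR.lip K hK.1 x hx σ s1
  have h3 := hM.norm_second_diff_le (a := u0 σ) (b := u0 x) (w := u σ - u0 σ)
    (w' := interp X.p K u x - u0 x) (hR.mem K hK.1 σ s1) (hl'.trans hR.h_small) (hw.trans hch)
  rw [add_sub_cancel, add_sub_cancel] at h3
  have h4 : G * ‖u σ - u0 σ‖ * ‖u0 σ - u0 x‖ ≤ G * (G * c * h) * (G * h) := by
    refine mul_le_mul (mul_le_mul_of_nonneg_left hw hG) hl (norm_nonneg _) ?_
    exact mul_nonneg hG ((norm_nonneg _).trans hw)
  have h5 := mul_le_mul_of_nonneg_left h2 hG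
  -- A second difference of `M` along `u - u0`, and the variation of the deviation `f_h - M(u0)`
  -- between `σ` and `x`; both are `O(h^2)`.
  have e : X.maxw (X.P *ᵥ interp X.p K f x) - interp X.p K f x - (X.maxw (u σ) - f σ) =
      -((X.maxw (u σ) - X.maxw (u0 σ)) - (X.maxw (interp X.p K u x) - X.maxw (u0 x))) -
      ((interp X.p K f x - X.maxw (u0 x)) - (f σ - X.maxw (u0 σ))) := by
    rw [hn.interp_u hK.1]
    abel
  rw [e]
  refine (norm_sub_le _ _).trans ?_
  rw [norm_neg]
  nlinarith

/-- Pointwise `u_h(x)` lies in `𝒰`, so `P M(u_h) = u_h = P f_h` there: relaxation conserves the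
macroscopic variable even after averaging, and `1 / ε` is absent from the macroscopic equation. -/
lemma Scheme.IsNear.proj_source (hn : X.IsNear T h c u0 u f) (hX : X.IsAdmissible Λ Ω κ)
    (hT : T.IsRegular Ω κ h) (hM : X.IsSmooth Λ 𝒰 𝒦 ρ G)
    (hR : X.IsReference 𝒦 ρ G T h Δt u0 B) (hch : (G * c + G) * h ≤ ρ) {σ : Pt D}
    (hσ : σ ∈ dofs X.p T) : X.P *ᵥ X.source T σ f = 0 := by
  have hp := hX.one_le_p
  unfold Scheme.source
  rw [mulVec_cellAvg hp X.P fun K hK => Scheme.continuous_relaxTerm hX f hK, ← norm_le_zero_iff,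
    ← sub_zero (cellAvg _ _ _ _)]
  refine norm_cellAvg_sub_le hp (hX.cellVol_pos hT hσ) (fun K hK => ?_) fun K hK x hx => ?_
  · exact Continuous.matrix_mulVec continuous_const (Scheme.continuous_relaxTerm hX f hK)
  · have : interp X.p K u x ∈ 𝒰 := hM.mem_of_dist (hR.mem K hK.1 x hx)
      ((hn.norm_interp_u_le hp hM hR hK.1 hx hx).trans hch)
    rw [Matrix.mulVec_sub, hn.interp_u hK.1, hM.proj _ this]
    simp

/-- `M(u)` and `f` are both compared with `M(u0)`. Proximity to equilibrium is thus `O(h)` uniformly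
in `ε`, a consequence of nearness to the data and not of strong relaxation. -/
lemma Scheme.IsNear.slow_relax (hn : X.IsNear T h c u0 u f) (hX : X.IsAdmissible Λ Ω κ)
    (hM : X.IsSmooth Λ 𝒰 𝒦 ρ G) (hR : X.IsReference 𝒦 ρ G T h Δt u0 B) (hc : 0 ≤ c)
    (hch : G * c * h ≤ ρ / 2) :
    SlowNodal X.p T h ((2 * G ^ 2 * (G * c) + c) * h) fun σ => X.maxw (u σ) - f σ := by
  have hG : 0 ≤ G := zero_le_one.trans hM.one_le
  have h1 := ((hn.slow_u hX.one_le_p hM hR).maxw hX.one_le_p hM hR (by positivity) hch).sub hn.slow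
  rw [← add_mul] at h1
  exact h1.congr fun σ _ => sub_sub_sub_cancel_right _ _ _

lemma Scheme.IsNear.slow_source (hn : X.IsNear T h c u0 u f) (hX : X.IsAdmissible Λ Ω κ)
    (hT : T.IsRegular Ω κ h) (hM : X.IsSmooth Λ 𝒰 𝒦 ρ G)
    (hR : X.IsReference 𝒦 ρ G T h Δt u0 B) (hc : 0 ≤ c) (hch : G * c * h ≤ ρ / 2) :
    SlowNodal X.p T h ((2 * G ^ 2 * (G * c) + c +
      2 * (G ^ 3 * c + (G ^ 2 + 1) * (c + 2 * G))) * h) fun σ => X.source T σ f := by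
  have hG : 0 ≤ G := zero_le_one.trans hM.one_le
  have hh := hR.h_pos
  have h1 : SlowNodal X.p T h (2 * ((G ^ 3 * c + (G ^ 2 + 1) * (c + 2 * G)) * h))
      fun σ => X.source T σ f - (X.maxw (u σ) - f σ) :=
    SlowNodal.of_small hR.h_le (by positivity) fun σ hσ =>
      (hn.norm_source_sub_le hX hT hM hR hch hσ).trans (le_of_eq (by ring))
  have h2 := ((hn.slow_relax hX hM hR hc hch).add h1).congr (g' := fun σ => X.source T σ f)
    fun σ _ => add_sub_cancel _ _
  exact h2.mono hh.le (le_of_eq (by ring))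

/-- Consistency at each single node is enough: the deviation from the smooth limit is `O(h)`, hence
slowly varying of order one. -/
lemma slowNodal_adv (hX : X.IsAdmissible Λ Ω κ) (hM : X.IsSmooth Λ 𝒰 𝒦 ρ G)
    (hR : X.IsReference 𝒦 ρ G T h Δt u0 B) {C : ℝ} (hC : 0 ≤ C)
    (hadv : ∀ σ ∈ dofs X.p T, ‖X.adv T σ f - fluxDeriv Λ B σ‖ ≤ C * h) :
    SlowNodal X.p T h (G * G + 2 * C) fun σ => X.adv T σ f :=
  ((slowNodal_fluxDeriv hX.one_le_p hM hR).add (SlowNodal.of_small hR.h_le hC hadv)).congr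
    fun _ _ => add_sub_cancel _ _

lemma Scheme.relax_mem (X : Scheme D q L S) {ε Δt : ℝ} (hε : 0 < ε) {m : Fin (S + 1)}
    (hm : 0 ≤ X.dt Δt m) : 0 ≤ X.relax ε Δt m ∧ X.relax ε Δt m ≤ 1 := by
  unfold Scheme.relax
  exact ⟨by positivity, (div_le_one (by positivity)).2 (by linarith)⟩

lemma Scheme.IsAdmissible.dt_le (hX : X.IsAdmissible Λ Ω κ) (hΔ : 0 < Δt) (m : Fin (S + 1)) :
    X.dt Δt m ≤ Δt := mul_le_of_le_one_left hΔ.le (hX.c_le_one m)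

lemma Scheme.IsAdmissible.dt_nonneg (hX : X.IsAdmissible Λ Ω κ) (hΔ : 0 < Δt) (m : Fin (S + 1)) :
    0 ≤ X.dt Δt m := mul_nonneg (hX.c_nonneg m) hΔ.le

/-- At the start of the timestep the estimates are trivial. -/
lemma Scheme.stepBound_zero (hX : X.IsAdmissible Λ Ω κ) (hn : X.IsNear T h c u0 us fs)
    (hc : 0 ≤ c) (hh : 0 ≤ h) (hΔ : 0 ≤ Δt) (hε : 0 < ε)
    (hu : ∀ σ ∈ dofs X.p T, u σ = us σ) (hf : ∀ σ ∈ dofs X.p T, f σ = fs σ) :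
    X.StepBound Λ T h Δt ε c u0 B us fs 0 u f := by
  have h0 : X.dt Δt 0 = 0 := by simp [Scheme.dt, hX.c_zero]
  refine ⟨hn.congr hu hf, fun σ hσ => ?_, fun σ hσ => ?_⟩
  · rw [hu σ hσ, h0, sub_self, zero_smul, add_zero, norm_zero]
    positivity
  · rw [hf σ hσ, h0, sub_self, zero_smul, add_zero, norm_zero]
    positivity

/-- All that is known about one timestep. -/
structure Scheme.StepContext (X : Scheme D q L S) (Ω : Set (Pt D)) (κ : ℝ)
    (𝒦 : Set (Fin q → ℝ)) (ρ G : ℝ) (T : Mesh D) (h Δt ε : ℝ)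
    (u0 : Pt D → Fin q → ℝ) (B : Pt D → Pt D →L[ℝ] (Fin L → ℝ)) (us : Pt D → Fin q → ℝ)
    (fs : Pt D → Fin L → ℝ) (u : ℕ → Fin (S + 1) → Pt D → Fin q → ℝ)
    (f : ℕ → Fin (S + 1) → Pt D → Fin L → ℝ) : Prop where
  regular : T.IsRegular Ω κ h
  ref : X.IsReference 𝒦 ρ G T h Δt u0 B
  eps_pos : 0 < ε
  step : X.IsStep ε T Δt us fs u f

/-- Estimates for the prediction. -/
lemma Scheme.IsAdmissible.exists_predict (hX : X.IsAdmissible Λ Ω κ)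
    (hM : X.IsSmooth Λ 𝒰 𝒦 ρ G) (hc : 0 ≤ c) : ∃ c', 0 ≤ c' ∧ ∃ h1 > 0,
    ∀ (T : Mesh D) (h Δt ε : ℝ) (u0 : Pt D → Fin q → ℝ) (B : Pt D → Pt D →L[ℝ] (Fin L → ℝ))
      (us : Pt D → Fin q → ℝ) (fs : Pt D → Fin L → ℝ)
      (u : ℕ → Fin (S + 1) → Pt D → Fin q → ℝ) (f : ℕ → Fin (S + 1) → Pt D → Fin L → ℝ),
      X.StepContext Ω κ 𝒦 ρ G T h Δt ε u0 B us fs u f → h ≤ h1 → X.IsNear T h c u0 us fs →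
      ∀ m, X.StepBound Λ T h Δt ε c' u0 B us fs m (u 1 m) (f 1 m) := by
  have hp := hX.one_le_p
  have hG1 := hM.one_le
  have hG : 0 ≤ G := zero_le_one.trans hG1
  have hρ := hM.rho_pos
  obtain ⟨C, hC0, h1, hh1, hC⟩ := hX.exists_norm_adv_sub_le hM hc
  -- `c1 h` and `c2 h` are the slow-variation constants of `u - u0` and `f - M(u0)` after the
  -- prediction; the constant returned also covers the increment bounds `G * C` and `C + 2 * G ^ 2 *
  -- c1 + c2`.
  set c1 : ℝ := G * c + G * (G * (G * G + 2 * C)) with hc1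
  set c2 : ℝ := c + G * (G * G + 2 * C) + 2 * G ^ 2 * c1 with hc2
  have hc1' : 0 ≤ c1 := by positivity
  have hc2' : 0 ≤ c2 := by positivity
  refine ⟨c + c2 + G * C + (C + 2 * G ^ 2 * c1 + c2), by positivity,
    min h1 (ρ / (2 * (c1 + 1))), by positivity, ?_⟩
  intro T h Δt ε u0 B us fs u f hctx hle hn m
  obtain ⟨hT, hR, hε, hs⟩ := hctx
  have hh := hR.h_pos
  have hΔ := hR.dt_pos
  rcases eq_or_ne m 0 with rfl | hm
  · refine (Scheme.stepBound_zero hX hn hc hh.le hΔ.le hε (hs.start_u 1) (hs.start_f 1)).mono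
      hh.le hΔ.le hε ?_
    have : 0 ≤ G * C := by positivity
    have : 0 ≤ C + 2 * G ^ 2 * c1 + c2 := by positivity
    linarith
  have hadv := hC T h Δt u0 B hT hR (hle.trans (min_le_left _ _)) fs hn.slow
  have hsm : c1 * h ≤ ρ / 2 := by
    have h2 := hle.trans (min_le_right _ _)
    rw [le_div_iff₀ (by positivity)] at h2
    linarith
  have hd0 := hX.dt_nonneg hΔ m
  have hd1 := hX.dt_le hΔ m
  have hd2 : X.dt Δt m ≤ G * h := hd1.trans hR.dt_le
  have slow_adv := slowNodal_adv hX hM hR hC0 hadv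
  have slow_dt_adv : SlowNodal X.p T h (G * (G * G + 2 * C) * h)
      fun σ => X.dt Δt m • X.adv T σ fs := by
    refine (slow_adv.smul (X.dt Δt m)).mono hh.le ?_
    rw [abs_of_nonneg hd0]
    calc X.dt Δt m * (G * G + 2 * C) ≤ G * h * (G * G + 2 * C) := by gcongr
      _ = _ := by ring
  have slow_u : SlowNodal X.p T h (c1 * h) fun σ => u 1 m σ - u0 σ := by
    have h2 := (hn.slow_u hp hM hR).sub (slow_dt_adv.mulVec hM)
    have e : G * c * h + G * (G * (G * G + 2 * C) * h) = c1 * h := by rw [hc1]; ring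
    rw [e] at h2
    refine h2.congr fun σ hσ => ?_
    rw [hs.predict_u m hm σ hσ, Matrix.mulVec_sub, hn.proj σ hσ]
    abel
  have slow_M := slow_u.maxw hp hM hR hc1' hsm
  obtain ⟨hα0, hα1⟩ := X.relax_mem hε hd0
  set α := X.relax ε Δt m with hα
  -- Both weights of the convex combination lie in `[0, 1]`, so `ε` drops out.
  have slow_f : SlowNodal X.p T h (c2 * h) fun σ => f 1 m σ - X.maxw (u0 σ) := by
    have h2 := ((hn.slow.sub slow_dt_adv).smul_le hh.le (by positivity) hα0 hα1).add
      (slow_M.smul_le hh.le (by positivity) (sub_nonneg.2 hα1) (sub_le_self 1 hα0))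
    have e : c * h + G * (G * G + 2 * C) * h + 2 * G ^ 2 * c1 * h = c2 * h := by rw [hc2]; ring
    rw [e] at h2
    refine h2.congr fun σ hσ => ?_
    rw [hs.predict_f m hm σ hσ]
    module
  have hmemU : ∀ σ ∈ dofs X.p T, u 1 m σ ∈ 𝒰 := fun σ hσ =>
    hM.mem_of_dist (hR.mem_dofs hp hσ) ((slow_u.1 σ hσ).trans (by linarith))
  have incu : ∀ σ ∈ dofs X.p T,
      ‖u 1 m σ - us σ + X.dt Δt m • (X.P *ᵥ fluxDeriv Λ B σ)‖ ≤ G * C * Δt * h := by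
    intro σ hσ
    have e : u 1 m σ - us σ + X.dt Δt m • (X.P *ᵥ fluxDeriv Λ B σ) =
        -(X.dt Δt m • (X.P *ᵥ (X.adv T σ fs - fluxDeriv Λ B σ))) := by
      rw [hs.predict_u m hm σ hσ, Matrix.mulVec_sub, Matrix.mulVec_sub, Matrix.mulVec_smul,
        hn.proj σ hσ]
      module
    rw [e, norm_neg, norm_smul, Real.norm_of_nonneg hd0]
    calc _ ≤ Δt * (G * (C * h)) := by
          refine mul_le_mul hd1 ?_ (norm_nonneg _) hΔ.le
          exact (hM.norm_P _).trans (mul_le_mul_of_nonneg_left (hadv σ hσ) hG)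
      _ = _ := by ring
  have incf : ∀ σ ∈ dofs X.p T, ‖f 1 m σ - fs σ + X.dt Δt m • fluxDeriv Λ B σ‖ ≤
      (C + 2 * G ^ 2 * c1 + c2) * Δt * (h + h / ε) := by
    intro σ hσ
    have hne : ε + X.dt Δt m ≠ 0 := by positivity
    have e1 := relax_predict hε.ne' hne (hs.predict_f m hm σ hσ)
    have e : f 1 m σ - fs σ + X.dt Δt m • fluxDeriv Λ B σ =
        (X.dt Δt m / ε) • (X.maxw (u 1 m σ) - f 1 m σ) -
          X.dt Δt m • (X.adv T σ fs - fluxDeriv Λ B σ) := by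
      rw [← e1]
      module
    have b1 : ‖X.maxw (u 1 m σ) - f 1 m σ‖ ≤ 2 * G ^ 2 * c1 * h + c2 * h := by
      have h2 := norm_sub_le (X.maxw (u 1 m σ) - X.maxw (u0 σ)) (f 1 m σ - X.maxw (u0 σ))
      rw [sub_sub_sub_cancel_right] at h2
      exact h2.trans (add_le_add (slow_M.1 σ hσ) (slow_f.1 σ hσ))
    rw [e]
    refine (norm_sub_le _ _).trans ?_
    rw [norm_smul, norm_smul, Real.norm_of_nonneg hd0,
      Real.norm_of_nonneg (div_nonneg hd0 hε.le)]
    calc _ ≤ Δt / ε * (2 * G ^ 2 * c1 * h + c2 * h) + Δt * (C * h) := by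
          gcongr
          exact hadv σ hσ
      _ = (2 * G ^ 2 * c1 + c2) * Δt * (h / ε) + C * Δt * h := by ring
      _ ≤ (C + 2 * G ^ 2 * c1 + c2) * Δt * (h / ε) + (C + 2 * G ^ 2 * c1 + c2) * Δt * h := by
          have : 0 ≤ 2 * G ^ 2 * c1 := by positivity
          gcongr <;> linarith
      _ = _ := by ring
  have hGC : 0 ≤ G * C := by positivity
  have hc3 : 0 ≤ C + 2 * G ^ 2 * c1 + c2 := by positivity
  refine ⟨⟨fun σ hσ => ?_, slow_f.mono hh.le ?_⟩, fun σ hσ => (incu σ hσ).trans ?_,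
    fun σ hσ => (incf σ hσ).trans ?_⟩
  · rw [hs.predict_f m hm σ hσ, Matrix.mulVec_add, Matrix.mulVec_smul, Matrix.mulVec_smul,
      hM.proj _ (hmemU σ hσ), ← hs.predict_u m hm σ hσ]
    module
  · exact mul_le_mul_of_nonneg_right (by linarith) hh.le
  · exact mul_le_mul_of_nonneg_right (mul_le_mul_of_nonneg_right (by linarith) hΔ.le) hh.le
  · exact mul_le_mul_of_nonneg_right (mul_le_mul_of_nonneg_right (by linarith) hΔ.le)
      (by positivity)

end Step

end

section

/-! ### Estimates for one correction -/

section Correct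

variable {D q L S : ℕ}
variable {X : Scheme D q L S} {Λ : Fin D → Fin L → ℝ} {Ω : Set (Pt D)} {κ : ℝ}
  {𝒰 𝒦 : Set (Fin q → ℝ)} {ρ G : ℝ} {T : Mesh D} {h Δt ε c : ℝ} {u0 : Pt D → Fin q → ℝ}
  {B : Pt D → Pt D →L[ℝ] (Fin L → ℝ)} {us : Pt D → Fin q → ℝ} {fs : Pt D → Fin L → ℝ}
  {u : ℕ → Fin (S + 1) → Pt D → Fin q → ℝ} {f : ℕ → Fin (S + 1) → Pt D → Fin L → ℝ}

/-- Splits the time quadrature into the exact contribution `Δt^m b` of a fixed value `b` and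
deviations from it, which are `O(h)` for the advection residuals. -/
lemma Scheme.IsAdmissible.smul_sum_weight (hX : X.IsAdmissible Λ Ω κ) {V : Type}
    [AddCommGroup V] [Module ℝ V] (Δt : ℝ) (m : Fin (S + 1)) (a : Fin (S + 1) → V) (b : V) :
    Δt • ∑ j, X.weight m j • a j = Δt • ∑ j, X.weight m j • (a j - b) + X.dt Δt m • b := by
  simp_rw [smul_sub]
  rw [Finset.sum_sub_distrib, ← Finset.sum_smul,
    X.sum_weight hX.strictMono_c m, Scheme.dt]
  module

lemma Scheme.IsSmooth.norm_sum_weight_le (hM : X.IsSmooth Λ 𝒰 𝒦 ρ G) {V : Type}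
    [NormedAddCommGroup V] [NormedSpace ℝ V] {m : Fin (S + 1)} {a : Fin (S + 1) → V} {s : ℝ}
    (hs : 0 ≤ s) (ha : ∀ j, ‖a j‖ ≤ s) : ‖∑ j, X.weight m j • a j‖ ≤ G * s := by
  refine (norm_sum_le_of_le (f := fun j => X.weight m j • a j) (n := fun j => |X.weight m j| * s)
    _ fun j _ => ?_).trans ?_
  · rw [norm_smul]
    exact mul_le_mul_of_nonneg_left (ha j) (abs_nonneg _)
  · rw [← Finset.sum_mul]
    exact mul_le_mul_of_nonneg_right (hM.norm_weight m) hs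

/-- The increments of the macroscopic variable in a correction. -/
lemma Scheme.StepContext.correct_inc_u
    (hctx : X.StepContext Ω κ 𝒦 ρ G T h Δt ε u0 B us fs u f) (hX : X.IsAdmissible Λ Ω κ)
    (hM : X.IsSmooth Λ 𝒰 𝒦 ρ G) (hc : 0 ≤ c) {C : ℝ} (hC : 0 ≤ C) {k : ℕ} (hk : 1 ≤ k)
    (hk' : k < X.iters)
    (hadv : ∀ j, ∀ σ ∈ dofs X.p T, ‖X.adv T σ (f k j) - fluxDeriv Λ B σ‖ ≤ C * h)
    (hb : ∀ m, X.StepBound Λ T h Δt ε c u0 B us fs m (u k m) (f k m))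
    {m : Fin (S + 1)} (hm : m ≠ 0) {σ : Pt D} (hσ : σ ∈ dofs X.p T) :
    ‖u (k + 1) m σ - us σ + X.dt Δt m • (X.P *ᵥ fluxDeriv Λ B σ)‖ ≤
      (G * (G * G) + 2 * c + G * (G * C)) * Δt * h := by
  obtain ⟨hT, hR, hε, hs⟩ := hctx
  have hp := hX.one_le_p
  have hG : 0 ≤ G := zero_le_one.trans hM.one_le
  have hh := hR.h_pos
  have hΔ := hR.dt_pos
  have hd0 := hX.dt_nonneg hΔ m
  have hd1 := hX.dt_le hΔ m
  set z := u k m - u k 0 with hz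
  -- The increment is a smooth drift of order `Δt` plus an error `O(Δt h)`, so it varies slowly with
  -- a constant of order `Δt`; replacing its cell average by its nodal value costs `O(Δt h)`.
  have slow_z : SlowNodal X.p T h (Δt * (G * (G * G)) + 2 * (c * Δt)) z := by
    have h1 : SlowNodal X.p T h (Δt * (G * (G * G)))
        fun σ => X.dt Δt m • (X.P *ᵥ fluxDeriv Λ B σ) :=
      (((slowNodal_fluxDeriv hp hM hR).mulVec hM).smul _).mono hh.le (by
        rw [abs_of_nonneg hd0]; gcongr)
    have h2 : SlowNodal X.p T h (2 * (c * Δt))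
        fun σ => u k m σ - us σ + X.dt Δt m • (X.P *ᵥ fluxDeriv Λ B σ) :=
      SlowNodal.of_small hR.h_le (by positivity) (hb m).inc_u
    refine (h1.neg.add h2).congr fun σ hσ => ?_
    rw [hz, Pi.sub_apply, hs.start_u k σ hσ]
    abel
  have havg := slow_z.norm_cellAvg_sub_le hp (hX.cellVol_pos hT hσ)
  have hsum : ‖∑ j, X.weight m j • (X.P *ᵥ X.adv T σ (f k j) - X.P *ᵥ fluxDeriv Λ B σ)‖ ≤
      G * (G * (C * h)) := by
    refine hM.norm_sum_weight_le (by positivity) fun j => ?_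
    rw [← Matrix.mulVec_sub]
    exact (hM.norm_P _).trans (mul_le_mul_of_nonneg_left (hadv j σ hσ) hG)
  -- The old value `u k m σ` cancels against `z σ`: the correction forgets it up to the error of
  -- mass lumping.
  have e : u (k + 1) m σ - us σ + X.dt Δt m • (X.P *ᵥ fluxDeriv Λ B σ) =
      -(cellAvg X.p T σ (fun K => interp X.p K z) - z σ) -
      Δt • ∑ j, X.weight m j • (X.P *ᵥ X.adv T σ (f k j) - X.P *ᵥ fluxDeriv Λ B σ) := by
    rw [hs.correct_u k hk hk' m hm σ hσ,
      hX.smul_sum_weight Δt m (fun j => X.P *ᵥ X.adv T σ (f k j)) (X.P *ᵥ fluxDeriv Λ B σ),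
      ← hs.start_u k σ hσ, show z σ = u k m σ - u k 0 σ from rfl]
    abel
  rw [e]
  refine (norm_sub_le _ _).trans ?_
  rw [norm_neg, norm_smul, Real.norm_of_nonneg hΔ.le]
  have := mul_le_mul_of_nonneg_left hsum hΔ.le
  linarith

/-- A correction preserves `u = P f`. -/
lemma Scheme.StepContext.correct_proj
    (hctx : X.StepContext Ω κ 𝒦 ρ G T h Δt ε u0 B us fs u f) (hX : X.IsAdmissible Λ Ω κ)
    (hM : X.IsSmooth Λ 𝒰 𝒦 ρ G) (hch : (G * c + G) * h ≤ ρ) {k : ℕ} (hk : 1 ≤ k)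
    (hk' : k < X.iters) (hb : ∀ m, X.IsNear T h c u0 (u k m) (f k m))
    {m : Fin (S + 1)} (hm : m ≠ 0) {σ : Pt D} (hσ : σ ∈ dofs X.p T) (hu : u k m σ ∈ 𝒰)
    (hu' : u (k + 1) m σ ∈ 𝒰) : X.P *ᵥ f (k + 1) m σ = u (k + 1) m σ := by
  obtain ⟨hT, hR, hε, hs⟩ := hctx
  have hp := hX.one_le_p
  have h1 : ∑ j, X.weight m j • (X.P *ᵥ X.source T σ (f k j)) = 0 :=
    Finset.sum_eq_zero fun j _ => by rw [(hb j).proj_source hX hT hM hR hch hσ, smul_zero]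
  have h2 : X.P *ᵥ cellAvg X.p T σ (fun K => interp X.p K (f k m - f k 0)) =
      cellAvg X.p T σ (fun K => interp X.p K (u k m - u k 0)) := by
    rw [mulVec_cellAvg hp X.P fun K hK => continuous_interp (isSimplex_of_mem_elems hK) _ _]
    simp_rw [← interp_mulVec]
    refine cellAvg_congr T σ id fun τ hτ => ?_
    rw [Pi.sub_apply, Pi.sub_apply, Matrix.mulVec_sub, (hb m).proj τ hτ, (hb 0).proj τ hτ]
  have h3 := hs.correct_u k hk hk' m hm σ hσ
  rw [hs.correct_f k hk hk' m hm σ hσ, Matrix.mulVec_add, Matrix.mulVec_sub, Matrix.mulVec_add,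
    Matrix.mulVec_smul, Matrix.mulVec_smul, Matrix.mulVec_smul, Matrix.mulVec_sub,
    Matrix.mulVec_add, Matrix.mulVec_smul, Matrix.mulVec_sum, Matrix.mulVec_sum, h2,
    hM.proj _ hu, hM.proj _ hu', (hb m).proj σ hσ]
  simp only [Matrix.mulVec_smul]
  rw [h1, h3]
  module

/-- Estimates for a correction. -/
lemma Scheme.IsAdmissible.exists_correct (hX : X.IsAdmissible Λ Ω κ)
    (hM : X.IsSmooth Λ 𝒰 𝒦 ρ G) (hc : 0 ≤ c) : ∃ c', 0 ≤ c' ∧ ∃ h1 > 0,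
    ∀ (T : Mesh D) (h Δt ε : ℝ) (u0 : Pt D → Fin q → ℝ) (B : Pt D → Pt D →L[ℝ] (Fin L → ℝ))
      (us : Pt D → Fin q → ℝ) (fs : Pt D → Fin L → ℝ)
      (u : ℕ → Fin (S + 1) → Pt D → Fin q → ℝ) (f : ℕ → Fin (S + 1) → Pt D → Fin L → ℝ),
      X.StepContext Ω κ 𝒦 ρ G T h Δt ε u0 B us fs u f → h ≤ h1 → X.IsNear T h c u0 us fs →
      ∀ k, 1 ≤ k → k < X.iters → (∀ m, X.StepBound Λ T h Δt ε c u0 B us fs m (u k m) (f k m)) →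
      ∀ m, X.StepBound Λ T h Δt ε c' u0 B us fs m (u (k + 1) m) (f (k + 1) m) := by
  have hp := hX.one_le_p
  have hG1 := hM.one_le
  have hG : 0 ≤ G := zero_le_one.trans hG1
  have hρ := hM.rho_pos
  obtain ⟨C, hC0, h1, hh1, hC⟩ := hX.exists_norm_adv_sub_le hM hc
  -- `c3` is for the increments of `u`, `c1` for `u - u0`, `Cs` for the averaged source, `c2` for `f
  -- - M(u0)`, and `c4` for the increments of `f`.
  obtain ⟨c3, hc3⟩ : ∃ c3, c3 = G * (G * G) + 2 * c + G * (G * C) := ⟨_, rfl⟩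
  obtain ⟨c1, hc1⟩ : ∃ c1, c1 = G * c + G * (G * (G * G)) + 2 * (c3 * G) := ⟨_, rfl⟩
  obtain ⟨Cs, hCs⟩ : ∃ Cs, Cs = 2 * G ^ 2 * (G * c) + c +
    2 * (G ^ 3 * c + (G ^ 2 + 1) * (c + 2 * G)) := ⟨_, rfl⟩
  obtain ⟨c2, hc2⟩ : ∃ c2, c2 = c + (2 * G ^ 2 * c1 + 2 * G ^ 2 * (G * c)) +
    (3 * (c + c) + G * (G * (G * G + 2 * C))) + G * (G * Cs) := ⟨_, rfl⟩
  obtain ⟨c4, hc4⟩ : ∃ c4, c4 = G * G + 2 * c + G * C + (2 * G ^ 2 * c1 + c2) +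
    (2 * G ^ 2 * (G * c) + c) + G * Cs := ⟨_, rfl⟩
  have hc3' : 0 ≤ c3 := by rw [hc3]; positivity
  have hc1' : 0 ≤ c1 := by rw [hc1]; positivity
  have hCs' : 0 ≤ Cs := by rw [hCs]; positivity
  have hc2' : 0 ≤ c2 := by rw [hc2]; positivity
  have hc4' : 0 ≤ c4 := by rw [hc4]; positivity
  refine ⟨c + c2 + c3 + c4, by positivity,
    min h1 (ρ / (2 * (c1 + (G * c + G) + 1))), by positivity, ?_⟩
  intro T h Δt ε u0 B us fs u f hctx hle hn k hk hk' hb m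
  obtain ⟨hT, hR, hε, hs⟩ := id hctx
  have hh := hR.h_pos
  have hΔ := hR.dt_pos
  rcases eq_or_ne m 0 with rfl | hm
  · exact (Scheme.stepBound_zero hX hn hc hh.le hΔ.le hε (hs.start_u _) (hs.start_f _)).mono
      hh.le hΔ.le hε (by linarith)
  have hadv : ∀ j, ∀ σ ∈ dofs X.p T, ‖X.adv T σ (f k j) - fluxDeriv Λ B σ‖ ≤ C * h :=
    fun j => hC T h Δt u0 B hT hR (hle.trans (min_le_left _ _)) (f k j) (hb j).near.slow
  have hsm : (c1 + (G * c + G)) * h ≤ ρ / 2 := by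
    have h2 := hle.trans (min_le_right _ _)
    rw [le_div_iff₀ (by positivity)] at h2
    linarith
  have hcG : 0 ≤ G * c * h := by positivity
  have hGh : 0 ≤ G * h := by positivity
  have hc1h : 0 ≤ c1 * h := by positivity
  have hsm1 : c1 * h ≤ ρ / 2 := by linarith
  have hsm2 : G * c * h ≤ ρ / 2 := by linarith
  have hsm3 : (G * c + G) * h ≤ ρ := by linarith
  have hd0 := hX.dt_nonneg hΔ m
  have hd1 := hX.dt_le hΔ m
  have hd2 : X.dt Δt m ≤ G * h := hd1.trans hR.dt_le
  have incu : ∀ σ ∈ dofs X.p T,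
      ‖u (k + 1) m σ - us σ + X.dt Δt m • (X.P *ᵥ fluxDeriv Λ B σ)‖ ≤ c3 * Δt * h :=
    fun σ hσ => by
      rw [hc3]
      exact hctx.correct_inc_u hX hM hc hC0 hk hk' hadv hb hm hσ
  have slow_u : SlowNodal X.p T h (c1 * h) fun σ => u (k + 1) m σ - u0 σ := by
    have s1 : SlowNodal X.p T h (G * (G * (G * G)) * h)
        fun σ => X.dt Δt m • (X.P *ᵥ fluxDeriv Λ B σ) :=
      (((slowNodal_fluxDeriv hp hM hR).mulVec hM).smul _).mono hh.le (by
        rw [abs_of_nonneg hd0]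
        calc X.dt Δt m * (G * (G * G)) ≤ G * h * (G * (G * G)) := by gcongr
          _ = _ := by ring)
    have s2 : SlowNodal X.p T h (2 * (c3 * G * h))
        fun σ => u (k + 1) m σ - us σ + X.dt Δt m • (X.P *ᵥ fluxDeriv Λ B σ) := by
      refine SlowNodal.of_small hR.h_le (by positivity) fun σ hσ => (incu σ hσ).trans ?_
      calc c3 * Δt * h ≤ c3 * (G * h) * h := by gcongr; exact hR.dt_le
        _ = _ := by ring
    have s3 := ((hn.slow_u hp hM hR).sub s1).add s2
    have e : G * c * h + G * (G * (G * G)) * h + 2 * (c3 * G * h) = c1 * h := by rw [hc1]; ring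
    rw [e] at s3
    exact s3.congr fun σ _ => by abel
  have slow_M' := slow_u.maxw hp hM hR hc1' hsm1
  have slow_M := ((hb m).near.slow_u hp hM hR).maxw hp hM hR (by positivity) hsm2
  have slow_y : SlowNodal X.p T h (c * h + c * h) (f k m - f k 0) :=
    ((hb m).near.slow.sub (hb 0).near.slow).congr fun σ _ => sub_sub_sub_cancel_right _ _ _
  have slow_avg := slow_y.cellAvg hp (fun σ hσ => hX.cellVol_pos hT hσ) (by positivity) hR.h_le
  have slow_source : SlowNodal X.p T h (G * (Cs * h))
      fun σ => ∑ j, X.weight m j • X.source T σ (f k j) :=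
    (SlowNodal.sum Finset.univ fun j _ => by
      have := (hb j).near.slow_source hX hT hM hR hc hsm2
      rwa [← hCs] at this).mono hh.le
      (mul_le_mul_of_nonneg_right (hM.norm_weight m) (by positivity))
  have slow_adv : SlowNodal X.p T h (G * h * (G * (G * G + 2 * C)))
      fun σ => Δt • ∑ j, X.weight m j • X.adv T σ (f k j) := by
    refine ((SlowNodal.sum Finset.univ fun j _ =>
      slowNodal_adv hX hM hR hC0 (hadv j)).smul Δt).mono hh.le ?_
    rw [abs_of_pos hΔ]
    have := hM.norm_weight m
    have := hR.dt_le
    gcongr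
  obtain ⟨hα0, hα1⟩ := X.relax_mem hε hd0
  set α := X.relax ε Δt m with hα
  -- The coefficient of the source is at most `1 / c_m` for every `ε`; here `m ≠ 0` matters.
  have hβ : Δt / (ε + X.dt Δt m) ≤ G := by
    refine le_trans ?_ (hM.inv_c m hm)
    have hcm := hX.c_pos hm
    rw [div_le_iff₀ (by positivity), ← div_eq_inv_mul, le_div_iff₀ hcm, Scheme.dt]
    linarith
  have hβ0 : 0 ≤ Δt / (ε + X.dt Δt m) := by positivity
  have slow_f : SlowNodal X.p T h (c2 * h) fun σ => f (k + 1) m σ - X.maxw (u0 σ) := by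
    have s1 := (slow_M'.sub slow_M).smul_le hh.le (by positivity) (sub_nonneg.2 hα1)
      (sub_le_self 1 hα0)
    have s2 := (slow_avg.add slow_adv).smul_le hh.le (by positivity) hα0 hα1
    have s3 : SlowNodal X.p T h (G * (G * (Cs * h))) _ :=
      (slow_source.smul (Δt / (ε + X.dt Δt m))).mono hh.le (by
        rw [abs_of_nonneg hβ0]
        gcongr)
    have s4 := (((hb m).near.slow.add s1).sub s2).add s3
    have e : c * h + (2 * G ^ 2 * c1 * h + 2 * G ^ 2 * (G * c) * h) +
        (3 * (c * h + c * h) + G * h * (G * (G * G + 2 * C))) + G * (G * (Cs * h)) = c2 * h := by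
      rw [hc2]; ring
    rw [e] at s4
    refine s4.congr fun σ hσ => ?_
    rw [hs.correct_f k hk hk' m hm σ hσ]
    module
  have incf : ∀ σ ∈ dofs X.p T, ‖f (k + 1) m σ - fs σ + X.dt Δt m • fluxDeriv Λ B σ‖ ≤
      c4 * Δt * (h + h / ε) := by
    intro σ hσ
    have hne : ε + X.dt Δt m ≠ 0 := by positivity
    have e1 := relax_correct hε.ne' hne (hs.correct_f k hk hk' m hm σ hσ)
    -- The bound `slow_y` is free of `ε` but of order `h`, useless after division by a `Δt` that may
    -- be much smaller than `h`. This one has the factor `Δt`, at the price of `1 / ε`.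
    have slow_y' : SlowNodal X.p T h (Δt * (G * G) + 2 * (c * Δt * (1 + 1 / ε)))
        (f k m - f k 0) := by
      have s1 : SlowNodal X.p T h (Δt * (G * G)) fun σ => X.dt Δt m • fluxDeriv Λ B σ :=
        ((slowNodal_fluxDeriv hp hM hR).smul _).mono hh.le (by
          rw [abs_of_nonneg hd0]; gcongr)
      have s2 : SlowNodal X.p T h (2 * (c * Δt * (1 + 1 / ε)))
          fun σ => f k m σ - fs σ + X.dt Δt m • fluxDeriv Λ B σ :=
        SlowNodal.of_small hR.h_le (by positivity) fun σ hσ =>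
          ((hb m).inc_f σ hσ).trans (le_of_eq (by ring))
      refine (s1.neg.add s2).congr fun σ hσ => ?_
      rw [Pi.sub_apply, hs.start_f k σ hσ]
      abel
    have b1 := slow_y'.norm_cellAvg_sub_le hp (hX.cellVol_pos hT hσ)
    have b2 : ‖∑ j, X.weight m j • (X.adv T σ (f k j) - fluxDeriv Λ B σ)‖ ≤ G * (C * h) :=
      hM.norm_sum_weight_le (by positivity) fun j => hadv j σ hσ
    have b3 : ‖X.maxw (u (k + 1) m σ) - f (k + 1) m σ‖ ≤ 2 * G ^ 2 * c1 * h + c2 * h := by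
      have h2 := norm_sub_le (X.maxw (u (k + 1) m σ) - X.maxw (u0 σ))
        (f (k + 1) m σ - X.maxw (u0 σ))
      rw [sub_sub_sub_cancel_right] at h2
      exact h2.trans (add_le_add (slow_M'.1 σ hσ) (slow_f.1 σ hσ))
    have b4 := ((hb m).near.slow_relax hX hM hR hc hsm2).1 σ hσ
    have b5 := slow_source.1 σ hσ
    -- Increment form by `relax_correct`: the new and the old relaxation term and the averaged
    -- source each carry `1 / ε`, and each is `O(h)`.
    have e : f (k + 1) m σ - fs σ + X.dt Δt m • fluxDeriv Λ B σ =
        -(cellAvg X.p T σ (fun K => interp X.p K (f k m - f k 0)) - (f k m - f k 0) σ) -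
        Δt • ∑ j, X.weight m j • (X.adv T σ (f k j) - fluxDeriv Λ B σ) +
        (X.dt Δt m / ε) • (X.maxw (u (k + 1) m σ) - f (k + 1) m σ) -
        (X.dt Δt m / ε) • (X.maxw (u k m σ) - f k m σ) +
        (Δt / ε) • ∑ j, X.weight m j • X.source T σ (f k j) := by
      have e2 : f (k + 1) m σ = f k m σ + (f (k + 1) m σ - f k m σ) := by abel
      rw [hX.smul_sum_weight Δt m (fun j => X.adv T σ (f k j)) (fluxDeriv Λ B σ)] at e1
      rw [Pi.sub_apply, hs.start_f k σ hσ]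
      calc _ = (f (k + 1) m σ - f k m σ) + (f k m σ - fs σ) +
            X.dt Δt m • fluxDeriv Λ B σ := by abel
        _ = _ := by rw [e1]; abel
    rw [e]
    refine (norm_add_le _ _).trans ((add_le_add_left ((norm_sub_le _ _).trans
      (add_le_add_left ((norm_add_le _ _).trans (add_le_add_left
        (norm_sub_le _ _) _)) _)) _).trans ?_)
    have hdε : X.dt Δt m / ε ≤ Δt / ε := by gcongr
    have hdε0 : 0 ≤ X.dt Δt m / ε := div_nonneg hd0 hε.le
    rw [norm_neg, norm_smul, norm_smul, norm_smul, norm_smul, Real.norm_of_nonneg hΔ.le,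
      Real.norm_of_nonneg hdε0, Real.norm_of_nonneg (div_nonneg hΔ.le hε.le)]
    have a2 := mul_le_mul_of_nonneg_left b2 hΔ.le
    have a3 := mul_le_mul hdε b3 (norm_nonneg _) (div_nonneg hΔ.le hε.le)
    have a4 := mul_le_mul hdε b4 (norm_nonneg _) (div_nonneg hΔ.le hε.le)
    have a5 := mul_le_mul_of_nonneg_left b5 (div_nonneg hΔ.le hε.le)
    calc _ ≤ (Δt * (G * G) + 2 * (c * Δt * (1 + 1 / ε))) * h + Δt * (G * (C * h)) +
          Δt / ε * (2 * G ^ 2 * c1 * h + c2 * h) +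
          Δt / ε * ((2 * G ^ 2 * (G * c) + c) * h) + Δt / ε * (G * (Cs * h)) := by linarith
      _ = c4 * Δt * (h + h / ε) - ((G * G + G * C) * (Δt * (h / ε)) +
          (2 * G ^ 2 * c1 + c2 + (2 * G ^ 2 * (G * c) + c) + G * Cs) * (Δt * h)) := by
        rw [hc4]; ring
      _ ≤ _ := sub_le_self _ (by positivity)
  have memU : ∀ σ ∈ dofs X.p T, u (k + 1) m σ ∈ 𝒰 := fun σ hσ =>
    hM.mem_of_dist (hR.mem_dofs hp hσ) ((slow_u.1 σ hσ).trans (by linarith))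
  have memU' : ∀ σ ∈ dofs X.p T, u k m σ ∈ 𝒰 := fun σ hσ =>
    hM.mem_of_dist (hR.mem_dofs hp hσ)
      ((((hb m).near.slow_u hp hM hR).1 σ hσ).trans (by linarith))
  refine ⟨⟨fun σ hσ => ?_, slow_f.mono hh.le ?_⟩, fun σ hσ => (incu σ hσ).trans ?_,
    fun σ hσ => (incf σ hσ).trans ?_⟩
  · exact hctx.correct_proj hX hM hsm3 hk hk' (fun j => (hb j).near) hm hσ (memU' σ hσ)
      (memU σ hσ)
  · exact mul_le_mul_of_nonneg_right (by linarith) hh.le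
  · exact mul_le_mul_of_nonneg_right (mul_le_mul_of_nonneg_right (by linarith) hΔ.le) hh.le
  · exact mul_le_mul_of_nonneg_right (mul_le_mul_of_nonneg_right (by linarith) hΔ.le)
      (by positivity)

end Correct

end

section

/-! ### Iteration over corrections and timesteps; initial data -/

section Iterate

variable {D q L S : ℕ}
variable {X : Scheme D q L S} {Λ : Fin D → Fin L → ℝ} {Ω : Set (Pt D)} {κ : ℝ}
  {𝒰 𝒦 : Set (Fin q → ℝ)} {ρ G c : ℝ}

/-- Estimates for all iterations of one timestep. -/
lemma Scheme.IsAdmissible.exists_stepBound (hX : X.IsAdmissible Λ Ω κ)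
    (hM : X.IsSmooth Λ 𝒰 𝒦 ρ G) (hc : 0 ≤ c) (i : ℕ) : ∃ c', c ≤ c' ∧ ∃ h1 > 0,
    ∀ (T : Mesh D) (h Δt ε : ℝ) (u0 : Pt D → Fin q → ℝ) (B : Pt D → Pt D →L[ℝ] (Fin L → ℝ))
      (us : Pt D → Fin q → ℝ) (fs : Pt D → Fin L → ℝ)
      (u : ℕ → Fin (S + 1) → Pt D → Fin q → ℝ) (f : ℕ → Fin (S + 1) → Pt D → Fin L → ℝ),
      X.StepContext Ω κ 𝒦 ρ G T h Δt ε u0 B us fs u f → h ≤ h1 → X.IsNear T h c u0 us fs →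
      ∀ k, 1 ≤ k → k ≤ i → k ≤ X.iters →
        ∀ m, X.StepBound Λ T h Δt ε c' u0 B us fs m (u k m) (f k m) := by
  induction i with
  | zero => exact ⟨c, le_rfl, 1, one_pos, fun _ _ _ _ _ _ _ _ _ _ _ _ _ k h1 h2 => by omega⟩
  | succ i ih =>
    obtain ⟨c1, hc1, h1, hh1, H1⟩ := ih
    rcases Nat.eq_zero_or_pos i with rfl | hi
    · obtain ⟨c2, hc2, h2, hh2, H2⟩ := hX.exists_predict hM hc
      refine ⟨c + c2, by linarith, h2, hh2, fun T h Δt ε u0 B us fs u f hctx hle hn k k1 k2 _ m => ?_⟩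
      obtain rfl : k = 1 := by omega
      exact (H2 T h Δt ε u0 B us fs u f hctx hle hn m).mono hctx.ref.h_pos.le hctx.ref.dt_pos.le
        hctx.eps_pos (by linarith)
    · obtain ⟨c2, hc2, h2, hh2, H2⟩ := hX.exists_correct hM (hc.trans hc1)
      refine ⟨c1 + c2, by linarith, min h1 h2, lt_min hh1 hh2,
        fun T h Δt ε u0 B us fs u f hctx hle hn k k1 k2 k3 m => ?_⟩
      have hb := H1 T h Δt ε u0 B us fs u f hctx (hle.trans (min_le_left _ _)) hn
      have hh := hctx.ref.h_pos.le
      have hΔ := hctx.ref.dt_pos.le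
      rcases Nat.lt_or_ge i k with hik | hik
      · obtain rfl : k = i + 1 := by omega
        exact (H2 T h Δt ε u0 B us fs u f hctx (hle.trans (min_le_right _ _)) (hn.mono hh hc1)
          i hi (by omega) (hb i hi le_rfl (by omega)) m).mono hh hΔ hctx.eps_pos
          (by linarith)
      · exact (hb k k1 hik k3 m).mono hh hΔ hctx.eps_pos (by linarith)

/-- Estimates for a number of timesteps. -/
lemma Scheme.IsAdmissible.exists_runBound (hX : X.IsAdmissible Λ Ω κ)
    (hM : X.IsSmooth Λ 𝒰 𝒦 ρ G) (hc : 0 ≤ c) (N : ℕ) : ∃ c', c ≤ c' ∧ ∃ h1 > 0,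
    ∀ (T : Mesh D) (h Δt ε : ℝ) (u0 : Pt D → Fin q → ℝ) (B : Pt D → Pt D →L[ℝ] (Fin L → ℝ))
      (U0 : Pt D → Fin q → ℝ) (u : History D q S) (f : History D L S), T.IsRegular Ω κ h →
      X.IsReference 𝒦 ρ G T h Δt u0 B → 0 < ε → h ≤ h1 → X.IsRun ε T Δt U0 u f →
      X.IsNear T h c u0 U0 (fun σ => X.maxw (U0 σ)) → ∀ n ≤ N, ∀ k, 1 ≤ k → k ≤ X.iters →
      ∀ m, X.StepBound Λ T h Δt ε c' u0 B (u n k 0) (f n k 0) m (u n k m) (f n k m) := by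
  -- The estimates refer to the start values of the timestep; those stored with iteration `k` agree
  -- with them at the degrees of freedom only.
  have start : ∀ {c' : ℝ} {T : Mesh D} {h Δt ε : ℝ} {u0 : Pt D → Fin q → ℝ}
      {B : Pt D → Pt D →L[ℝ] (Fin L → ℝ)} {us : Pt D → Fin q → ℝ} {fs : Pt D → Fin L → ℝ}
      {u : ℕ → Fin (S + 1) → Pt D → Fin q → ℝ} {f : ℕ → Fin (S + 1) → Pt D → Fin L → ℝ}
      {k : ℕ} {m : Fin (S + 1)}, X.StepContext Ω κ 𝒦 ρ G T h Δt ε u0 B us fs u f →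
      X.StepBound Λ T h Δt ε c' u0 B us fs m (u k m) (f k m) →
      X.StepBound Λ T h Δt ε c' u0 B (u k 0) (f k 0) m (u k m) (f k m) := by
    intro c' T h Δt ε u0 B us fs u f k m hctx hb
    refine ⟨hb.near, fun σ hσ => ?_, fun σ hσ => ?_⟩
    · rw [hctx.step.start_u k σ hσ]
      exact hb.inc_u σ hσ
    · rw [hctx.step.start_f k σ hσ]
      exact hb.inc_f σ hσ
  induction N with
  | zero =>
    obtain ⟨c1, hc1, h1, hh1, H1⟩ := hX.exists_stepBound hM hc X.iters
    refine ⟨c1, hc1, h1, hh1, fun T h Δt ε u0 B U0 u f hT hR hε hle hr hn n hn0 k k1 k2 m => ?_⟩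
    obtain rfl : n = 0 := by omega
    have hctx : X.StepContext Ω κ 𝒦 ρ G T h Δt ε u0 B _ _ (u 0) (f 0) :=
      ⟨hT, hR, hε, hX.isStep_of_isRun hT hR.dt_pos hε hr 0⟩
    exact start hctx (H1 T h Δt ε u0 B _ _ _ _ hctx hle (hn.congr (hr.init_u 1) (hr.init_f 1))
      k k1 k2 k2 m)
  | succ N ih =>
    obtain ⟨c1, hc1, h1, hh1, H1⟩ := ih
    -- The constant reached after `N` timesteps serves as start constant of the next one. It may
    -- grow with each timestep, which is harmless as their number is fixed.
    obtain ⟨c2, hc2, h2, hh2, H2⟩ := hX.exists_stepBound hM (hc.trans hc1) X.iters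
    refine ⟨c2, hc1.trans hc2, min h1 h2, lt_min hh1 hh2,
      fun T h Δt ε u0 B U0 u f hT hR hε hle hr hn n hnN k k1 k2 m => ?_⟩
    have hb := H1 T h Δt ε u0 B U0 u f hT hR hε (hle.trans (min_le_left _ _)) hr hn
    rcases Nat.lt_or_ge N n with hNn | hNn
    · obtain rfl : n = N + 1 := by omega
      have hctx : X.StepContext Ω κ 𝒦 ρ G T h Δt ε u0 B _ _ (u (N + 1)) (f (N + 1)) :=
        ⟨hT, hR, hε, hX.isStep_of_isRun hT hR.dt_pos hε hr (N + 1)⟩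
      exact start hctx (H2 T h Δt ε u0 B _ _ _ _ hctx (hle.trans (min_le_right _ _))
        ((hb N le_rfl X.iters hX.one_le_iters le_rfl (Fin.last S)).near.congr
          (hr.next_u N 1) (hr.next_f N 1)) k k1 k2 k2 m)
    · exact (hb n hNn k k1 k2 m).mono hR.h_pos.le hR.dt_pos.le hε hc2

/-- Well prepared initial data. -/
lemma Scheme.IsAdmissible.exists_isNear_init (hX : X.IsAdmissible Λ Ω κ)
    (hM : X.IsSmooth Λ 𝒰 𝒦 ρ G) : ∃ c, 0 ≤ c ∧ ∃ h1 > 0,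
    ∀ (T : Mesh D) (h Δt : ℝ) (u0 : Pt D → Fin q → ℝ) (B : Pt D → Pt D →L[ℝ] (Fin L → ℝ))
      (U0 : Pt D → Fin q → ℝ), X.IsReference 𝒦 ρ G T h Δt u0 B → h ≤ h1 →
      (∀ σ ∈ dofs X.p T, ‖U0 σ - u0 σ‖ ≤ G * h ^ 2) →
      X.IsNear T h c u0 U0 (fun σ => X.maxw (U0 σ)) := by
  have hG : 0 < G := zero_lt_one.trans_le hM.one_le
  have hρ := hM.rho_pos
  refine ⟨2 * (G * G), by positivity, ρ / G, by positivity, fun T h Δt u0 B U0 hR hle hU => ?_⟩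
  have hh := hR.h_pos
  have h1 : G * h ≤ ρ := by rwa [le_div_iff₀' hG] at hle
  refine ⟨fun σ hσ => hM.proj _ (hM.mem_of_dist (hR.mem_dofs hX.one_le_p hσ)
    ((hU σ hσ).trans ?_)), ?_⟩
  · have := mul_le_of_le_one_right (mul_nonneg hG.le hh.le) hR.h_le
    nlinarith
  · rw [mul_assoc]
    -- Data accurate to `O(h^2)` are needed here: a deviation of size `(G^2 h) h` is slowly varying
    -- of order `h`.
    refine SlowNodal.of_small hR.h_le (by positivity) fun σ hσ => ?_
    calc _ ≤ G * ‖U0 σ - u0 σ‖ := hM.lip _ _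
      _ ≤ G * (G * h ^ 2) := by gcongr; exact hU σ hσ
      _ = _ := by ring

end Iterate

end

section

/-! ### Uniform constants of the model and of smooth reference states -/

section Constants

variable {D q L S : ℕ}
variable {X : Scheme D q L S} {Λ : Fin D → Fin L → ℝ} {Ω : Set (Pt D)} {κ : ℝ}
  {𝒰 𝒦 : Set (Fin q → ℝ)} {ρ G : ℝ}

lemma Scheme.IsSmooth.mono (hM : X.IsSmooth Λ 𝒰 𝒦 ρ G) {G' : ℝ} (hG : G ≤ G') :
    X.IsSmooth Λ 𝒰 𝒦 ρ G' where
  one_le := hM.one_le.trans hG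
  rho_pos := hM.rho_pos
  thick := hM.thick
  proj := hM.proj
  diff := hM.diff
  lip v w := (hM.lip v w).trans (by gcongr)
  lip_fderiv a ha v hv w hw := (hM.lip_fderiv a ha v hv w hw).trans (by gcongr)
  norm_P v := (hM.norm_P v).trans (by gcongr)
  norm_Λ := hM.norm_Λ.trans hG
  norm_weight m := (hM.norm_weight m).trans hG
  inv_c m hm := (hM.inv_c m hm).trans hG

/-- A closed `ρ`-neighbourhood of the compact set still lies in `𝒰` and is compact, so the second
derivative of `M` is bounded on it. The neighbourhood need not be convex, hence the mean value
inequality is used on balls around points of `𝒦`. `G` is the sum of all constants needed. -/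
lemma Scheme.IsAdmissible.exists_isSmooth (hX : X.IsAdmissible Λ Ω κ) (h𝒰 : IsOpen 𝒰)
    (hM : ContDiffOn ℝ 2 X.maxw 𝒰) (hP : ∀ w ∈ 𝒰, X.P *ᵥ X.maxw w = w) (h𝒦 : 𝒦 ⊆ 𝒰)
    (hc : IsCompact 𝒦) : ∃ ρ G, X.IsSmooth Λ 𝒰 𝒦 ρ G := by
  obtain ⟨ρ, hρ, hthick⟩ := hc.exists_cthickening_subset_open h𝒰 h𝒦
  obtain ⟨lip, hlip⟩ := hX.lipschitz
  have hD := hM.fderiv_of_isOpen h𝒰 (m := 1) (by norm_num)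
  obtain ⟨C2, hC2⟩ := (hc.cthickening (r := ρ)).exists_bound_of_continuousOn
    ((hD.continuousOn_fderiv_of_isOpen h𝒰 le_rfl).mono hthick)
  set PL := LinearMap.toContinuousLinearMap (Matrix.mulVecLin X.P) with hPL
  obtain ⟨G, hG⟩ : ∃ G, G = 1 + lip + |C2| + ‖PL‖ + ∑ d, ‖Λ d‖ + ∑ m, ∑ j, |X.weight m j| +
    ∑ m, |(X.c m)⁻¹| := ⟨_, rfl⟩
  have p0 : (0 : ℝ) ≤ lip := lip.2
  have p1 := abs_nonneg C2
  have p2 := norm_nonneg PL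
  have p3 : 0 ≤ ∑ d, ‖Λ d‖ := Finset.sum_nonneg fun _ _ => norm_nonneg _
  have p4 : 0 ≤ ∑ m, ∑ j, |X.weight m j| :=
    Finset.sum_nonneg fun _ _ => Finset.sum_nonneg fun _ _ => abs_nonneg _
  have p5 : 0 ≤ ∑ m, |(X.c m)⁻¹| := Finset.sum_nonneg fun _ _ => abs_nonneg _
  refine ⟨ρ, G, ⟨by linarith, hρ, hthick, hP, fun w hw =>
    (hM.differentiableOn (by norm_num)).differentiableAt (h𝒰.mem_nhds hw), fun v w => ?_,
    fun a ha v hv w hw => ?_, fun v => ?_, by linarith, fun m => ?_, fun m hm => ?_⟩⟩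
  · exact (hlip.norm_sub_le v w).trans (mul_le_mul_of_nonneg_right (by linarith) (norm_nonneg _))
  · have hsub := Metric.closedBall_subset_cthickening ha ρ
    refine (convex_closedBall a ρ).norm_image_sub_le_of_norm_fderiv_le (𝕜 := ℝ)
      (fun z hz => ?_) (fun z hz => (hC2 z (hsub hz)).trans ?_) hw hv
    · exact (hD.differentiableOn (by norm_num)).differentiableAt
        (h𝒰.mem_nhds (hthick (hsub hz)))
    · linarith [le_abs_self C2]
  · exact (PL.le_opNorm v).trans (mul_le_mul_of_nonneg_right (by linarith) (norm_nonneg _))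
  · have := Finset.single_le_sum (f := fun m => ∑ j, |X.weight m j|)
      (fun _ _ => Finset.sum_nonneg fun _ _ => abs_nonneg _) (Finset.mem_univ m)
    linarith
  · have := Finset.single_le_sum (f := fun m => |(X.c m)⁻¹|) (fun _ _ => abs_nonneg _)
      (Finset.mem_univ m)
    linarith [le_abs_self (X.c m)⁻¹]

lemma Scheme.IsSmooth.norm_fderiv_le (hM : X.IsSmooth Λ 𝒰 𝒦 ρ G) (w : Fin q → ℝ) :
    ‖fderiv ℝ X.maxw w‖ ≤ G := by
  have hG : 0 ≤ G := zero_le_one.trans hM.one_le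
  have hl : LipschitzWith ⟨G, hG⟩ X.maxw := LipschitzWith.of_dist_le_mul fun v w => by
    rw [dist_eq_norm, dist_eq_norm]
    exact hM.lip v w
  exact norm_fderiv_le_of_lipschitz ℝ hl

/-- Differentiation of `P M(w) = w`, which holds on the open set `𝒰`. Consequently `B = DM Du0` can
be recovered from its projection `P B = Du0`. -/
lemma Scheme.IsSmooth.mulVec_fderiv (hM : X.IsSmooth Λ 𝒰 𝒦 ρ G) (h𝒰 : IsOpen 𝒰)
    {w : Fin q → ℝ} (hw : w ∈ 𝒰) (v : Fin q → ℝ) : X.P *ᵥ fderiv ℝ X.maxw w v = v := by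
  have h1 := (LinearMap.toContinuousLinearMap (Matrix.mulVecLin X.P)).hasFDerivAt.comp w
    (hM.diff w hw).hasFDerivAt
  have h2 : HasFDerivAt (fun w => X.P *ᵥ X.maxw w) (ContinuousLinearMap.id ℝ _) w :=
    (hasFDerivAt_id w).congr_of_eventuallyEq
      (Filter.eventuallyEq_of_mem (h𝒰.mem_nhds hw) fun z hz => hM.proj z hz)
  exact DFunLike.congr_fun (h1.unique h2) v

/-- A smooth function with values in `𝒦` is a reference state on fine meshes. -/
lemma Scheme.IsSmooth.exists_isReference (hM : X.IsSmooth Λ 𝒰 𝒦 ρ G) (h𝒰 : IsOpen 𝒰)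
    (h𝒦 : IsCompact 𝒦) (hΩ : IsOpen Ω) (hκ : 0 < κ) (R cfl : ℝ) : ∃ G' ≥ G, R ≤ G' ∧ ∃ h1 > 0,
    ∀ (T : Mesh D) (h Δt : ℝ) (u0 : Pt D → Fin q → ℝ), T.IsRegular Ω κ h → h ≤ h1 → 0 < Δt →
      Δt ≤ cfl * h → ContDiffOn ℝ 2 u0 Ω →
      (∀ x ∈ Ω, u0 x ∈ 𝒦 ∧ ‖fderiv ℝ u0 x‖ ≤ R ∧ ‖iteratedFDeriv ℝ 2 u0 x‖ ≤ R) →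
      X.IsReference 𝒦 ρ G' T h Δt u0 fun x => (fderiv ℝ X.maxw (u0 x)).comp (fderiv ℝ u0 x) := by
  have hG : 0 < G := zero_lt_one.trans_le hM.one_le
  have hρ := hM.rho_pos
  have hcont : Continuous X.maxw := (LipschitzWith.of_dist_le_mul (K := ⟨G, hG.le⟩) fun v w => by
    rw [dist_eq_norm, dist_eq_norm]
    exact hM.lip v w).continuous
  obtain ⟨C0, hC0⟩ := h𝒦.exists_bound_of_continuousOn hcont.continuousOn
  obtain ⟨R', hR'⟩ : ∃ R', R' = |R| := ⟨_, rfl⟩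
  have hR0 : 0 ≤ R' := hR' ▸ abs_nonneg R
  have hRR : R ≤ R' := hR' ▸ le_abs_self R
  -- The summands bound, besides the constants of the model, the derivatives of `u0`, the size and
  -- Lipschitz constant of `B`, the Maxwellian on `𝒦`, and the CFL number.
  obtain ⟨G', hG'⟩ : ∃ G', G' = G + R' + G * R' + (G * R' * R' + G * R') + |C0| + |cfl| :=
    ⟨_, rfl⟩
  have q1 : 0 ≤ G * R' := by positivity
  have q2 : 0 ≤ G * R' * R' := by positivity
  have q3 := abs_nonneg C0
  have q4 := abs_nonneg cfl
  have hG'0 : 0 < G' := by linarith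
  refine ⟨G', by linarith, by linarith, min 1 (ρ / (2 * G')), by positivity,
    fun T h Δt u0 hT hle hΔ hcfl hu hb => ?_⟩
  have hh := hT.1
  have hsm : G' * h ≤ ρ / 2 := by
    have := hle.trans (min_le_right _ _)
    rw [le_div_iff₀ (by positivity)] at this
    linarith
  have hRh : R' * h ≤ G' * h := mul_le_mul_of_nonneg_right (by linarith) hh.le
  have hdist : ∀ K ∈ T.elems, ∀ x ∈ hull K, ∀ y ∈ hull K, ‖x - y‖ ≤ h := fun K hK x hx y hy =>
    (hT.simplex hκ hK).dist_le hx hy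
  have hsub : ∀ K ∈ T.elems, hull K ⊆ Ω := fun K hK => (hT.2 K hK).1
  have hdu : ∀ x ∈ Ω, DifferentiableAt ℝ u0 x := fun x hx =>
    (hu.differentiableOn (by norm_num)).differentiableAt (hΩ.mem_nhds hx)
  have hddu : ∀ x ∈ Ω, DifferentiableAt ℝ (fderiv ℝ u0) x := fun x hx =>
    ((hu.fderiv_of_isOpen hΩ (m := 1) (by norm_num)).differentiableOn
      (by norm_num)).differentiableAt (hΩ.mem_nhds hx)
  have hdd : ∀ x ∈ Ω, ‖fderiv ℝ (fderiv ℝ u0) x‖ ≤ R' := fun x hx => by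
    rw [← norm_iteratedFDeriv_one, norm_iteratedFDeriv_fderiv]
    exact (hb x hx).2.2.trans hRR
  have hlip : ∀ K ∈ T.elems, ∀ x ∈ hull K, ∀ y ∈ hull K, ‖u0 x - u0 y‖ ≤ R' * h :=
    fun K hK x hx y hy => ((convex_hull K).norm_image_sub_le_of_norm_fderiv_le (𝕜 := ℝ)
      (fun z hz => hdu z (hsub K hK hz))
      (fun z hz => (hb z (hsub K hK hz)).2.1.trans hRR) hy hx).trans
      (mul_le_mul_of_nonneg_left (hdist K hK x hx y hy) hR0)
  have hlipD : ∀ K ∈ T.elems, ∀ x ∈ hull K, ∀ y ∈ hull K,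
      ‖fderiv ℝ u0 x - fderiv ℝ u0 y‖ ≤ R' * h :=
    fun K hK x hx y hy => ((convex_hull K).norm_image_sub_le_of_norm_fderiv_le (𝕜 := ℝ)
      (fun z hz => hddu z (hsub K hK hz)) (fun z hz => hdd z (hsub K hK hz)) hy hx).trans
      (mul_le_mul_of_nonneg_left (hdist K hK x hx y hy) hR0)
  have hlipB : ∀ K ∈ T.elems, ∀ x ∈ hull K, ∀ y ∈ hull K,
      ‖(fderiv ℝ X.maxw (u0 x)).comp (fderiv ℝ u0 x) -
        (fderiv ℝ X.maxw (u0 y)).comp (fderiv ℝ u0 y)‖ ≤ (G * R' * R' + G * R') * h := by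
    intro K hK x hx y hy
    have e : (fderiv ℝ X.maxw (u0 x)).comp (fderiv ℝ u0 x) -
        (fderiv ℝ X.maxw (u0 y)).comp (fderiv ℝ u0 y) =
        (fderiv ℝ X.maxw (u0 x) - fderiv ℝ X.maxw (u0 y)).comp (fderiv ℝ u0 x) +
        (fderiv ℝ X.maxw (u0 y)).comp (fderiv ℝ u0 x - fderiv ℝ u0 y) := by
      rw [ContinuousLinearMap.sub_comp, ContinuousLinearMap.comp_sub]
      abel
    have b1 := hM.lip_fderiv (u0 x) (hb x (hsub K hK hx)).1 (u0 x)
      (Metric.mem_closedBall_self hρ.le) (u0 y) (by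
        rw [mem_closedBall_iff_norm]
        linarith [hlip K hK y hy x hx])
    rw [e]
    refine (norm_add_le _ _).trans ?_
    calc _ ≤ G * (R' * h) * R' + G * (R' * h) := by
          refine add_le_add ((ContinuousLinearMap.opNorm_comp_le _ _).trans ?_)
            ((ContinuousLinearMap.opNorm_comp_le _ _).trans ?_)
          · refine mul_le_mul (b1.trans ?_) ((hb x (hsub K hK hx)).2.1.trans hRR)
              (norm_nonneg _) (by positivity)
            exact mul_le_mul_of_nonneg_left (hlip K hK x hx y hy) hG.le
          · exact mul_le_mul (hM.norm_fderiv_le _) (hlipD K hK x hx y hy) (norm_nonneg _) hG.le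
      _ = _ := by ring
  refine ⟨hΔ, hcfl.trans (mul_le_mul_of_nonneg_right ?_ hh.le), hh, hle.trans (min_le_left _ _),
    hsm, fun K hK x hx => (hb x (hsub K hK hx)).1, fun K hK x hx => ?_,
    fun K hK x hx y hy => (hlip K hK x hx y hy).trans hRh, fun K hK x hx => ?_,
    fun K hK x hx y hy => (hlipB K hK x hx y hy).trans (mul_le_mul_of_nonneg_right ?_ hh.le),
    fun K hK x hx y hy => ?_, fun K hK x hx z => ?_⟩
  · linarith [le_abs_self cfl]
  · exact (hC0 _ (hb x (hsub K hK hx)).1).trans (by linarith [le_abs_self C0])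
  · refine (ContinuousLinearMap.opNorm_comp_le _ _).trans ?_
    exact (mul_le_mul (hM.norm_fderiv_le _) ((hb x (hsub K hK hx)).2.1.trans hRR)
      (norm_nonneg _) hG.le).trans (by linarith)
  · linarith
  -- Taylor remainder by the mean value inequality on the convex element: the derivative of `M ∘ u0`
  -- varies there by `O(h)`.
  · have := (convex_hull K).norm_image_sub_le_of_norm_hasFDerivWithin_le' (𝕜 := ℝ)
      (f := fun z => X.maxw (u0 z))
      (f' := fun z => (fderiv ℝ X.maxw (u0 z)).comp (fderiv ℝ u0 z))
      (φ := (fderiv ℝ X.maxw (u0 x)).comp (fderiv ℝ u0 x))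
      (fun z hz => ((hM.diff _ (hM.mem_self (hb z (hsub K hK hz)).1)).hasFDerivAt.comp z
        (hdu z (hsub K hK hz)).hasFDerivAt).hasFDerivWithinAt)
      (fun z hz => hlipB K hK z hz x hx) hx hy
    refine this.trans ?_
    calc _ ≤ (G * R' * R' + G * R') * h * h :=
          mul_le_mul_of_nonneg_left (hdist K hK y hy x hx) (by positivity)
      _ ≤ G' * h * h := by
          refine mul_le_mul_of_nonneg_right (mul_le_mul_of_nonneg_right ?_ hh.le) hh.le
          linarith
      _ = _ := by ring
  · exact congrArg _ (hM.mulVec_fderiv h𝒰 (hM.mem_self (hb x (hsub K hK hx)).1) _)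

end Constants

end

section

/-! ### From increment bounds to discrete relations, and closedness under limits -/

section Relations

variable {D q L S : ℕ}
variable {X : Scheme D q L S} {Λ : Fin D → Fin L → ℝ} {Ω : Set (Pt D)} {κ : ℝ}
  {𝒰 𝒦 : Set (Fin q → ℝ)} {ρ G : ℝ} {T : Mesh D} {h Δt ε c : ℝ} {u0 : Pt D → Fin q → ℝ}
  {B : Pt D → Pt D →L[ℝ] (Fin L → ℝ)} {u us : Pt D → Fin q → ℝ} {f fs : Pt D → Fin L → ℝ}
  {A : Fin D → (Fin q → ℝ) → (Fin q → ℝ)} {σ x : Pt D} {K : Finset (Pt D)}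

lemma Scheme.IsNear.norm_nodal_sub_le (hn : X.IsNear T h c u0 u f) (hX : X.IsAdmissible Λ Ω κ)
    (hT : T.IsRegular Ω κ h) (hM : X.IsSmooth Λ 𝒰 𝒦 ρ G)
    (hR : X.IsReference 𝒦 ρ G T h Δt u0 B) (hK : K ∈ elemsAt X.p T σ) :
    ∀ τ ∈ nodes X.p K, ‖f τ - (f σ + B σ (τ - σ))‖ ≤ (c + G) * h ^ 2 := fun τ hτ => by
  have hp := hX.one_le_p
  simpa using (norm_layers_le hp hX.kappa_pos hT hM hR hn.slow ⟨K, hK⟩ 1 τ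
    ⟨σ, rfl, K, hK.1, hK.2, hτ⟩).2.2

lemma Scheme.IsNear.norm_fderiv_interp_sub_le (hn : X.IsNear T h c u0 u f)
    (hX : X.IsAdmissible Λ Ω κ)
    (hT : T.IsRegular Ω κ h) (hM : X.IsSmooth Λ 𝒰 𝒦 ρ G)
    (hR : X.IsReference 𝒦 ρ G T h Δt u0 B) (hK : K ∈ elemsAt X.p T σ) (hx : x ∈ hull K) :
    ‖fderiv ℝ (interp X.p K f) x - B σ‖ ≤ inverseConst D X.p κ * (c + G) * h := by
  refine ((hT.simplex hX.kappa_pos hK.1).norm_fderiv_interp_sub_le hX.one_le_p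
    (hn.norm_nodal_sub_le hX hT hM hR hK) hx).trans (le_of_eq ?_)
  have := hR.h_pos.ne'
  field_simp

/-- The discrete derivatives of the kinetic flux. -/
lemma Scheme.IsNear.norm_kineticFlux_sub_le (hn : X.IsNear T h c u0 u f)
    (hX : X.IsAdmissible Λ Ω κ)
    (hT : T.IsRegular Ω κ h) (hM : X.IsSmooth Λ 𝒰 𝒦 ρ G)
    (hR : X.IsReference 𝒦 ρ G T h Δt u0 B) (hK : K ∈ elemsAt X.p T σ) (hx : x ∈ hull K) :
    ‖∑ d, lam Λ d (pderiv d (interp X.p K f) x) - fluxDeriv Λ B σ‖ ≤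
      G * (inverseConst D X.p κ * (c + G) * h) :=
  (norm_fluxDeriv_sub_le hM σ _).trans (mul_le_mul_of_nonneg_left
    (hn.norm_fderiv_interp_sub_le hX hT hM hR hK hx) (zero_le_one.trans hM.one_le))

/-- The discrete derivatives of the macroscopic flux. -/
lemma Scheme.IsNear.norm_flux_sub_le (hn : X.IsNear T h c u0 u f) (hX : X.IsAdmissible Λ Ω κ)
    (hT : T.IsRegular Ω κ h) (hM : X.IsSmooth Λ 𝒰 𝒦 ρ G)
    (hR : X.IsReference 𝒦 ρ G T h Δt u0 B) (h𝒰 : IsOpen 𝒰)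
    (hA : ∀ d, ∀ w ∈ 𝒰, X.P *ᵥ lam Λ d (X.maxw w) = A d w) (hc : 0 ≤ c)
    (hch : (G * c + G) * h ≤ ρ) (hK : K ∈ elemsAt X.p T σ) (hx : x ∈ hull K) :
    ‖∑ d, pderiv d (fun y => A d (interp X.p K u y)) x - X.P *ᵥ fluxDeriv Λ B σ‖ ≤
      G * (G * (G * (inverseConst D X.p κ * (G * (c + G))) + G * (G * c + G) * (G * G))) * h := by
  have hp := hX.one_le_p
  have hG : 0 ≤ G := zero_le_one.trans hM.one_le
  have hh := hR.h_pos
  have s1 := nodes_subset_hull hp hK.2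
  have hw := hn.norm_interp_u_le hp hM hR hK.1 s1 hx
  have hw𝒰 : interp X.p K u x ∈ 𝒰 := hM.mem_of_dist (hR.mem K hK.1 σ s1) (hw.trans hch)
  set PL := LinearMap.toContinuousLinearMap (Matrix.mulVecLin X.P) with hPL
  have hPLa : ∀ v, PL v = X.P *ᵥ v := fun v => rfl
  set E := fderiv ℝ (interp X.p K u) x with hE
  set DM := fderiv ℝ X.maxw (interp X.p K u x) with hDM
  have hdi : DifferentiableAt ℝ (interp X.p K u) x :=
    ((contDiff_interp (isSimplex_of_mem_elems hK.1) X.p u).differentiable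
      (by norm_num)).differentiableAt
  -- Near `x` the values of `u_h` stay in the open set `𝒰`, where the flux is `P Λ_d M`; its
  -- differentiability is inherited from `M`.
  have hflux : ∀ d, pderiv d (fun y => A d (interp X.p K u y)) x =
      X.P *ᵥ lam Λ d (DM.comp E (unitDir d)) := by
    intro d
    set lamL := LinearMap.toContinuousLinearMap (Matrix.mulVecLin (Matrix.diagonal (Λ d)))
    have h1 : HasFDerivAt (fun y => PL (lamL (X.maxw (interp X.p K u y))))
        (PL.comp (lamL.comp (DM.comp E))) x :=
      PL.hasFDerivAt.comp x (lamL.hasFDerivAt.comp x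
        ((hM.diff _ hw𝒰).hasFDerivAt.comp x hdi.hasFDerivAt))
    have h2 : HasFDerivAt (fun y => A d (interp X.p K u y)) _ x :=
      h1.congr_of_eventuallyEq (Filter.eventuallyEq_of_mem
        (hdi.continuousAt.preimage_mem_nhds (h𝒰.mem_nhds hw𝒰)) fun z hz => (hA d _ hz).symm)
    rw [pderiv, h2.fderiv]
    rfl
  have hPB : ‖E - PL.comp (B σ)‖ ≤ inverseConst D X.p κ * (G * (c + G)) * h := by
    refine ((hT.simplex hX.kappa_pos hK.1).norm_fderiv_interp_sub_le hp
      (a := u σ) (σ := σ) (δ := G * ((c + G) * h ^ 2)) (fun τ hτ => ?_) hx).trans (le_of_eq ?_)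
    · have e : u τ - (u σ + PL.comp (B σ) (τ - σ)) =
          X.P *ᵥ (f τ - (f σ + B σ (τ - σ))) := by
        rw [Matrix.mulVec_sub, Matrix.mulVec_add, hn.proj τ ⟨K, hK.1, hτ⟩, hn.proj σ ⟨K, hK⟩]
        rfl
      rw [e]
      exact (hM.norm_P _).trans
        (mul_le_mul_of_nonneg_left (hn.norm_nodal_sub_le hX hT hM hR hK τ hτ) hG)
    · have := hh.ne'
      field_simp
  have hnB : ‖PL.comp (B σ)‖ ≤ G * G :=
    ContinuousLinearMap.opNorm_le_bound _ (by positivity) fun z => by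
      refine (hM.norm_P _).trans ?_
      rw [mul_assoc]
      exact mul_le_mul_of_nonneg_left ((B σ).le_of_opNorm_le (hR.norm_B K hK.1 σ s1) z) hG
  -- With `DM(u0) P B = B`, the error of `DM(u_h) Du_h` splits into that of the gradient `Du_h`
  -- against `P B` and that of `DM` between two states at distance `O(h)`.
  have hBσ : (fderiv ℝ X.maxw (u0 σ)).comp (PL.comp (B σ)) = B σ :=
    ContinuousLinearMap.ext fun z => hR.fderiv_B K hK.1 σ s1 z
  have hC : ‖DM.comp E - B σ‖ ≤ (G * (inverseConst D X.p κ * (G * (c + G))) +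
      G * (G * c + G) * (G * G)) * h := by
    have e : DM.comp E - B σ = DM.comp (E - PL.comp (B σ)) +
        (DM - fderiv ℝ X.maxw (u0 σ)).comp (PL.comp (B σ)) := by
      rw [ContinuousLinearMap.comp_sub, ContinuousLinearMap.sub_comp, hBσ]
      abel
    have b1 := hM.lip_fderiv (u0 σ) (hR.mem K hK.1 σ s1) (interp X.p K u x)
      (mem_closedBall_iff_norm.2 (hw.trans hch)) (u0 σ)
      (Metric.mem_closedBall_self hM.rho_pos.le)
    rw [e]
    refine (norm_add_le _ _).trans ?_
    calc _ ≤ G * (inverseConst D X.p κ * (G * (c + G)) * h) +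
          G * ((G * c + G) * h) * (G * G) := by
          refine add_le_add ((ContinuousLinearMap.opNorm_comp_le _ _).trans ?_)
            ((ContinuousLinearMap.opNorm_comp_le _ _).trans ?_)
          · exact mul_le_mul (hM.norm_fderiv_le _) hPB (norm_nonneg _) hG
          · exact mul_le_mul (b1.trans (mul_le_mul_of_nonneg_left hw hG)) hnB
              (norm_nonneg _) (by positivity)
      _ = _ := by ring
  simp_rw [hflux]
  rw [← Matrix.mulVec_sum, ← Matrix.mulVec_sub]
  refine (hM.norm_P _).trans ?_
  rw [mul_assoc, mul_assoc G]
  exact mul_le_mul_of_nonneg_left ((norm_fluxDeriv_sub_le hM σ _).trans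
    (mul_le_mul_of_nonneg_left hC hG)) hG

/-- The ratio `Δt / Δt^m = 1 / c_m` depends only on the sub-timestep. -/
lemma Scheme.IsAdmissible.norm_inv_dt_smul_le (hX : X.IsAdmissible Λ Ω κ)
    (hM : X.IsSmooth Λ 𝒰 𝒦 ρ G) (hΔ : 0 < Δt) {m : Fin (S + 1)} (hm : m ≠ 0) {V : Type}
    [NormedAddCommGroup V] [NormedSpace ℝ V] {v : V} {e : ℝ} (he : 0 ≤ e)
    (hv : ‖v‖ ≤ Δt * e) : ‖(1 / X.dt Δt m) • v‖ ≤ G * e := by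
  have hd := hX.dt_pos hΔ hm
  rw [norm_smul, Real.norm_of_nonneg (by positivity)]
  calc _ ≤ 1 / X.dt Δt m * (Δt * e) := by gcongr
    _ = (X.c m)⁻¹ * e := by
      have := (hX.c_pos hm).ne'
      rw [Scheme.dt]
      field_simp
    _ ≤ _ := mul_le_mul_of_nonneg_right (hM.inv_c m hm) he

/-- The macroscopic relations follow from the estimates of the increments. -/
lemma Scheme.IsAdmissible.exists_limitRelation (hX : X.IsAdmissible Λ Ω κ)
    (hM : X.IsSmooth Λ 𝒰 𝒦 ρ G) (h𝒰 : IsOpen 𝒰)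
    (hA : ∀ d, ∀ w ∈ 𝒰, X.P *ᵥ lam Λ d (X.maxw w) = A d w) (hc : 0 ≤ c) : ∃ C, 0 ≤ C ∧
    ∃ h1 > 0, ∀ (T : Mesh D) (h Δt : ℝ) (u0 : Pt D → Fin q → ℝ)
      (B : Pt D → Pt D →L[ℝ] (Fin L → ℝ)) (us u : Pt D → Fin q → ℝ) (f : Pt D → Fin L → ℝ),
      T.IsRegular Ω κ h → X.IsReference 𝒦 ρ G T h Δt u0 B → h ≤ h1 → X.IsNear T h c u0 u f →
      ∀ m ≠ 0, (∀ σ ∈ dofs X.p T,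
        ‖u σ - us σ + X.dt Δt m • (X.P *ᵥ fluxDeriv Λ B σ)‖ ≤ c * Δt * h) →
      ∀ σ ∈ dofs X.p T, X.P *ᵥ f σ = u σ ∧ ‖f σ - X.maxw (u σ)‖ ≤ C * h ∧
        ∀ K ∈ elemsAt X.p T σ, ∀ x ∈ hull K, interp X.p K u x ∈ 𝒰 ∧
          ‖(1 / X.dt Δt m) • (u σ - us σ) + ∑ d, pderiv d (fun y => A d (interp X.p K u y)) x‖ ≤
            C * h := by
  have hG : 0 ≤ G := zero_le_one.trans hM.one_le
  have hρ := hM.rho_pos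
  have hI := inverseConst_nonneg D X.p hX.kappa_pos
  obtain ⟨C1, hC1⟩ : ∃ C1, C1 = G * (G * (G * (inverseConst D X.p κ * (G * (c + G))) +
    G * (G * c + G) * (G * G))) := ⟨_, rfl⟩
  have hC1' : 0 ≤ C1 := by rw [hC1]; positivity
  refine ⟨2 * G ^ 2 * (G * c) + c + G * c + C1, by positivity, ρ / (2 * (G * c + G + 1)),
    by positivity, fun T h Δt u0 B us u f hT hR hle hn m hm hinc σ hσ => ?_⟩
  have hh := hR.h_pos
  have hGch : 0 ≤ G * c * h := by positivity
  have hGh : 0 ≤ G * h := by positivity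
  rw [le_div_iff₀ (by positivity)] at hle
  have hsm : G * c * h ≤ ρ / 2 := by linarith
  have hsm' : (G * c + G) * h ≤ ρ := by linarith
  refine ⟨hn.proj σ hσ, ?_, fun K hK x hx => ⟨?_, ?_⟩⟩
  · rw [norm_sub_rev]
    refine ((hn.slow_relax hX hM hR hc hsm).1 σ hσ).trans
      (mul_le_mul_of_nonneg_right ?_ hh.le)
    have : 0 ≤ G * c := by positivity
    linarith
  · exact hM.mem_of_dist (hR.mem K hK.1 x hx)
      ((hn.norm_interp_u_le hX.one_le_p hM hR hK.1 hx hx).trans hsm')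
  · have b1 := hn.norm_flux_sub_le hX hT hM hR h𝒰 hA hc hsm' hK hx
    rw [← hC1] at b1
    have b2 := hX.norm_inv_dt_smul_le hM hR.dt_pos hm (e := c * h) (by positivity)
      ((hinc σ hσ).trans (le_of_eq (by ring)))
    have hd := (hX.dt_pos hR.dt_pos hm).ne'
    have e : (1 / X.dt Δt m) • (u σ - us σ) +
        ∑ d, pderiv d (fun y => A d (interp X.p K u y)) x =
        (1 / X.dt Δt m) • (u σ - us σ + X.dt Δt m • (X.P *ᵥ fluxDeriv Λ B σ)) +
        (∑ d, pderiv d (fun y => A d (interp X.p K u y)) x - X.P *ᵥ fluxDeriv Λ B σ) := by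
      rw [smul_add (1 / X.dt Δt m), smul_smul, one_div_mul_cancel hd, one_smul]
      abel
    rw [e]
    refine (norm_add_le _ _).trans ((add_le_add b2 b1).trans ?_)
    have : 0 ≤ (2 * G ^ 2 * (G * c) + c) * h := by positivity
    linarith

/-- The kinetic relations follow from the estimates of the increments. -/
lemma Scheme.IsAdmissible.exists_kineticRelation (hX : X.IsAdmissible Λ Ω κ)
    (hM : X.IsSmooth Λ 𝒰 𝒦 ρ G) (hc : 0 ≤ c) : ∃ C, 0 ≤ C ∧
    ∃ h1 > 0, ∀ (T : Mesh D) (h Δt ε : ℝ) (u0 : Pt D → Fin q → ℝ)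
      (B : Pt D → Pt D →L[ℝ] (Fin L → ℝ)) (us u : Pt D → Fin q → ℝ) (fs f : Pt D → Fin L → ℝ),
      T.IsRegular Ω κ h → X.IsReference 𝒦 ρ G T h Δt u0 B → h ≤ h1 → 0 < ε →
      ∀ m ≠ 0, X.StepBound Λ T h Δt ε c u0 B us fs m u f →
      ∀ σ ∈ dofs X.p T, ∀ K ∈ elemsAt X.p T σ, ∀ x ∈ hull K,
        ‖(1 / X.dt Δt m) • (f σ - fs σ) + (∑ d, lam Λ d (pderiv d (interp X.p K f) x)) -
          (1 / ε) • (X.maxw (u σ) - f σ)‖ ≤ C * (h / ε + h) := by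
  have hG : 0 ≤ G := zero_le_one.trans hM.one_le
  have hρ := hM.rho_pos
  have hI := inverseConst_nonneg D X.p hX.kappa_pos
  refine ⟨2 * G ^ 2 * (G * c) + c + G * c + G * (inverseConst D X.p κ * (c + G)), by positivity,
    ρ / (2 * (G * c + 1)),
    by positivity, fun T h Δt ε u0 B us u fs f hT hR hle hε m hm hb σ hσ K hK x hx => ?_⟩
  have hh := hR.h_pos
  rw [le_div_iff₀ (by positivity)] at hle
  have hsm : G * c * h ≤ ρ / 2 := by linarith
  have b1 := hb.near.norm_kineticFlux_sub_le hX hT hM hR hK hx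
  have b2 := hX.norm_inv_dt_smul_le hM hR.dt_pos hm (e := c * (h + h / ε)) (by positivity)
    ((hb.inc_f σ hσ).trans (le_of_eq (by ring)))
  have b3 := (hb.near.slow_relax hX hM hR hc hsm).1 σ hσ
  have hd := (hX.dt_pos hR.dt_pos hm).ne'
  have e : (1 / X.dt Δt m) • (f σ - fs σ) + (∑ d, lam Λ d (pderiv d (interp X.p K f) x)) -
      (1 / ε) • (X.maxw (u σ) - f σ) =
      (1 / X.dt Δt m) • (f σ - fs σ + X.dt Δt m • fluxDeriv Λ B σ) +
      (∑ d, lam Λ d (pderiv d (interp X.p K f) x) - fluxDeriv Λ B σ) -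
      (1 / ε) • (X.maxw (u σ) - f σ) := by
    rw [smul_add (1 / X.dt Δt m), smul_smul, one_div_mul_cancel hd, one_smul]
    abel
  rw [e]
  refine (norm_sub_le _ _).trans ((add_le_add_left (norm_add_le _ _) _).trans ?_)
  rw [norm_smul (1 / ε), Real.norm_of_nonneg (by positivity : 0 ≤ 1 / ε)]
  have b4 := mul_le_mul_of_nonneg_left b3 (by positivity : 0 ≤ 1 / ε)
  calc _ ≤ G * (c * (h + h / ε)) + G * (inverseConst D X.p κ * (c + G) * h) +
        1 / ε * ((2 * G ^ 2 * (G * c) + c) * h) := by linarith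
    _ = (2 * G ^ 2 * (G * c) + c + G * c + G * (inverseConst D X.p κ * (c + G))) *
        (h / ε + h) - ((2 * G ^ 2 * (G * c) + c) * h +
          G * (inverseConst D X.p κ * (c + G)) * (h / ε)) := by ring
    _ ≤ _ := sub_le_self _ (by positivity)

/-- The estimates pass to the limit. -/
lemma SlowNodal.of_tendsto {ι : Type} {l : Filter ι} [l.NeBot] {V : Type}
    [NormedAddCommGroup V] {p : ℕ} {s : ℝ} {g : ι → Pt D → V} {g' : Pt D → V}
    (hg : ∀ᶠ i in l, SlowNodal p T h s (g i))
    (hl : ∀ σ ∈ dofs p T, Tendsto (fun i => g i σ) l (𝓝 (g' σ))) : SlowNodal p T h s g' :=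
  ⟨fun σ hσ => le_of_tendsto (hl σ hσ).norm (hg.mono fun _ hi => hi.1 σ hσ),
    fun K hK σ hσ τ hτ => le_of_tendsto
      ((hl σ ⟨K, hK, hσ⟩).sub (hl τ ⟨K, hK, hτ⟩)).norm (hg.mono fun _ hi => hi.2 K hK σ hσ τ hτ)⟩

lemma Scheme.IsNear.of_tendsto {ι : Type} {l : Filter ι} [l.NeBot]
    {v : ι → Pt D → Fin q → ℝ} {g : ι → Pt D → Fin L → ℝ}
    (hn : ∀ᶠ i in l, X.IsNear T h c u0 (v i) (g i))
    (hv : ∀ σ ∈ dofs X.p T, Tendsto (fun i => v i σ) l (𝓝 (u σ)))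
    (hg : ∀ σ ∈ dofs X.p T, Tendsto (fun i => g i σ) l (𝓝 (f σ))) : X.IsNear T h c u0 u f := by
  refine ⟨fun σ hσ => ?_, SlowNodal.of_tendsto (hn.mono fun _ hi => hi.slow)
    fun σ hσ => (hg σ hσ).sub_const _⟩
  have hP : Continuous fun w : Fin L → ℝ => X.P *ᵥ w :=
    Continuous.matrix_mulVec continuous_const continuous_id
  exact tendsto_nhds_unique (((hP.tendsto _).comp (hg σ hσ)).congr'
    (hn.mono fun i hi => hi.proj σ hσ)) (hv σ hσ)

end Relations

end

/-! ### Assembly of the uniform asymptotic relations -/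

section

variable {D q L S : ℕ}

/-- The asymptotic relations, with constants independent of relaxation time, mesh, timestep and
data. -/
theorem Scheme.IsAdmissible.exists_relations {X : Scheme D q L S} {Λ : Fin D → Fin L → ℝ}
    {Ω : Set (Pt D)} {κ : ℝ} (hX : X.IsAdmissible Λ Ω κ) (hΩ : IsOpen Ω)
    {A : Fin D → (Fin q → ℝ) → (Fin q → ℝ)} {𝒰 𝒦 : Set (Fin q → ℝ)} (h𝒰 : IsOpen 𝒰)
    (hM : ContDiffOn ℝ 2 X.maxw 𝒰) (hP : ∀ w ∈ 𝒰, X.P *ᵥ X.maxw w = w)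
    (hA : ∀ d, ∀ w ∈ 𝒰, X.P *ᵥ lam Λ d (X.maxw w) = A d w) (h𝒦 : 𝒦 ⊆ 𝒰)
    (hc : IsCompact 𝒦) (R cfl : ℝ) (N : ℕ) : ∃ C : ℝ, ∃ h0 > 0,
      ∀ (T : Mesh D) (h : ℝ), T.IsRegular Ω κ h → h ≤ h0 → ∀ Δt > 0, Δt ≤ cfl * h →
      ∀ U0 : Pt D → Fin q → ℝ, GoodData X.p Ω 𝒦 R h T U0 →
        (∀ ε > 0, ∀ (u : History D q S) (f : History D L S), X.IsRun ε T Δt U0 u f →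
          X.LimitRelations A 𝒰 T Δt N (C * (ε + h)) u f ∧
          X.KineticRelations Λ ε T Δt N (C * (h / ε + h)) u f) ∧
        (∀ (u : ℝ → History D q S) (f : ℝ → History D L S)
          (u' : History D q S) (f' : History D L S),
          (∀ ε > 0, X.IsRun ε T Δt U0 (u ε) (f ε)) →
          (∀ n k, 1 ≤ k → k ≤ X.iters → ∀ m, ∀ σ ∈ dofs X.p T,
            Tendsto (fun ε => u ε n k m σ) (𝓝[>] 0) (𝓝 (u' n k m σ)) ∧
            Tendsto (fun ε => f ε n k m σ) (𝓝[>] 0) (𝓝 (f' n k m σ))) →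
          X.LimitRelations A 𝒰 T Δt N (C * h) u' f') := by
  obtain ⟨ρ, G0, hM0⟩ := hX.exists_isSmooth h𝒰 hM hP h𝒦 hc
  obtain ⟨G, hG, hRG, h1, hh1, href⟩ := hM0.exists_isReference h𝒰 hc hΩ hX.kappa_pos R cfl
  have hM := hM0.mono hG
  obtain ⟨c0, hc0, h2, hh2, hinit⟩ := hX.exists_isNear_init hM
  obtain ⟨c, hc0c, h3, hh3, hrun⟩ := hX.exists_runBound hM hc0 N
  have hc := hc0.trans hc0c
  obtain ⟨C1, hC1, h4, hh4, hlim⟩ := hX.exists_limitRelation hM h𝒰 hA hc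
  obtain ⟨C2, hC2, h5, hh5, hkin⟩ := hX.exists_kineticRelation hM hc
  refine ⟨C1 + C2, min (min (min h1 h2) h3) (min h4 h5), by positivity,
    fun T h hT hle Δt hΔ hcfl U0 hU0 => ?_⟩
  simp only [le_min_iff] at hle
  obtain ⟨⟨⟨l1, l2⟩, l3⟩, l4, l5⟩ := hle
  obtain ⟨u0, hu0, hb, hU⟩ := hU0
  have hh := hT.1
  have hR := href T h Δt u0 hT l1 hΔ hcfl hu0 hb
  have hn := hinit T h Δt u0 _ U0 hR l2 fun σ hσ => (hU σ hσ).trans (by gcongr)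
  have hbound := fun ε hε u f hr => hrun T h Δt ε u0 _ U0 u f hT hR hε l3 hr hn
  -- The macroscopic error is in fact `C1 h` for every `ε`. The same bound, weakened, gives `O(ε +
  -- h)`, and unweakened it serves the limit.
  have herr : ∀ e, h ≤ e → C1 * h ≤ (C1 + C2) * e := fun e he => by gcongr; linarith
  refine ⟨fun ε hε u f hr => ⟨fun n hnN k k1 k2 m hm σ hσ => ?_,
    fun n hnN k k1 k2 m hm σ hσ K hK x hx => ?_⟩, fun u f u' f' hr hl n hnN k k1 k2 m hm σ hσ => ?_⟩
  · have hs := hbound ε hε u f hr n hnN k k1 k2 m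
    obtain ⟨r1, r2, r3⟩ := hlim T h Δt u0 _ _ _ _ hT hR l4 hs.near m hm hs.inc_u σ hσ
    have he := herr (ε + h) (by linarith)
    exact ⟨r1, r2.trans he, fun K hK x hx => ⟨(r3 K hK x hx).1, (r3 K hK x hx).2.trans he⟩⟩
  · have hs := hbound ε hε u f hr n hnN k k1 k2 m
    refine (hkin T h Δt ε u0 _ _ _ _ _ hT hR l5 hε m hm hs σ hσ K hK x hx).trans ?_
    gcongr
    linarith
  · have hpos : ∀ᶠ ε : ℝ in 𝓝[>] 0, 0 < ε := eventually_mem_nhdsWithin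
    have hs : ∀ᶠ ε : ℝ in 𝓝[>] 0, X.StepBound Λ T h Δt ε c u0 _ (u ε n k 0) (f ε n k 0) m
        (u ε n k m) (f ε n k m) :=
      hpos.mono fun ε hε => hbound ε hε _ _ (hr ε hε) n hnN k k1 k2 m
    -- Nearness and the macroscopic increments are closed conditions with bounds free of `ε`. The
    -- bound on the increments of `f` degenerates like `h / ε` and is not needed in the limit.
    have hnear : X.IsNear T h c u0 (u' n k m) (f' n k m) :=
      Scheme.IsNear.of_tendsto (hs.mono fun _ hε => hε.near)
        (fun τ hτ => (hl n k k1 k2 m τ hτ).1) fun τ hτ => (hl n k k1 k2 m τ hτ).2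
    have hinc : ∀ τ ∈ dofs X.p T, ‖u' n k m τ - u' n k 0 τ + X.dt Δt m • (X.P *ᵥ
        fluxDeriv Λ (fun x => (fderiv ℝ X.maxw (u0 x)).comp (fderiv ℝ u0 x)) τ)‖ ≤
        c * Δt * h := fun τ hτ =>
      le_of_tendsto ((((hl n k k1 k2 m τ hτ).1.sub (hl n k k1 k2 0 τ hτ).1).add_const _).norm)
        (hs.mono fun _ hε => hε.inc_u τ hτ)
    obtain ⟨r1, r2, r3⟩ := hlim T h Δt u0 _ _ _ _ hT hR l4 hnear m hm hinc σ hσ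
    have he := herr h le_rfl
    exact ⟨r1, r2.trans he, fun K hK x hx => ⟨(r3 K hK x hx).1, (r3 K hK x hx).2.trans he⟩⟩

end

end IMEXRD

end

theorem mainTheorem2 {D q L S : ℕ} (hD : 1 ≤ D) (hS : 1 ≤ S)
    (Λ : Fin D → Fin L → ℝ) (A : Fin D → (Fin q → ℝ) → (Fin q → ℝ))
    (Ω : Set (Pt D)) (hΩ : IsOpen Ω) (κ : ℝ) (hκ : 0 < κ)
    (p : ℕ) (hp : 1 ≤ p) :
    -- the Galerkin residuals with jump stabilization are consistent
    (∀ θ : ℕ → ℝ, IsConsistentResidual p Λ Ω κ (galerkinJump p Λ θ)) ∧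
    -- the scheme built on any consistent residuals is asymptotic preserving
    ∀ X : Scheme D q L S, X.p = p → 1 ≤ X.iters →
      StrictMono X.c → X.c 0 = 0 → X.c (Fin.last S) = 1 →
      IsConsistentResidual p Λ Ω κ X.φ →
      (∃ lip, LipschitzWith lip X.maxw) →
    ∀ 𝒰 : Set (Fin q → ℝ), IsOpen 𝒰 → ContDiffOn ℝ 2 X.maxw 𝒰 →
      (∀ w ∈ 𝒰, X.P *ᵥ X.maxw w = w) →
      (∀ d, ∀ w ∈ 𝒰, X.P *ᵥ lam Λ d (X.maxw w) = A d w) →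
    -- the scheme is well defined for every `ε`
    (∀ (T : Mesh D) (h : ℝ), T.IsRegular Ω κ h → ∀ Δt > 0, ∀ (U0 : Pt D → Fin q → ℝ), ∀ ε > 0,
      ∃ (u : History D q S) (f : History D L S), X.IsRun ε T Δt U0 u f) ∧
    -- at fixed mesh and timestep its limit as `ε → 0` exists
    (∀ (T : Mesh D) (h : ℝ), T.IsRegular Ω κ h → ∀ Δt > 0, ∀ (U0 : Pt D → Fin q → ℝ)
        (u : ℝ → History D q S) (f : ℝ → History D L S),
      (∀ ε > 0, X.IsRun ε T Δt U0 (u ε) (f ε)) →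
      ∃ (u' : History D q S) (f' : History D L S), ∀ n k, 1 ≤ k → k ≤ X.iters → ∀ m, ∀ σ ∈ dofs p T,
        Tendsto (fun ε => u ε n k m σ) (𝓝[>] 0) (𝓝 (u' n k m σ)) ∧
        Tendsto (fun ε => f ε n k m σ) (𝓝[>] 0) (𝓝 (f' n k m σ))) ∧
    -- the asymptotic relations hold, with constants independent of `ε`, mesh, timestep and data
    (∀ 𝒦 ⊆ 𝒰, IsCompact 𝒦 → ∀ (R cfl : ℝ) (N : ℕ), ∃ C : ℝ, ∃ h0 > 0,
      ∀ (T : Mesh D) (h : ℝ), T.IsRegular Ω κ h → h ≤ h0 → ∀ Δt > 0, Δt ≤ cfl * h →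
      ∀ U0 : Pt D → Fin q → ℝ, GoodData p Ω 𝒦 R h T U0 →
        (∀ ε > 0, ∀ (u : History D q S) (f : History D L S), X.IsRun ε T Δt U0 u f →
          X.LimitRelations A 𝒰 T Δt N (C * (ε + h)) u f ∧
          X.KineticRelations Λ ε T Δt N (C * (h / ε + h)) u f) ∧
        (∀ (u : ℝ → History D q S) (f : ℝ → History D L S)
          (u' : History D q S) (f' : History D L S),
          (∀ ε > 0, X.IsRun ε T Δt U0 (u ε) (f ε)) →
          (∀ n k, 1 ≤ k → k ≤ X.iters → ∀ m, ∀ σ ∈ dofs p T,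
            Tendsto (fun ε => u ε n k m σ) (𝓝[>] 0) (𝓝 (u' n k m σ)) ∧
            Tendsto (fun ε => f ε n k m σ) (𝓝[>] 0) (𝓝 (f' n k m σ))) →
          X.LimitRelations A 𝒰 T Δt N (C * h) u' f')) := by
  refine ⟨isConsistentResidual_galerkinJump hD hp Λ Ω hκ, ?_⟩
  rintro X rfl hiters hmono hc0 hc1 hcons hlip 𝒰 h𝒰 hM hP hA
  have hX : X.IsAdmissible Λ Ω κ :=
    ⟨hD, hp, hiters, hκ, hmono, hc0, hc1, hcons, hlip⟩
  exact ⟨fun T h hT Δt hΔ U0 ε hε => hX.exists_isRun hT hΔ hε U0,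
    fun T h hT Δt hΔ U0 u f hr => hX.exists_limit hT hΔ hr,
    fun 𝒦 h𝒦 hc R cfl N => hX.exists_relations hΩ h𝒰 hM hP hA h𝒦 hc R cfl N⟩
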